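/- Let $d\in\mathbb N$, $\lambda>0$, $\sigma\ge 0$, $\theta^{\mathrm{opt}}\in\mathbb R^d$, and let $X_i=(Z_i,Y_i)$ be i.i.d. observations in $\mathbb R^d\times\mathbb R$ with $\mathbb E\|Z_1\|^4<\infty$ and $Y_i\mid Z_i\sim\mathcal N(Z_i^\top\theta^{\mathrm{opt}},\sigma^2)$. Let $X'_1$ and $\tilde X$ be independent copies of $X_1$, independent of each other and of $(X_i)$. Train by ridge regression, $$\hat\theta_l=\operatorname*{arg\,min}_{\theta\in\mathbb R^d}\ \frac1l\sum_{i\le l}(Y_i-Z_i^\top\theta)^2+\lambda\|\theta\|^2,$$ and evaluate under the squared loss $\mathcal L((z,y),\theta)=(y-z^\top\theta)^2$. Write $R(\theta)=\mathbb E\,\mathcal L(\tilde X,\theta)$, $\bar{\mathcal L}_l(x)=\mathbb E\,\mathcal L(x,\hat\theta_l)$, $\beta_1^l=\mathcal L(\tilde X,\hat\theta_l)-\mathcal L(\tilde X,\hat\theta_l^1)$, where $\hat\theta_l^1$ is trained with $X_1$ replaced by $X_1'$, and $$\sigma_1^2=\lim_{l\to\infty}\mathbb E\big[\operatorname{Var}(\mathcal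 L(\tilde X,\hat\theta_l)\mid\hat\theta_l)\big],\quad \sigma_2^2=\lim_{l\to\infty} l\operatorname{Var}(R(\hat\theta_l)),\quad \rho=\lim_{l_1,l_2\to\infty} l_1\operatorname{Cov}\big(\bar{\mathcal L}_{l_2}(X_1),\mathbb E[\beta_1^{l_1}\mid X_1]\big).$$ Let $\theta^*=\arg\min_\theta \mathbb E[(Y_1-Z_1^\top\theta)^2]+\lambda\|\theta\|^2$, $\Delta=\theta^*-\theta^{\mathrm{opt}}$, let $S_V$ denote the variance-covariance matrix of a random vector $V$, $S=S_{Z_1}$, $M=\mathbb E[Z_1Z_1^\top]$, and $\Sigma=\operatorname{Cov}(\partial_\theta\Psi(X_1,\theta^*))$, where $\Psi(x,\theta)=\mathcal L(x,\theta)+\lambda\|\theta\|^2$. (1) The limit $\rho$ exists and $$\rho=-2\Delta^\top M(M+\lambda I)^{-1}\big(S_{Z_1Z_1^\top\Delta}+2\sigma^2M\big)\Delta .$$ In particular, if $\mathbb E Z_1=0$, then $\rho=-2\Delta^\top S(S+\lambda I)^{-1}\big(S_{Z_1Z_1^\top\Delta}+2\sigma^2S\big)\Delta$. (2) If $Z_1\sim\mathcal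 N(0,S)$ (with $S$ possibly singular), then $\sigma_1^2,\sigma_2^2,\rho$ exist and $$\sigma_1^2=2(\Delta^\top S\Delta+\sigma^2)^2,\qquad \Sigma=4\big[(\Delta^\top S\Delta+\sigma^2)S+(S\Delta)(S\Delta)^\top\big],$$ $$\sigma_2^2=\Delta^\top S(S+\lambda I)^{-1}\Sigma(S+\lambda I)^{-1}S\Delta,\qquad \rho=-4(\Delta^\top S\Delta+\sigma^2)\,\Delta^\top S(S+\lambda I)^{-1}S\Delta .$$ Moreover $\rho\le 0$, and $\rho<0$ if and only if $S\theta^{\mathrm{opt}}\ne 0$. (3) Suppose in (2) that $\sigma>0$ and $S\theta^{\mathrm{opt}}\neq0$. Then the speed-up exceeds $K$ for every integer $K\ge2$: we have $\sigma_1^2+\sigma_2^2+2\rho>0$ and $$K\Big(1+\frac{2\rho}{\sigma_1^2+\sigma_2^2}\Big)^{-1}>K .$$ Furthermore, for fixed $K$ and any partitions of $\{1,\dots,n\}$ into $K$ folds whose sizes differ by at most one, the $K$-fold cross-validated risk $\hat R_{\mathrm{cv}}$ and the train-test split risk $\hat R_{\mathrm{split}}$ (one fold held out for testing, the others used for training)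 satisfy, as $n\to\infty$, $n\operatorname{Var}\hat R_{\mathrm{cv}}\to\sigma_1^2+\sigma_2^2+2\rho$, and $\operatorname{Var}\hat R_{\mathrm{split}}/\operatorname{Var}\hat R_{\mathrm{cv}}$ converges to a limit strictly larger than $K$. -/

import Mathlib

open MeasureTheory ProbabilityTheory Filter Topology
open scoped NNReal

/-! ### Cross-validation quantities for a general estimator and loss

A data set is a sequence `x : ℕ → 𝒳` of observations (indexed from `0`); an estimator
`f : Finset ℕ → (ℕ → 𝒳) → Θ` returns the parameter `f s x` fitted on the observations `x i`
with `i ∈ s`. The estimator trained on the first `l` observations is `f (Finset.range l)`. -/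

/-- `X 0, X 1, …` are i.i.d. observations, `X'` is the independent copy of `X 0` that is used to
replace it, and `Xt` is a further independent copy, the test observation: all of these variables
are jointly independent and have the same law. -/
structure IIDWithCopies {Ω 𝒳 : Type*} [MeasurableSpace Ω] [MeasurableSpace 𝒳]
    (X : ℕ → Ω → 𝒳) (X' Xt : Ω → 𝒳) (μ : Measure Ω) : Prop where
  measurable : ∀ i : ℕ ⊕ Fin 2, Measurable (Sum.elim X ![X', Xt] i)
  indep : iIndepFun (β := fun _ : ℕ ⊕ Fin 2 => 𝒳) (Sum.elim X ![X', Xt]) μ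
  ident : ∀ i : ℕ ⊕ Fin 2, IdentDistrib (Sum.elim X ![X', Xt] i) (X 0) μ μ

/-- The data set `(X 0 ω, X 1 ω, …)`. -/
def dataset {Ω 𝒳 : Type*} (X : ℕ → Ω → 𝒳) (ω : Ω) : ℕ → 𝒳 := fun i => X i ω

/-- The data set in which the first observation is replaced by `X'`. -/
def datasetReplaced {Ω 𝒳 : Type*} (X : ℕ → Ω → 𝒳) (X' : Ω → 𝒳) (ω : Ω) : ℕ → 𝒳 :=
  Function.update (dataset X ω) 0 (X' ω)

/-- The risk `R(θ) = 𝔼[L(Xt, θ)]` of a hypothesis `θ`. -/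
noncomputable def risk {Ω 𝒳 Θ : Type*} [MeasurableSpace Ω]
    (L : 𝒳 → Θ → ℝ) (Xt : Ω → 𝒳) (μ : Measure Ω) (θ : Θ) : ℝ :=
  ∫ ω, L (Xt ω) θ ∂μ

/-- The average loss `𝔼[L(x, f_l(X_{1:l}))]` at a fixed observation `x`. -/
noncomputable def meanLoss {Ω 𝒳 Θ : Type*} [MeasurableSpace Ω]
    (f : Finset ℕ → (ℕ → 𝒳) → Θ) (L : 𝒳 → Θ → ℝ) (X : ℕ → Ω → 𝒳) (μ : Measure Ω)
    (l : ℕ) (x : 𝒳) : ℝ :=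
  ∫ ω, L x (f (Finset.range l) (dataset X ω)) ∂μ

/-- First order stability: the change of the loss at the test observation when the first training
observation is replaced by its independent copy. -/
def stabilityOne {Ω 𝒳 Θ : Type*}
    (f : Finset ℕ → (ℕ → 𝒳) → Θ) (L : 𝒳 → Θ → ℝ) (X : ℕ → Ω → 𝒳) (X' Xt : Ω → 𝒳)
    (l : ℕ) (ω : Ω) : ℝ :=
  L (Xt ω) (f (Finset.range l) (dataset X ω))
    - L (Xt ω) (f (Finset.range l) (datasetReplaced X X' ω))

/-- `σ₁²` is the limit of `𝔼[Var(L(Xt, f_l(X_{1:l})) ∣ f_l(X_{1:l}))]` as `l → ∞`. -/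
def IsSigmaOneSq {Ω 𝒳 Θ : Type*} [MeasurableSpace Ω] [mΘ : MeasurableSpace Θ]
    (f : Finset ℕ → (ℕ → 𝒳) → Θ) (L : 𝒳 → Θ → ℝ) (X : ℕ → Ω → 𝒳) (Xt : Ω → 𝒳)
    (μ : Measure Ω) (s : ℝ) : Prop :=
  Tendsto (fun l : ℕ =>
      ∫ ω, (Var[fun ω' => L (Xt ω') (f (Finset.range l) (dataset X ω')); μ |
        mΘ.comap (fun ω' => f (Finset.range l) (dataset X ω'))]) ω ∂μ)
    atTop (𝓝 s)

/-- `σ₂²` is the limit of `l Var(R(f_l(X_{1:l})))` as `l → ∞`. -/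
def IsSigmaTwoSq {Ω 𝒳 Θ : Type*} [MeasurableSpace Ω]
    (f : Finset ℕ → (ℕ → 𝒳) → Θ) (L : 𝒳 → Θ → ℝ) (X : ℕ → Ω → 𝒳) (Xt : Ω → 𝒳)
    (μ : Measure Ω) (s : ℝ) : Prop :=
  Tendsto (fun l : ℕ =>
      (l : ℝ) * Var[fun ω => risk L Xt μ (f (Finset.range l) (dataset X ω)); μ])
    atTop (𝓝 s)

/-- `ρ` is the limit, as `l₁, l₂ → ∞` jointly, of `l₁` times the covariance of the average loss of
the estimator of size `l₂` at `X 0` and the conditional expectation given `X 0` of the first order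
stability of the estimator of size `l₁`. -/
def IsRho {Ω 𝒳 Θ : Type*} [MeasurableSpace Ω] [m𝒳 : MeasurableSpace 𝒳]
    (f : Finset ℕ → (ℕ → 𝒳) → Θ) (L : 𝒳 → Θ → ℝ) (X : ℕ → Ω → 𝒳) (X' Xt : Ω → 𝒳)
    (μ : Measure Ω) (r : ℝ) : Prop :=
  Tendsto (fun l : ℕ × ℕ =>
      (l.1 : ℝ) * cov[fun ω => meanLoss f L X μ l.2 (X 0 ω),
        μ[stabilityOne f L X X' Xt l.1 | m𝒳.comap (X 0)]; μ])
    (atTop ×ˢ atTop) (𝓝 r)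

/-- The cross-validated risk of the first `n` observations, where `b i` is the fold of `i`: each
observation is evaluated at the estimator trained on all folds but its own. -/
noncomputable def cvRisk {𝒳 Θ : Type*} {K : ℕ}
    (f : Finset ℕ → (ℕ → 𝒳) → Θ) (L : 𝒳 → Θ → ℝ) (b : ℕ → Fin K) (n : ℕ) (x : ℕ → 𝒳) : ℝ :=
  (n : ℝ)⁻¹ * ∑ i ∈ Finset.range n, L (x i) (f {k ∈ Finset.range n | b k ≠ b i} x)

/-- The train-test split risk of the first `n` observations: the estimator is trained on all folds
but the fold `j`, and evaluated on the fold `j`. -/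
noncomputable def splitRisk {𝒳 Θ : Type*} {K : ℕ}
    (f : Finset ℕ → (ℕ → 𝒳) → Θ) (L : 𝒳 → Θ → ℝ) (b : ℕ → Fin K) (j : Fin K) (n : ℕ)
    (x : ℕ → 𝒳) : ℝ :=
  ((K : ℝ) / n) * ∑ i ∈ Finset.range n with b i = j,
    L (x i) (f {k ∈ Finset.range n | b k ≠ j} x)

/-- The sizes of any two folds of `{0, …, n - 1}` differ by at most one. -/
def BalancedFolds {K : ℕ} (b : ℕ → Fin K) (n : ℕ) : Prop :=
  ∀ j j' : Fin K, ({i ∈ Finset.range n | b i = j}).card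
    ≤ ({i ∈ Finset.range n | b i = j'}).card + 1

/-! ### Ridge regression -/

/-- A minimiser of `g`, if there is one. -/
noncomputable def argmin {Θ : Type*} [Nonempty Θ] (g : Θ → ℝ) : Θ :=
  Classical.epsilon fun θ => ∀ θ', g θ ≤ g θ'

/-- The squared loss of `θ` at the observation `x = (z, y)`. -/
noncomputable def sqLoss {d : ℕ} (x : EuclideanSpace ℝ (Fin d) × ℝ)
    (θ : EuclideanSpace ℝ (Fin d)) : ℝ :=
  (x.2 - inner ℝ x.1 θ) ^ 2

/-- The ridge loss, which is used for training. -/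
noncomputable def ridgeLoss {d : ℕ} (lam : ℝ) (x : EuclideanSpace ℝ (Fin d) × ℝ)
    (θ : EuclideanSpace ℝ (Fin d)) : ℝ :=
  sqLoss x θ + lam * ‖θ‖ ^ 2

/-- The ridge estimator trained on the observations with index in `s`. -/
noncomputable def ridgeEstimator {d : ℕ} (lam : ℝ) (s : Finset ℕ)
    (x : ℕ → EuclideanSpace ℝ (Fin d) × ℝ) : EuclideanSpace ℝ (Fin d) :=
  argmin fun θ => (s.card : ℝ)⁻¹ * ∑ i ∈ s, sqLoss (x i) θ + lam * ‖θ‖ ^ 2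

/-- The minimiser `θ*` of the population ridge objective, where `V` has the law of an
observation. -/
noncomputable def ridgeTarget {Ω : Type*} [MeasurableSpace Ω] {d : ℕ} (lam : ℝ)
    (V : Ω → EuclideanSpace ℝ (Fin d) × ℝ) (μ : Measure Ω) : EuclideanSpace ℝ (Fin d) :=
  argmin fun θ => (∫ ω, sqLoss (V ω) θ ∂μ) + lam * ‖θ‖ ^ 2

/-- The variance-covariance matrix `S_V` of a random vector `V`. -/
noncomputable def covMatrix {Ω : Type*} [MeasurableSpace Ω] {d : ℕ}
    (V : Ω → EuclideanSpace ℝ (Fin d)) (μ : Measure Ω) : Matrix (Fin d) (Fin d) ℝ :=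
  Matrix.of fun i j => cov[fun ω => V ω i, fun ω => V ω j; μ]

/-- The second moment matrix `𝔼[V Vᵀ]` of a random vector `V`. -/
noncomputable def secondMomentMatrix {Ω : Type*} [MeasurableSpace Ω] {d : ℕ}
    (V : Ω → EuclideanSpace ℝ (Fin d)) (μ : Measure Ω) : Matrix (Fin d) (Fin d) ℝ :=
  Matrix.of fun i j => ∫ ω, V ω i * V ω j ∂μ

/-! ### Ridge regression: normal equations, error bounds, measurability. -/

section Ridge

variable {d : ℕ}

/-! Write θ for θ*, r for the residual at θ, s = r z for the score, M̂ for the empirical second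
moment operator, δ = θ̂ − θ, and G for the mean score minus λθ. The normal equations read (M̂ + λ)δ
= G, and M̂ ≥ 0 gives λ‖δ‖ ≤ ‖G‖. The risk is exactly quadratic: R(θ + δ) = R(θ) − 2λ⟨θ, δ⟩ + ⟨Mδ,
δ⟩. A random inverse is avoided by duality: if (M + λ)w = −λθ, symmetry of M̂ gives −λ⟨θ, δ⟩ = ⟨w,
G⟩ + ⟨δ, (M − M̂)w⟩. Hence R(θ̂) = R(θ) + 2⟨w, G⟩ + remainder, each term of the remainder being a
product of two fluctuations (`risk_ridgeEstimator`, `abs_ridgeRemainder_le`). Optimality of θ gives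
MΔ = −λθ, so w = (M + λ)⁻¹MΔ; this is the resolvent in all the formulas.

For ρ, conditioning, the replaced data set and the test point all drop out of the covariance, which
becomes Cov(L̄(X₁), R(θ̂)) (`covariance_condExp_stabilityOne`). Subtracting the risk of the fit
without X₁, which is independent of X₁, leaves 2⟨w, s(X₁)⟩ plus l times a difference of remainders.
A leave-one-out estimate with truncated leverage (`ridgeRemainder_leave_one_out`) shows that this
difference is negligible under four moments only. Since L̄ tends to r², ρ = 2 Cov(r², ⟨w, s⟩)
(`isRho`); substituting r = ε − ⟨Z, Δ⟩ with independent normal ε yields part (1).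

With Gaussian covariates eight moments are available and the remainder has second moment O(l⁻²). So
σ₂² = 4 Var⟨w, s⟩ (`isSigmaTwoSq`), while E r⁴ = 3(E r²)² at every parameter gives σ₁² = 2(E r²)²
(`isSigmaOneSq`). Isserlis' theorem evaluates the remaining moments. With v = E r², a = ⟨w, SΔ⟩, q =
⟨w, Sw⟩, D = ⟨Δ, SΔ⟩ the limits are 2v², 4(vq + a²) and −4va. From (S + λ)w = SΔ one gets a = q +
λ‖w‖², and positivity of S then gives q ≤ a ≤ D ≤ v; moreover a vanishes exactly when Sθopt does.

Cross-validation and the split are two choices of fold weights in one statistic. The same duality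
linearises each fold loss with an error bounded in L² (`exists_integral_sq_foldRemainder_le`), so
what survives is a sum of independent terms combining r² and ⟨w, s⟩
(`tendsto_mul_variance_foldStatistic`). In cross-validation every observation carries r² + 2⟨w, s⟩
in the limit, whose variance is σ₁² + σ₂² + 2ρ; in the split each observation serves only one
purpose and no covariance arises. The final inequalities follow from the ordering of q, a, D and v.
-/

/-- A function with a strict minimiser `θ₀` has `argmin` equal to `θ₀`. -/
lemma argmin_eq_of_strict {Θ : Type*} [Nonempty Θ] {g : Θ → ℝ} {θ₀ : Θ}
    (h : ∀ θ, θ ≠ θ₀ → g θ₀ < g θ) : argmin g = θ₀ := by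
  have hmin : ∀ θ', g (argmin g) ≤ g θ' :=
    Classical.epsilon_spec (p := fun θ => ∀ θ', g θ ≤ g θ') ⟨θ₀, fun θ' => by
      by_cases hθ : θ' = θ₀
      · rw [hθ]
      · exact (h θ' hθ).le⟩
  by_contra hne
  exact absurd (hmin θ₀) (not_le.mpr (h _ hne))

/-- A penalised quadratic function has a critical point, and it is the minimiser. -/
lemma argmin_quadratic (B : EuclideanSpace ℝ (Fin d) →L[ℝ] EuclideanSpace ℝ (Fin d)) (hsymm : ∀ u v, inner ℝ (B u) v = inner ℝ (B v) u)
    (hpos : ∀ v, 0 ≤ inner ℝ (B v) v) {lam : ℝ} (hlam : 0 < lam) (b : EuclideanSpace ℝ (Fin d)) (c : ℝ) (J : EuclideanSpace ℝ (Fin d) → ℝ)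
    (hJ : ∀ θ, J θ = c - 2 * inner ℝ b θ + inner ℝ (B θ) θ + lam * ‖θ‖ ^ 2) :
    B (argmin J) + lam • argmin J = b := by
  let A : EuclideanSpace ℝ (Fin d) →ₗ[ℝ] EuclideanSpace ℝ (Fin d) := (B : EuclideanSpace ℝ (Fin d) →ₗ[ℝ] EuclideanSpace ℝ (Fin d)) + lam • LinearMap.id
  have hA : ∀ v, A v = B v + lam • v := fun v => rfl
  have hinj : Function.Injective A := by
    refine (injective_iff_map_eq_zero A).2 fun v hv => ?_
    have h1 : inner ℝ (B v) v + lam * ‖v‖ ^ 2 = 0 := by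
      have := congrArg (fun u => inner ℝ u v) hv
      simpa [hA, inner_add_left, real_inner_smul_left, real_inner_self_eq_norm_sq] using this
    have h2 := hpos v
    have h3 : lam * ‖v‖ ^ 2 = 0 := le_antisymm (by linarith) (by positivity)
    simpa [hlam.ne'] using h3
  obtain ⟨θ₀, hθ₀⟩ := (LinearMap.injective_iff_surjective.1 hinj) b
  -- Completing the square at the critical point; the penalty makes the excess strictly positive
  -- away from it.
  have key : ∀ θ, J θ = J θ₀ + (inner ℝ (B (θ - θ₀)) (θ - θ₀) + lam * ‖θ - θ₀‖ ^ 2) := by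
    intro θ
    obtain ⟨v, rfl⟩ : ∃ v, θ = θ₀ + v := ⟨θ - θ₀, by abel⟩
    have h1 : inner ℝ b v = inner ℝ (B θ₀) v + lam * inner ℝ θ₀ v := by
      rw [← hθ₀, hA, inner_add_left, real_inner_smul_left]
    rw [hJ, hJ, add_sub_cancel_left, norm_add_sq_real]
    simp only [map_add, inner_add_left, inner_add_right]
    rw [h1, hsymm v θ₀]
    ring
  have : argmin J = θ₀ := by
    refine argmin_eq_of_strict fun θ hθ => ?_
    rw [key θ]
    have h1 := hpos (θ - θ₀)
    have h2 : 0 < ‖θ - θ₀‖ := norm_pos_iff.2 (sub_ne_zero.2 hθ)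
    have : 0 < lam * ‖θ - θ₀‖ ^ 2 := by positivity
    linarith
  rw [this, ← hA, hθ₀]

/-- The residual of the observation `x` under the parameter `θ`. -/
noncomputable def fitResidual (θ : EuclideanSpace ℝ (Fin d)) (x : EuclideanSpace ℝ (Fin d) × ℝ) : ℝ := x.2 - inner ℝ x.1 θ

/-- The residual times the covariate. -/
noncomputable def score (θ : EuclideanSpace ℝ (Fin d)) (x : EuclideanSpace ℝ (Fin d) × ℝ) : EuclideanSpace ℝ (Fin d) := fitResidual θ x • x.1

lemma sqLoss_eq (x : EuclideanSpace ℝ (Fin d) × ℝ) (θ : EuclideanSpace ℝ (Fin d)) : sqLoss x θ = fitResidual θ x ^ 2 := rfl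

lemma fitResidual_eq_sub (θ θ' : EuclideanSpace ℝ (Fin d)) (x : EuclideanSpace ℝ (Fin d) × ℝ) :
    fitResidual θ x = fitResidual θ' x - inner ℝ x.1 (θ - θ') := by
  simp only [fitResidual, inner_sub_right]; ring

@[fun_prop]
lemma continuous_fitResidual (θ : EuclideanSpace ℝ (Fin d)) : Continuous (fitResidual θ) := by
  unfold fitResidual; fun_prop

@[fun_prop]
lemma continuous_score (θ : EuclideanSpace ℝ (Fin d)) : Continuous (score θ) := by
  unfold score; fun_prop

/-- The empirical second moment operator of the covariates with index in `s`. -/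
noncomputable def empSecondMoment (s : Finset ℕ) (x : ℕ → EuclideanSpace ℝ (Fin d) × ℝ) : EuclideanSpace ℝ (Fin d) →L[ℝ] EuclideanSpace ℝ (Fin d) :=
  (s.card : ℝ)⁻¹ • ∑ i ∈ s, (innerSL ℝ (x i).1).smulRight (x i).1

lemma empSecondMoment_apply (s : Finset ℕ) (x : ℕ → EuclideanSpace ℝ (Fin d) × ℝ) (v : EuclideanSpace ℝ (Fin d)) :
    empSecondMoment s x v = (s.card : ℝ)⁻¹ • ∑ i ∈ s, inner ℝ (x i).1 v • (x i).1 := by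
  simp [empSecondMoment]

lemma inner_empSecondMoment (s : Finset ℕ) (x : ℕ → EuclideanSpace ℝ (Fin d) × ℝ) (u v : EuclideanSpace ℝ (Fin d)) :
    inner ℝ (empSecondMoment s x u) v
      = (s.card : ℝ)⁻¹ * ∑ i ∈ s, inner ℝ (x i).1 u * inner ℝ (x i).1 v := by
  simp [empSecondMoment_apply, real_inner_smul_left, sum_inner]

lemma inner_empSecondMoment_comm (s : Finset ℕ) (x : ℕ → EuclideanSpace ℝ (Fin d) × ℝ) (u v : EuclideanSpace ℝ (Fin d)) :
    inner ℝ (empSecondMoment s x u) v = inner ℝ (empSecondMoment s x v) u := by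
  simp only [inner_empSecondMoment]
  congr 1
  exact Finset.sum_congr rfl fun i _ => mul_comm _ _

lemma inner_empSecondMoment_self (s : Finset ℕ) (x : ℕ → EuclideanSpace ℝ (Fin d) × ℝ) (v : EuclideanSpace ℝ (Fin d)) :
    0 ≤ inner ℝ (empSecondMoment s x v) v := by
  rw [inner_empSecondMoment]
  exact mul_nonneg (by positivity) (Finset.sum_nonneg fun i _ => mul_self_nonneg _)

/-- The gradient of the ridge objective at `θ`, up to a factor `-2`. -/
noncomputable def ridgeScore (lam : ℝ) (θ : EuclideanSpace ℝ (Fin d)) (s : Finset ℕ) (x : ℕ → EuclideanSpace ℝ (Fin d) × ℝ) : EuclideanSpace ℝ (Fin d) :=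
  (s.card : ℝ)⁻¹ • ∑ i ∈ s, score θ (x i) - lam • θ

variable {lam : ℝ}

/-- The normal equations. -/
lemma ridgeEstimator_normal (hlam : 0 < lam) (s : Finset ℕ) (x : ℕ → EuclideanSpace ℝ (Fin d) × ℝ) :
    empSecondMoment s x (ridgeEstimator lam s x) + lam • ridgeEstimator lam s x
      = (s.card : ℝ)⁻¹ • ∑ i ∈ s, (x i).2 • (x i).1 := by
  refine argmin_quadratic (empSecondMoment s x) (inner_empSecondMoment_comm s x)
    (inner_empSecondMoment_self s x) hlam _ ((s.card : ℝ)⁻¹ * ∑ i ∈ s, (x i).2 ^ 2) _ fun θ => ?_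
  rw [inner_empSecondMoment, real_inner_smul_left, sum_inner]
  simp only [sqLoss, real_inner_smul_left, sub_sq, Finset.sum_add_distrib, Finset.sum_sub_distrib]
  have : ∑ i ∈ s, 2 * (x i).2 * inner ℝ (x i).1 θ = 2 * ∑ i ∈ s, (x i).2 * inner ℝ (x i).1 θ := by
    rw [Finset.mul_sum]; exact Finset.sum_congr rfl fun i _ => by ring
  rw [this]
  simp only [← pow_two]
  ring

/-- The normal equations recentred at an arbitrary reference point. All later error bounds pair this
identity with a suitable vector, so the random operator is never inverted. -/
lemma ridgeEstimator_sub (hlam : 0 < lam) (s : Finset ℕ) (x : ℕ → EuclideanSpace ℝ (Fin d) × ℝ) (θ : EuclideanSpace ℝ (Fin d)) :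
    empSecondMoment s x (ridgeEstimator lam s x - θ) + lam • (ridgeEstimator lam s x - θ)
      = ridgeScore lam θ s x := by
  have h := ridgeEstimator_normal hlam s x
  rw [map_sub, smul_sub, ridgeScore]
  have h2 : (s.card : ℝ)⁻¹ • ∑ i ∈ s, score θ (x i)
      = (s.card : ℝ)⁻¹ • ∑ i ∈ s, (x i).2 • (x i).1 - empSecondMoment s x θ := by
    rw [empSecondMoment_apply, ← smul_sub, ← Finset.sum_sub_distrib]
    simp only [score, fitResidual, sub_smul]
  rw [h2, ← h]
  abel

lemma ridgeScore_ridgeEstimator (hlam : 0 < lam) (s : Finset ℕ) (x : ℕ → EuclideanSpace ℝ (Fin d) × ℝ) :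
    ridgeScore lam (ridgeEstimator lam s x) s x = 0 := by
  simpa using (ridgeEstimator_sub hlam s x (ridgeEstimator lam s x)).symm

/-- Pairing the error equation with the error itself and dropping the nonnegative empirical
quadratic form; the penalty alone gives coercivity. -/
lemma norm_ridgeEstimator_sub_le (hlam : 0 < lam) (s : Finset ℕ) (x : ℕ → EuclideanSpace ℝ (Fin d) × ℝ) (θ : EuclideanSpace ℝ (Fin d)) :
    lam * ‖ridgeEstimator lam s x - θ‖ ≤ ‖ridgeScore lam θ s x‖ := by
  set δ := ridgeEstimator lam s x - θ with hδ
  have h := ridgeEstimator_sub hlam s x θ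
  rw [← hδ] at h
  have h1 : lam * ‖δ‖ ^ 2 ≤ ‖ridgeScore lam θ s x‖ * ‖δ‖ := by
    calc lam * ‖δ‖ ^ 2 ≤ inner ℝ (empSecondMoment s x δ) δ + lam * ‖δ‖ ^ 2 := by
          have := inner_empSecondMoment_self s x δ
          linarith
      _ = inner ℝ (ridgeScore lam θ s x) δ := by
          rw [← h, inner_add_left, real_inner_smul_left, real_inner_self_eq_norm_sq]
      _ ≤ _ := real_inner_le_norm _ _
  rcases (norm_nonneg δ).eq_or_lt with h0 | h0
  · rw [← h0]; simp
  · nlinarith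

/-- Pairing the normal equations with the estimator bounds each summand by yp − p² ≤ y². The bound
is crude, but it involves only the responses and serves for integrability. -/
lemma norm_sq_ridgeEstimator_le (hlam : 0 < lam) (s : Finset ℕ) (x : ℕ → EuclideanSpace ℝ (Fin d) × ℝ) :
    ‖ridgeEstimator lam s x‖ ^ 2 ≤ lam⁻¹ * ∑ i ∈ s, (x i).2 ^ 2 := by
  set θ := ridgeEstimator lam s x with hθ
  have h := congrArg (fun u => inner ℝ u θ) (ridgeEstimator_normal hlam s x)
  simp only [← hθ, inner_add_left, real_inner_smul_left, inner_empSecondMoment, sum_inner,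
    real_inner_self_eq_norm_sq] at h
  have h1 : lam * ‖θ‖ ^ 2 = (s.card : ℝ)⁻¹ *
      ∑ i ∈ s, ((x i).2 * inner ℝ (x i).1 θ - inner ℝ (x i).1 θ * inner ℝ (x i).1 θ) := by
    rw [Finset.sum_sub_distrib]; linarith
  have h2 : ∑ i ∈ s, ((x i).2 * inner ℝ (x i).1 θ - inner ℝ (x i).1 θ * inner ℝ (x i).1 θ)
      ≤ ∑ i ∈ s, (x i).2 ^ 2 := Finset.sum_le_sum fun i _ => by
    nlinarith [sq_nonneg ((x i).2 - inner ℝ (x i).1 θ), sq_nonneg ((x i).2)]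
  have h3 : (s.card : ℝ)⁻¹ ≤ 1 := Nat.cast_inv_le_one _
  have h4 : 0 ≤ ∑ i ∈ s, (x i).2 ^ 2 := Finset.sum_nonneg fun i _ => sq_nonneg _
  have h5 : lam * ‖θ‖ ^ 2 ≤ ∑ i ∈ s, (x i).2 ^ 2 := by
    rw [h1]
    calc _ ≤ (s.card : ℝ)⁻¹ * ∑ i ∈ s, (x i).2 ^ 2 :=
          mul_le_mul_of_nonneg_left h2 (by positivity)
      _ ≤ _ := mul_le_of_le_one_left h4 h3
  rw [inv_mul_eq_div, le_div_iff₀ hlam]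
  linarith

@[fun_prop]
lemma continuous_ridgeScore (θ : EuclideanSpace ℝ (Fin d)) (s : Finset ℕ) :
    Continuous (ridgeScore lam θ s : (ℕ → EuclideanSpace ℝ (Fin d) × ℝ) → EuclideanSpace ℝ (Fin d)) := by
  unfold ridgeScore score fitResidual
  fun_prop

/-- The estimator is defined by a choice of minimiser, so regularity needs an argument: take the fit
at x₀ as reference point. Its score vanishes at x₀ and is continuous in the data, and it controls
the distance of the fits. -/
lemma continuous_ridgeEstimator (hlam : 0 < lam) (s : Finset ℕ) :
    Continuous (ridgeEstimator lam s : (ℕ → EuclideanSpace ℝ (Fin d) × ℝ) → EuclideanSpace ℝ (Fin d)) := by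
  rw [continuous_iff_continuousAt]
  intro x₀
  set θ₀ := ridgeEstimator lam s x₀ with hθ₀
  have h0 : Tendsto (fun x => lam⁻¹ * ‖ridgeScore lam θ₀ s x‖) (𝓝 x₀) (𝓝 0) := by
    have : Continuous fun x : ℕ → EuclideanSpace ℝ (Fin d) × ℝ => lam⁻¹ * ‖ridgeScore lam θ₀ s x‖ := by fun_prop
    simpa [hθ₀, ridgeScore_ridgeEstimator hlam] using this.tendsto x₀
  rw [ContinuousAt, tendsto_iff_norm_sub_tendsto_zero]
  refine squeeze_zero (fun _ => norm_nonneg _) (fun x => ?_) h0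
  rw [inv_mul_eq_div, le_div_iff₀ hlam, mul_comm]
  exact norm_ridgeEstimator_sub_le hlam s x _

lemma measurable_ridgeEstimator (hlam : 0 < lam) (s : Finset ℕ) :
    Measurable (ridgeEstimator lam s : (ℕ → EuclideanSpace ℝ (Fin d) × ℝ) → EuclideanSpace ℝ (Fin d)) :=
  (continuous_ridgeEstimator hlam s).measurable

lemma dependsOn_ridgeEstimator (s : Finset ℕ) :
    DependsOn (ridgeEstimator lam s : (ℕ → EuclideanSpace ℝ (Fin d) × ℝ) → EuclideanSpace ℝ (Fin d)) s := by
  intro x y h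
  unfold ridgeEstimator
  congr 1
  funext θ
  congr 2
  exact Finset.sum_congr rfl fun i hi => by rw [h i hi]

lemma dependsOn_ridgeScore (θ : EuclideanSpace ℝ (Fin d)) (s : Finset ℕ) :
    DependsOn (ridgeScore lam θ s : (ℕ → EuclideanSpace ℝ (Fin d) × ℝ) → EuclideanSpace ℝ (Fin d)) s := by
  intro x y h
  unfold ridgeScore
  congr 2
  exact Finset.sum_congr rfl fun i hi => by rw [h i hi]

lemma dependsOn_empSecondMoment (s : Finset ℕ) :
    DependsOn (empSecondMoment s : (ℕ → EuclideanSpace ℝ (Fin d) × ℝ) → _) s := by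
  intro x y h
  unfold empSecondMoment
  congr 1
  exact Finset.sum_congr rfl fun i hi => by rw [h i hi]

end Ridge

/-! ### Linearisation of the risk and leave-one-out stability of its remainder. -/

section Expansion

variable {d : ℕ} {lam : ℝ}

/-- The remainder in the linearisation of the risk of the ridge estimator around `θ`: here `M` is
the second moment operator of the covariates and `w` is the direction in which the empirical score
enters the linear part. -/
noncomputable def ridgeRemainder (lam : ℝ) (M : EuclideanSpace ℝ (Fin d) →L[ℝ] EuclideanSpace ℝ (Fin d)) (θ w : EuclideanSpace ℝ (Fin d)) (s : Finset ℕ)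
    (x : ℕ → EuclideanSpace ℝ (Fin d) × ℝ) : ℝ :=
  2 * inner ℝ (ridgeEstimator lam s x - θ) (M w - empSecondMoment s x w)
    + inner ℝ (M (ridgeEstimator lam s x - θ)) (ridgeEstimator lam s x - θ)

variable {M : EuclideanSpace ℝ (Fin d) →L[ℝ] EuclideanSpace ℝ (Fin d)} {θ w : EuclideanSpace ℝ (Fin d)}

/-- The duality step: test the error equation against w and move the symmetric empirical operator
onto w. Replacing it by M costs one product of fluctuations. -/
lemma neg_inner_ridgeEstimator_sub (hlam : 0 < lam)
    (hw : M w + lam • w = -(lam • θ)) (s : Finset ℕ) (x : ℕ → EuclideanSpace ℝ (Fin d) × ℝ) :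
    -(lam * inner ℝ θ (ridgeEstimator lam s x - θ)) = inner ℝ w (ridgeScore lam θ s x)
      + inner ℝ (ridgeEstimator lam s x - θ) (M w - empSecondMoment s x w) := by
  set δ := ridgeEstimator lam s x - θ with hδ
  have h1 : -(lam * inner ℝ θ δ) = inner ℝ (M w) δ + lam * inner ℝ w δ := by
    rw [← real_inner_smul_left, ← inner_neg_left, ← hw, inner_add_left, real_inner_smul_left]
  have h2 : inner ℝ w (ridgeScore lam θ s x)
      = inner ℝ (empSecondMoment s x w) δ + lam * inner ℝ w δ := by
    rw [← ridgeEstimator_sub hlam s x θ, ← hδ, inner_add_right, real_inner_smul_right,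
      real_inner_comm, inner_empSecondMoment_comm]
  rw [h1, h2, inner_sub_right δ, real_inner_comm (M w) δ, real_inner_comm (empSecondMoment s x w) δ]
  ring

lemma quadratic_ridgeEstimator_sub (hlam : 0 < lam)
    (hw : M w + lam • w = -(lam • θ)) (s : Finset ℕ) (x : ℕ → EuclideanSpace ℝ (Fin d) × ℝ) :
    -(2 * (lam * inner ℝ θ (ridgeEstimator lam s x - θ)))
      + inner ℝ (M (ridgeEstimator lam s x - θ)) (ridgeEstimator lam s x - θ)
      = 2 * inner ℝ w (ridgeScore lam θ s x) + ridgeRemainder lam M θ w s x := by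
  have := neg_inner_ridgeEstimator_sub hlam hw s x
  rw [ridgeRemainder]
  linarith

lemma inner_apply_self_le (M : EuclideanSpace ℝ (Fin d) →L[ℝ] EuclideanSpace ℝ (Fin d)) (u v : EuclideanSpace ℝ (Fin d)) : |inner ℝ (M u) v| ≤ ‖M‖ * ‖u‖ * ‖v‖ :=
  (abs_real_inner_le_norm _ _).trans
    (mul_le_mul_of_nonneg_right (M.le_opNorm u) (norm_nonneg v))

/-- Both terms are products of two small factors, so the arithmetic-geometric mean inequality leaves
only squares of mean deviations. -/
lemma abs_ridgeRemainder_le (hlam : 0 < lam) (s : Finset ℕ) (x : ℕ → EuclideanSpace ℝ (Fin d) × ℝ) :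
    |ridgeRemainder lam M θ w s x| ≤ (lam⁻¹ ^ 2 * (1 + ‖M‖)) * ‖ridgeScore lam θ s x‖ ^ 2
      + ‖M w - empSecondMoment s x w‖ ^ 2 := by
  set δ := ridgeEstimator lam s x - θ with hδ
  have h0 : ‖δ‖ ≤ lam⁻¹ * ‖ridgeScore lam θ s x‖ := by
    rw [inv_mul_eq_div, le_div_iff₀ hlam, mul_comm]
    exact norm_ridgeEstimator_sub_le hlam s x θ
  have h1 : ‖δ‖ ^ 2 ≤ lam⁻¹ ^ 2 * ‖ridgeScore lam θ s x‖ ^ 2 := by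
    rw [← mul_pow]; exact pow_le_pow_left₀ (norm_nonneg _) h0 2
  have h2 := inner_apply_self_le M δ δ
  have h3 := abs_real_inner_le_norm δ (M w - empSecondMoment s x w)
  have h4 : |ridgeRemainder lam M θ w s x| ≤ 2 * |inner ℝ δ (M w - empSecondMoment s x w)|
      + |inner ℝ (M δ) δ| := by
    rw [ridgeRemainder, ← hδ]
    refine (abs_add_le _ _).trans (le_of_eq ?_)
    rw [abs_mul, abs_two]
  have h5 : 2 * (‖δ‖ * ‖M w - empSecondMoment s x w‖)
      ≤ ‖δ‖ ^ 2 + ‖M w - empSecondMoment s x w‖ ^ 2 := by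
    nlinarith [sq_nonneg (‖δ‖ - ‖M w - empSecondMoment s x w‖)]
  have h6 : (1 + ‖M‖) * ‖δ‖ ^ 2 ≤ (1 + ‖M‖) * (lam⁻¹ ^ 2 * ‖ridgeScore lam θ s x‖ ^ 2) :=
    mul_le_mul_of_nonneg_left h1 (by positivity)
  nlinarith

/-- The relative leverage bound of an observation in a sample of size `l`. -/
noncomputable def leverageBound (lam : ℝ) (l : ℕ) (x : EuclideanSpace ℝ (Fin d) × ℝ) : ℝ :=
  min 1 (‖x.1‖ ^ 2 / (lam * l))

/-- A polynomial bound on the functions of one observation that appear in the expansion. -/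
noncomputable def obsBound (θ : EuclideanSpace ℝ (Fin d)) (x : EuclideanSpace ℝ (Fin d) × ℝ) : ℝ := 1 + ‖x.1‖ ^ 2 + fitResidual θ x ^ 2

/-- Deleting an observation means setting it to zero while keeping the factor 1/l. The change is
then exactly a rank-one term, with no renormalisation. -/
lemma empSecondMoment_update (l : ℕ) (x : ℕ → EuclideanSpace ℝ (Fin d) × ℝ) (hl : 0 < l) (v : EuclideanSpace ℝ (Fin d)) :
    empSecondMoment (Finset.range l) x v
      = empSecondMoment (Finset.range l) (Function.update x 0 0) v
        + ((l : ℝ)⁻¹ * inner ℝ (x 0).1 v) • (x 0).1 := by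
  obtain ⟨m, rfl⟩ := Nat.exists_eq_add_of_lt hl
  simp only [empSecondMoment_apply, Finset.card_range, zero_add, Finset.sum_range_succ',
    Function.update_self, Function.update_of_ne (Nat.succ_ne_zero _)]
  simp [smul_add, smul_smul]

lemma ridgeScore_update (l : ℕ) (x : ℕ → EuclideanSpace ℝ (Fin d) × ℝ) (hl : 0 < l) :
    ridgeScore lam θ (Finset.range l) x
      = ridgeScore lam θ (Finset.range l) (Function.update x 0 0)
        + (l : ℝ)⁻¹ • score θ (x 0) := by
  obtain ⟨m, rfl⟩ := Nat.exists_eq_add_of_lt hl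
  simp only [ridgeScore, Finset.card_range, zero_add, Finset.sum_range_succ',
    Function.update_self, Function.update_of_ne (Nat.succ_ne_zero _)]
  simp [score, smul_add]
  abel

/-- Removing the first observation: the change `η` of the estimator, and of the fitted value at
the removed observation. -/
lemma leave_one_out_bounds (hlam : 0 < lam) (l : ℕ) (hl : 0 < l) (x : ℕ → EuclideanSpace ℝ (Fin d) × ℝ) (θ₀ η : EuclideanSpace ℝ (Fin d))
    (hθ₀ : θ₀ = ridgeEstimator lam (Finset.range l) (Function.update x 0 0))
    (hη : η = ridgeEstimator lam (Finset.range l) x - θ₀) :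
    |inner ℝ (x 0).1 η| ≤ leverageBound lam l (x 0) * |fitResidual θ₀ (x 0)| ∧
    l * ‖η‖ ≤ lam⁻¹ * (‖(x 0).1‖ * |fitResidual θ₀ (x 0)|) ∧
    l * ‖η‖ ^ 2 ≤ lam⁻¹ * (leverageBound lam l (x 0) * fitResidual θ₀ (x 0) ^ 2) := by
  have hl' : (0 : ℝ) < l := by exact_mod_cast hl
  set r := fitResidual θ₀ (x 0) with hr
  set p := inner ℝ (x 0).1 η with hp
  set U := ‖(x 0).1‖ with hU
  -- The score of the deleted sample vanishes at its own fit θ₀, so only the score of the restored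
  -- observation drives η.
  have h1 := ridgeEstimator_sub hlam (Finset.range l) x θ₀
  rw [ridgeScore_update l x hl, hθ₀, ridgeScore_ridgeEstimator hlam, ← hθ₀, ← hη, zero_add] at h1
  have h2 := congrArg (fun u => inner ℝ u η) h1
  simp only [inner_add_left, real_inner_smul_left, real_inner_self_eq_norm_sq, score,
    ← hr, ← hp] at h2
  have h3 : (l : ℝ)⁻¹ * (p * p) ≤ inner ℝ (empSecondMoment (Finset.range l) x η) η := by
    rw [inner_empSecondMoment, Finset.card_range]
    refine mul_le_mul_of_nonneg_left ?_ (by positivity)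
    exact Finset.single_le_sum (f := fun i => inner ℝ (x i).1 η * inner ℝ (x i).1 η)
      (fun i _ => mul_self_nonneg _) (Finset.mem_range.2 hl)
  -- Of the empirical quadratic form only the contribution of observation 0 is kept. This inequality
  -- yields both entries of the leverage minimum: p² ≤ rp gives the 1, and the penalty gives
  -- ‖z‖²/(λl).
  have h4 : p * p + l * (lam * ‖η‖ ^ 2) ≤ r * p := by
    have h5 : (l : ℝ)⁻¹ * (p * p) + lam * ‖η‖ ^ 2 ≤ (l : ℝ)⁻¹ * (r * p) := by linarith
    have := mul_le_mul_of_nonneg_left h5 hl'.le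
    rw [mul_add, mul_inv_cancel_left₀ hl'.ne', mul_inv_cancel_left₀ hl'.ne'] at this
    exact this
  have hrp : r * p ≤ |r| * |p| := by rw [← abs_mul]; exact le_abs_self _
  have hpp : p * p = |p| * |p| := (abs_mul_abs_self p).symm
  have hnn : 0 ≤ l * (lam * ‖η‖ ^ 2) := by positivity
  have hpU : |p| ≤ U * ‖η‖ := abs_real_inner_le_norm _ _
  have hA : |p| ≤ |r| := by
    rcases (abs_nonneg p).eq_or_lt with h0 | h0
    · rw [← h0]; exact abs_nonneg r
    · nlinarith
  have hB : l * (lam * ‖η‖) ≤ U * |r| := by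
    rcases (norm_nonneg η).eq_or_lt with h0 | h0
    · rw [← h0]; simp only [mul_zero]; positivity
    · have h6 : |r| * |p| ≤ |r| * (U * ‖η‖) := mul_le_mul_of_nonneg_left hpU (abs_nonneg r)
      have h7 : l * (lam * ‖η‖) * ‖η‖ ≤ U * |r| * ‖η‖ := by
        nlinarith [mul_self_nonneg p]
      exact le_of_mul_le_mul_right h7 h0
  have hC : |p| ≤ U ^ 2 / (lam * l) * |r| := by
    rw [div_mul_eq_mul_div, le_div_iff₀ (by positivity)]
    calc |p| * (lam * l) ≤ U * ‖η‖ * (lam * l) :=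
          mul_le_mul_of_nonneg_right hpU (by positivity)
      _ = U * (l * (lam * ‖η‖)) := by ring
      _ ≤ U * (U * |r|) := mul_le_mul_of_nonneg_left hB (norm_nonneg _)
      _ = U ^ 2 * |r| := by ring
  have hD : |p| ≤ leverageBound lam l (x 0) * |r| := by
    rw [leverageBound, min_mul_of_nonneg _ _ (abs_nonneg r), one_mul]
    exact le_min hA hC
  refine ⟨hD, ?_, ?_⟩
  · rw [inv_mul_eq_div, le_div_iff₀ hlam]; linarith
  · rw [inv_mul_eq_div, le_div_iff₀ hlam]
    have h6 : |r| * |p| ≤ |r| * (leverageBound lam l (x 0) * |r|) :=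
      mul_le_mul_of_nonneg_left hD (abs_nonneg r)
    have h7 : |r| * (leverageBound lam l (x 0) * |r|) = leverageBound lam l (x 0) * r ^ 2 := by
      rw [← sq_abs r]; ring
    nlinarith [mul_self_nonneg p]

/-- The arithmetic of the leave-one-out bound. -/
lemma leave_one_out_arith {a U q R ε N m P V W K L A p t₁ t₂ t₃ t₄ t₅ : ℝ} (ha : 0 ≤ a)
    (hU : 0 ≤ U) (hR : 0 ≤ R) (hε : 0 ≤ ε) (hN : 0 ≤ N) (hm : 0 ≤ m) (hW : 0 ≤ W)
    (hK : 0 ≤ K) (hP : P = 1 + U ^ 2 + q ^ 2) (hV : V = N + ε + N ^ 2 + ε ^ 2)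
    (hRq : R ≤ q + U * ε) (hp : p ≤ m * R) (hA : L * A ≤ a * (U * R))
    (hA2 : L * A ^ 2 ≤ a * (m * R ^ 2))
    (ht₁ : t₁ ≤ L * (A * N)) (ht₂ : t₂ ≤ (U * W) * (U * ε)) (ht₃ : t₃ ≤ (U * W) * p)
    (ht₄ : t₄ ≤ L * (K * A * ε)) (ht₅ : t₅ ≤ L * (K * A * A)) :
    2 * t₁ + 2 * t₂ + 2 * t₃ + 2 * t₄ + t₅
      ≤ (2 * a + 4 * W + 4 * K * a) * (P * V + P * m * (1 + V)) := by
  have hP0 : 0 ≤ P := by rw [hP]; positivity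
  have hV0 : 0 ≤ V := by rw [hV]; positivity
  obtain ⟨hUq, hU2, hq2⟩ : U * q ≤ P ∧ U ^ 2 ≤ P ∧ q ^ 2 ≤ P := by
    have h1 := sq_nonneg (U - q)
    have h2 := sq_nonneg U
    have h3 := sq_nonneg q
    rw [sub_sq] at h1
    refine ⟨?_, ?_, ?_⟩ <;> linarith
  -- The residual at the leave-one-out fit depends on the other data; it is traded for the residual
  -- q at the fixed θ, at the price Uε. Afterwards everything separates into P times functions of ε,
  -- N and m.
  have hUR : U * R ≤ P * (1 + ε) := by
    calc U * R ≤ U * (q + U * ε) := mul_le_mul_of_nonneg_left hRq hU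
      _ = U * q + U ^ 2 * ε := by ring
      _ ≤ P + P * ε := add_le_add hUq (mul_le_mul_of_nonneg_right hU2 hε)
      _ = _ := by ring
  have hR2 : R ^ 2 ≤ 2 * (P * (1 + ε ^ 2)) := by
    calc R ^ 2 ≤ (q + U * ε) ^ 2 := pow_le_pow_left₀ hR hRq 2
      _ ≤ 2 * (q ^ 2 + U ^ 2 * ε ^ 2) := by linarith [sq_nonneg (q - U * ε)]
      _ ≤ 2 * (P + P * ε ^ 2) := by
        have := mul_le_mul_of_nonneg_right hU2 (sq_nonneg ε)
        linarith
      _ = _ := by ring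
  obtain ⟨hV1, hV2, hV3, hV4⟩ : (1 + ε) * N ≤ V ∧ ε ≤ V ∧ (1 + ε) * ε ≤ V ∧ ε ^ 2 ≤ V := by
    have h1 := sq_nonneg (ε - N)
    have h2 := sq_nonneg ε
    have h3 := sq_nonneg N
    rw [sub_sq] at h1
    refine ⟨?_, ?_, ?_, ?_⟩ <;> linarith
  have hLA : L * A ≤ a * (P * (1 + ε)) := hA.trans (mul_le_mul_of_nonneg_left hUR ha)
  have s1 : t₁ ≤ a * (P * V) := by
    calc t₁ ≤ (L * A) * N := by linarith
      _ ≤ (a * (P * (1 + ε))) * N := mul_le_mul_of_nonneg_right hLA hN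
      _ = a * (P * ((1 + ε) * N)) := by ring
      _ ≤ _ := mul_le_mul_of_nonneg_left (mul_le_mul_of_nonneg_left hV1 hP0) ha
  have s2 : t₂ ≤ W * (P * V) := by
    calc t₂ ≤ W * (U ^ 2 * ε) := by linarith
      _ ≤ _ := mul_le_mul_of_nonneg_left (mul_le_mul hU2 hV2 hε hP0) hW
  have s3 : t₃ ≤ W * (P * m * (1 + V)) := by
    calc t₃ ≤ (U * W) * (m * R) := ht₃.trans (mul_le_mul_of_nonneg_left hp (mul_nonneg hU hW))
      _ = W * m * (U * R) := by ring
      _ ≤ W * m * (P * (1 + V)) := mul_le_mul_of_nonneg_left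
        (hUR.trans (mul_le_mul_of_nonneg_left (by linarith) hP0)) (mul_nonneg hW hm)
      _ = _ := by ring
  have s4 : t₄ ≤ K * a * (P * V) := by
    calc t₄ ≤ K * ε * (L * A) := by linarith
      _ ≤ K * ε * (a * (P * (1 + ε))) := mul_le_mul_of_nonneg_left hLA (mul_nonneg hK hε)
      _ = K * a * (P * ((1 + ε) * ε)) := by ring
      _ ≤ _ := mul_le_mul_of_nonneg_left (mul_le_mul_of_nonneg_left hV3 hP0) (mul_nonneg hK ha)
  have s5 : t₅ ≤ 2 * (K * a * (P * m * (1 + V))) := by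
    calc t₅ ≤ K * (L * A ^ 2) := by linarith
      _ ≤ K * (a * (m * (2 * (P * (1 + V))))) := by
        refine mul_le_mul_of_nonneg_left (hA2.trans (mul_le_mul_of_nonneg_left
          (mul_le_mul_of_nonneg_left (hR2.trans ?_) hm) ha)) hK
        exact mul_le_mul_of_nonneg_left (mul_le_mul_of_nonneg_left (by linarith) hP0) two_pos.le
      _ = _ := by ring
  have z1 : 0 ≤ P * V := mul_nonneg hP0 hV0
  have z2 : 0 ≤ P * m * (1 + V) := mul_nonneg (mul_nonneg hP0 hm) (by linarith)
  have z3 := mul_nonneg hK ha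
  linarith [mul_nonneg hW z1, mul_nonneg hW z2, mul_nonneg z3 z1, mul_nonneg z3 z2,
    mul_nonneg ha z1, mul_nonneg ha z2]

/-- Every term of the scaled difference is of degree at most two in the deleted observation, times
either V, which is independent of it and small, or the leverage bound, which is at most 1 and tends
to 0. Without truncating the leverage the degree would be higher and four moments would not suffice
for ρ. -/
lemma ridgeRemainder_leave_one_out (hlam : 0 < lam)
    (hM : ∀ u v, inner ℝ (M u) v = inner ℝ (M v) u) (l : ℕ) (hl : 0 < l) (x : ℕ → EuclideanSpace ℝ (Fin d) × ℝ)
    (x₀ : ℕ → EuclideanSpace ℝ (Fin d) × ℝ) (hx₀ : x₀ = Function.update x 0 0) (V : ℝ)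
    (hV : V = ‖M w - empSecondMoment (Finset.range l) x₀ w‖
      + ‖ridgeEstimator lam (Finset.range l) x₀ - θ‖
      + ‖M w - empSecondMoment (Finset.range l) x₀ w‖ ^ 2
      + ‖ridgeEstimator lam (Finset.range l) x₀ - θ‖ ^ 2) :
    l * |ridgeRemainder lam M θ w (Finset.range l) x
        - ridgeRemainder lam M θ w (Finset.range l) x₀|
      ≤ (2 * lam⁻¹ + 4 * ‖w‖ + 4 * ‖M‖ * lam⁻¹) *
        (obsBound θ (x 0) * V + obsBound θ (x 0) * leverageBound lam l (x 0) * (1 + V)) := by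
  have hl' : (0 : ℝ) < l := by exact_mod_cast hl
  set θ₀ := ridgeEstimator lam (Finset.range l) x₀ with hθ₀
  set e := θ₀ - θ with he
  set η := ridgeEstimator lam (Finset.range l) x - θ₀ with hη
  set n := M w - empSecondMoment (Finset.range l) x₀ w with hn
  set U := ‖(x 0).1‖ with hU
  set r := fitResidual θ₀ (x 0) with hr
  set P := obsBound θ (x 0) with hP
  set m := leverageBound lam l (x 0) with hm
  obtain ⟨hb1, hb2, hb3⟩ := leave_one_out_bounds hlam l hl x θ₀ η (by rw [hθ₀, hx₀]) hη
  rw [← hr, ← hm] at hb1 hb3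
  rw [← hr, ← hU] at hb2
  have hm0 : 0 ≤ m := le_min zero_le_one (by positivity)
  have hU0 : 0 ≤ U := norm_nonneg _
  have hε0 : 0 ≤ ‖e‖ := norm_nonneg _
  have hN0 : 0 ≤ ‖n‖ := norm_nonneg _
  have hli : 0 < lam⁻¹ := inv_pos.2 hlam
  have hδ : ridgeEstimator lam (Finset.range l) x - θ = e + η := by rw [hη, he]; abel
  have hMx : M w - empSecondMoment (Finset.range l) x w
      = n - ((l : ℝ)⁻¹ * inner ℝ (x 0).1 w) • (x 0).1 := by
    rw [empSecondMoment_update l x hl, ← hx₀, hn]; abel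
  -- The second and third terms come from the rank-one change of the empirical operator, whose
  -- factor 1/l cancels l; the others from the change η of the fit.
  have hdiff : l * (ridgeRemainder lam M θ w (Finset.range l) x
        - ridgeRemainder lam M θ w (Finset.range l) x₀)
      = 2 * (l * inner ℝ η n) - 2 * (inner ℝ (x 0).1 w * inner ℝ (x 0).1 e)
        - 2 * (inner ℝ (x 0).1 w * inner ℝ (x 0).1 η)
        + 2 * (l * inner ℝ (M η) e) + l * inner ℝ (M η) η := by
    rw [ridgeRemainder, ridgeRemainder, hδ, hMx, ← hθ₀, ← he, ← hn, map_add]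
    simp only [inner_add_left, inner_add_right, inner_sub_right, real_inner_smul_right]
    rw [hM e η, real_inner_comm (x 0).1 e, real_inner_comm (x 0).1 η]
    field_simp
    ring
  have hr1 : |r| ≤ |fitResidual θ (x 0)| + U * ‖e‖ := by
    rw [hr, fitResidual_eq_sub θ₀ θ, ← he]
    exact (abs_sub _ _).trans (add_le_add le_rfl (abs_real_inner_le_norm _ _))
  have habs : l * |ridgeRemainder lam M θ w (Finset.range l) x
        - ridgeRemainder lam M θ w (Finset.range l) x₀|
      ≤ 2 * (l * |inner ℝ η n|) + 2 * (|inner ℝ (x 0).1 w| * |inner ℝ (x 0).1 e|)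
        + 2 * (|inner ℝ (x 0).1 w| * |inner ℝ (x 0).1 η|)
        + 2 * (l * |inner ℝ (M η) e|) + l * |inner ℝ (M η) η| := by
    rw [← abs_of_pos hl', ← abs_mul, abs_of_pos hl', hdiff]
    refine (abs_add_le _ _).trans (add_le_add ((abs_add_le _ _).trans (add_le_add
      ((abs_sub _ _).trans (add_le_add ((abs_sub _ _).trans (add_le_add ?_ ?_)) ?_)) ?_)) ?_) <;>
    simp [abs_mul]
  refine habs.trans ?_
  have hUw : |inner ℝ (x 0).1 w| ≤ U * ‖w‖ := abs_real_inner_le_norm _ _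
  refine leave_one_out_arith (U := U) (q := |fitResidual θ (x 0)|) (R := |r|) (ε := ‖e‖)
    (N := ‖n‖) (L := l) (A := ‖η‖) (p := |inner ℝ (x 0).1 η|) hli.le hU0 (abs_nonneg _) hε0 hN0
    hm0 (norm_nonneg w) (norm_nonneg M) ?_ hV hr1 hb1 hb2 ?_ ?_ ?_ ?_ ?_ ?_
  · rw [hP, obsBound, sq_abs]
  · rw [sq_abs]; exact hb3
  · exact mul_le_mul_of_nonneg_left (abs_real_inner_le_norm _ _) hl'.le
  · exact mul_le_mul hUw (abs_real_inner_le_norm _ _) (abs_nonneg _) (by positivity)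
  · exact mul_le_mul_of_nonneg_right hUw (abs_nonneg _)
  · exact mul_le_mul_of_nonneg_left (inner_apply_self_le M η e) hl'.le
  · exact mul_le_mul_of_nonneg_left (inner_apply_self_le M η η) hl'.le

end Expansion

/-! ### Independence of functions of disjoint coordinates. -/

section Independence

variable {Ω : Type*} [MeasurableSpace Ω] {μ : Measure Ω}

/-- Functions of disjoint sets of coordinates of an independent family are independent. -/
lemma indepFun_of_dependsOn {ι 𝒳 α β : Type*} [MeasurableSpace 𝒳] [Inhabited 𝒳]
    [MeasurableSpace α] [MeasurableSpace β] {W : ι → Ω → 𝒳} (hW : iIndepFun W μ)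
    (hWm : ∀ i, Measurable (W i)) {S T : Finset ι} (hST : Disjoint S T)
    {F : (ι → 𝒳) → α} {G : (ι → 𝒳) → β} (hF : Measurable F) (hG : Measurable G)
    (hFS : DependsOn F S) (hGT : DependsOn G T) :
    IndepFun (fun ω => F fun i => W i ω) (fun ω => G fun i => W i ω) μ := by
  classical
  -- Filling the coordinates outside R with a default value does not affect F or G, which ignore
  -- them.
  let ext (R : Finset ι) (t : R → 𝒳) : ι → 𝒳 := fun i => if h : i ∈ R then t ⟨i, h⟩ else default
  have hext : ∀ R, Measurable (ext R) := fun R => measurable_pi_lambda _ fun i => by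
    by_cases h : i ∈ R
    · simpa only [ext, h, dite_true] using measurable_pi_apply _
    · simp only [ext, h, dite_false]; exact measurable_const
  have h := (hW.indepFun_finset S T hST hWm).comp (hF.comp (hext S)) (hG.comp (hext T))
  convert h using 1
  · funext ω
    exact hFS fun i hi => by simp [ext, Finset.mem_coe.1 hi]
  · funext ω
    exact hGT fun i hi => by simp [ext, Finset.mem_coe.1 hi]

end Independence

/-! ### Covariance bounds and moments of i.i.d. sums. -/

section Moments

variable {Ω : Type*} [MeasurableSpace Ω] {μ : Measure Ω}

instance holderTriple_four_four_two : ENNReal.HolderTriple 4 4 2 := ⟨by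
  rw [← ENNReal.toReal_eq_toReal_iff' (by simp) (by simp), ENNReal.toReal_add (by simp) (by simp)]
  simp; norm_num⟩

instance holderTriple_eight_eight_four : ENNReal.HolderTriple 8 8 4 := ⟨by
  rw [← ENNReal.toReal_eq_toReal_iff' (by simp) (by simp), ENNReal.toReal_add (by simp) (by simp)]
  simp; norm_num⟩

lemma memLp_sq_of_four {f : Ω → ℝ} (hf : MemLp f 4 μ) : MemLp (fun ω => f ω ^ 2) 2 μ := by
  simp only [pow_two]
  exact hf.mul' hf

lemma integrable_pow_four {f : Ω → ℝ} (hf : MemLp f 4 μ) : Integrable (fun ω => f ω ^ 4) μ := by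
  have := (memLp_sq_of_four hf).integrable_sq
  simpa only [← pow_mul] using this

lemma integrable_mul_of_memLp_two {f g : Ω → ℝ} (hf : MemLp f 2 μ) (hg : MemLp g 2 μ) :
    Integrable (fun ω => f ω * g ω) μ := hf.integrable_mul hg

/-- Cauchy–Schwarz as the discriminant of t ↦ Var(f + tg) ≥ 0. -/
lemma sq_covariance_le [IsFiniteMeasure μ] {f g : Ω → ℝ} (hf : MemLp f 2 μ) (hg : MemLp g 2 μ) :
    (2 * cov[f, g; μ]) ^ 2 ≤ 4 * (Var[f; μ] * Var[g; μ]) := by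
  have h : ∀ t : ℝ, 0 ≤ Var[g; μ] * (t * t) + 2 * cov[f, g; μ] * t + Var[f; μ] := fun t => by
    have h1 := variance_nonneg (f + t • g) μ
    rw [variance_add hf (hg.const_smul t), covariance_smul_right, variance_smul] at h1
    linarith
  have := discrim_le_zero h
  rw [discrim] at this
  linarith

/-- Adding a term of negligible second moment does not change the limit of the variance. -/
lemma tendsto_mul_variance_add [IsProbabilityMeasure μ] {L R : ℕ → Ω → ℝ} {c : ℕ → ℝ} {v : ℝ}
    (hc : ∀ n, 0 ≤ c n) (hL : ∀ᶠ n in atTop, MemLp (L n) 2 μ) (hR : ∀ᶠ n in atTop, MemLp (R n) 2 μ)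
    (h1 : Tendsto (fun n => c n * Var[L n; μ]) atTop (𝓝 v))
    (h2 : Tendsto (fun n => c n * ∫ ω, R n ω ^ 2 ∂μ) atTop (𝓝 0)) :
    Tendsto (fun n => c n * Var[fun ω => L n ω + R n ω; μ]) atTop (𝓝 v) := by
  have h3 : Tendsto (fun n => c n * Var[R n; μ]) atTop (𝓝 0) := by
    refine squeeze_zero' (Eventually.of_forall fun n => mul_nonneg (hc n) (variance_nonneg _ _))
      (hR.mono fun n hn => ?_) h2
    exact mul_le_mul_of_nonneg_left (variance_le_expectation_sq hn.aestronglyMeasurable) (hc n)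
  -- The square of the cross term is at most 4 (c Var L)(c Var R): a convergent factor times a
  -- vanishing one.
  have h4 : Tendsto (fun n => c n * (2 * cov[L n, R n; μ])) atTop (𝓝 0) := by
    have h5 : Tendsto (fun n => 4 * ((c n * Var[L n; μ]) * (c n * Var[R n; μ]))) atTop (𝓝 0) := by
      simpa using (h1.mul h3).const_mul 4
    have h6 : Tendsto (fun n => (c n * (2 * cov[L n, R n; μ])) ^ 2) atTop (𝓝 0) := by
      refine squeeze_zero' (Eventually.of_forall fun n => sq_nonneg _) ?_ h5
      filter_upwards [hL, hR] with n hLn hRn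
      calc (c n * (2 * cov[L n, R n; μ])) ^ 2 = c n ^ 2 * (2 * cov[L n, R n; μ]) ^ 2 := by ring
        _ ≤ c n ^ 2 * (4 * (Var[L n; μ] * Var[R n; μ])) :=
            mul_le_mul_of_nonneg_left (sq_covariance_le hLn hRn) (sq_nonneg _)
        _ = _ := by ring
    have h7 := (Real.continuous_sqrt.tendsto 0).comp h6
    simp only [Function.comp_def, Real.sqrt_sq_eq_abs, Real.sqrt_zero] at h7
    exact (tendsto_zero_iff_abs_tendsto_zero _).2 h7
  have h8 := (h1.add h4).add h3
  simp only [add_zero] at h8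
  refine h8.congr' ?_
  filter_upwards [hL, hR] with n hLn hRn
  rw [variance_fun_add hLn hRn]
  ring

variable {d : ℕ}

lemma norm_pow_four_le (v : EuclideanSpace ℝ (Fin d)) : ‖v‖ ^ 4 ≤ d * ∑ k, v k ^ 4 := by
  have h1 : ‖v‖ ^ 4 = (∑ k, v k ^ 2) ^ 2 := by
    rw [← EuclideanSpace.real_norm_sq_eq, ← pow_mul]
  rw [h1]
  have := sq_sum_le_card_mul_sum_sq (s := Finset.univ) (f := fun k => v k ^ 2)
  simpa [← pow_mul] using this

variable {ξ : ℕ → Ω → EuclideanSpace ℝ (Fin d)}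

lemma identDistrib_coord (hid : ∀ i, IdentDistrib (ξ i) (ξ 0) μ μ) (k : Fin d) (i : ℕ) :
    IdentDistrib (fun ω => ξ i ω k) (fun ω => ξ 0 ω k) μ μ :=
  (hid i).comp (u := fun v : EuclideanSpace ℝ (Fin d) => v k) (by fun_prop)

lemma iIndepFun_coord (hind : iIndepFun ξ μ) (k : Fin d) :
    iIndepFun (fun i ω => ξ i ω k) μ :=
  hind.comp (fun _ (v : EuclideanSpace ℝ (Fin d)) => v k) fun _ => by fun_prop

lemma memLp_coord {f : Ω → EuclideanSpace ℝ (Fin d)} {p : ENNReal} (hf : MemLp f p μ) (k : Fin d) :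
    MemLp (fun ω => f ω k) p μ :=
  (EuclideanSpace.proj k : EuclideanSpace ℝ (Fin d) →L[ℝ] ℝ).comp_memLp' hf

variable [IsProbabilityMeasure μ]

lemma integral_sum_pow_le_of_iIndepFun {ξ : ℕ → Ω → ℝ} (hind : iIndepFun ξ μ)
    (hm : ∀ i, Measurable (ξ i)) (hid : ∀ i, IdentDistrib (ξ i) (ξ 0) μ μ)
    (h0 : ∫ ω, ξ 0 ω ∂μ = 0) (hL : MemLp (ξ 0) 2 μ) (s : Finset ℕ) :
    ∫ ω, (∑ i ∈ s, ξ i ω) ^ 2 ∂μ = s.card * ∫ ω, ξ 0 ω ^ 2 ∂μ := by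
  have hLi : ∀ i, MemLp (ξ i) 2 μ := fun i => (hid i).symm.memLp_iff.1 hL
  have hi0 : ∀ i, ∫ ω, ξ i ω ∂μ = 0 := fun i => by rw [← h0]; exact (hid i).integral_eq
  have h1 := IndepFun.variance_sum (s := s) (fun i _ => hLi i)
    fun i _ j _ hij => hind.indepFun hij
  rw [variance_of_integral_eq_zero (Finset.aemeasurable_sum _ fun i _ => (hm i).aemeasurable)
    (by simp only [Finset.sum_apply]
        rw [integral_finsetSum _ fun i _ => (hLi i).integrable one_le_two]
        simp [hi0])] at h1
  simp only [Finset.sum_apply] at h1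
  rw [h1, Finset.sum_congr rfl fun i _ => (hid i).variance_eq, Finset.sum_const, nsmul_eq_mul,
    variance_of_integral_eq_zero (hm 0).aemeasurable h0]

/-- Induction on the index set. In (S + ξ)⁴ the terms S³ξ and Sξ³ have mean zero, and (E ξ²)² ≤ E ξ⁴
bounds the middle term. The constant 3 closes the induction because 3m² + 6m + 1 ≤ 3(m + 1)². -/
lemma integral_sum_pow_four_le_of_iIndepFun {ξ : ℕ → Ω → ℝ} (hind : iIndepFun ξ μ)
    (hm : ∀ i, Measurable (ξ i)) (hid : ∀ i, IdentDistrib (ξ i) (ξ 0) μ μ)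
    (h0 : ∫ ω, ξ 0 ω ∂μ = 0) (hL : MemLp (ξ 0) 4 μ) (s : Finset ℕ) :
    ∫ ω, (∑ i ∈ s, ξ i ω) ^ 4 ∂μ ≤ 3 * s.card ^ 2 * ∫ ω, ξ 0 ω ^ 4 ∂μ := by
  have hLi : ∀ i, MemLp (ξ i) 4 μ := fun i => (hid i).symm.memLp_iff.1 hL
  have hi0 : ∀ i, ∫ ω, ξ i ω ∂μ = 0 := fun i => by rw [← h0]; exact (hid i).integral_eq
  have h24 : MemLp (ξ 0) 2 μ := hL.mono_exponent (by norm_num)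
  have hvar : (∫ ω, ξ 0 ω ^ 2 ∂μ) ^ 2 ≤ ∫ ω, ξ 0 ω ^ 4 ∂μ := by
    have := variance_nonneg (fun ω => ξ 0 ω ^ 2) μ
    rw [variance_eq_sub (memLp_sq_of_four hL)] at this
    simp only [Pi.pow_apply, ← pow_mul] at this
    linarith
  induction s using Finset.induction_on with
  | empty => simp
  | insert a s ha ih =>
    have hS : MemLp (fun ω => ∑ i ∈ s, ξ i ω) 4 μ := memLp_finsetSum _ fun i _ => hLi i
    have hI : IndepFun (fun ω => ∑ i ∈ s, ξ i ω) (ξ a) μ := by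
      have := hind.indepFun_finsetSum_of_notMem hm ha
      convert this using 1
      funext ω; simp
    have hS2 := integral_sum_pow_le_of_iIndepFun hind hm hid h0 h24 s
    set S : Ω → ℝ := fun ω => ∑ i ∈ s, ξ i ω with hSdef
    have hpow : ∀ {f : Ω → ℝ}, MemLp f 4 μ → ∀ k : ℕ, k ≤ 4 → Integrable (fun ω => f ω ^ k) μ := by
      intro f hf k hk
      have h1 : Integrable (fun ω => 1 + f ω ^ 4) μ := (integrable_const _).add (integrable_pow_four hf)
      refine h1.mono' (hf.aestronglyMeasurable.pow k) (ae_of_all _ fun ω => ?_)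
      rw [Real.norm_eq_abs, abs_pow]
      have h2 : f ω ^ 4 = |f ω| ^ 4 := by rw [← abs_pow, abs_of_nonneg (by positivity)]
      rw [h2]
      rcases le_total |f ω| 1 with h3 | h3
      · linarith [pow_le_one₀ (n := k) (abs_nonneg (f ω)) h3, pow_nonneg (abs_nonneg (f ω)) 4]
      · linarith [pow_le_pow_right₀ h3 hk]
    have hmul : ∀ j k : ℕ, j ≤ 4 → k ≤ 4 → Integrable (fun ω => S ω ^ j * ξ a ω ^ k) μ ∧
        ∫ ω, S ω ^ j * ξ a ω ^ k ∂μ = (∫ ω, S ω ^ j ∂μ) * ∫ ω, ξ a ω ^ k ∂μ := by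
      intro j k hj hk
      have hI' := hI.comp (φ := fun t : ℝ => t ^ j) (ψ := fun t : ℝ => t ^ k)
        (by fun_prop) (by fun_prop)
      exact ⟨hI'.integrable_mul (hpow hS j hj) (hpow (hLi a) k hk),
        hI'.integral_fun_mul_eq_mul_integral (hpow hS j hj).aestronglyMeasurable
          (hpow (hLi a) k hk).aestronglyMeasurable⟩
    have hS0 : ∫ ω, S ω ^ 1 ∂μ = 0 := by
      simp only [pow_one, hSdef]
      rw [integral_finsetSum _ fun i _ => (hLi i).integrable (by norm_num)]
      simp [hi0]
    have hexp : ∫ ω, (∑ i ∈ insert a s, ξ i ω) ^ 4 ∂μ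
        = ∫ ω, S ω ^ 4 ∂μ + 6 * ((∫ ω, S ω ^ 2 ∂μ) * ∫ ω, ξ a ω ^ 2 ∂μ) + ∫ ω, ξ a ω ^ 4 ∂μ := by
      have e1 : ∀ ω, (∑ i ∈ insert a s, ξ i ω) ^ 4 = S ω ^ 4 + 4 * (S ω ^ 3 * ξ a ω ^ 1)
          + 6 * (S ω ^ 2 * ξ a ω ^ 2) + 4 * (S ω ^ 1 * ξ a ω ^ 3) + ξ a ω ^ 4 := fun ω => by
        rw [Finset.sum_insert ha]; simp only [hSdef]; ring
      simp only [e1]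
      have i4 := hpow hS 4 le_rfl
      have i31 := ((hmul 3 1 (by norm_num) (by norm_num)).1).const_mul 4
      have i22 := ((hmul 2 2 (by norm_num) (by norm_num)).1).const_mul 6
      have i13 := ((hmul 1 3 (by norm_num) (by norm_num)).1).const_mul 4
      have j4 := hpow (hLi a) 4 le_rfl
      have a1 := i4.fun_add i31
      have a2 := a1.fun_add i22
      rw [integral_add (a2.fun_add i13) j4, integral_add a2 i13, integral_add a1 i22,
        integral_add i4 i31]
      simp only [integral_const_mul]
      rw [(hmul 3 1 (by norm_num) (by norm_num)).2, (hmul 2 2 (by norm_num) (by norm_num)).2,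
        (hmul 1 3 (by norm_num) (by norm_num)).2, hS0]
      simp only [pow_one, hi0]
      ring
    have ea2 : ∫ ω, ξ a ω ^ 2 ∂μ = ∫ ω, ξ 0 ω ^ 2 ∂μ :=
      ((hid a).comp (u := fun t : ℝ => t ^ 2) (by fun_prop)).integral_eq
    have ea4 : ∫ ω, ξ a ω ^ 4 ∂μ = ∫ ω, ξ 0 ω ^ 4 ∂μ :=
      ((hid a).comp (u := fun t : ℝ => t ^ 4) (by fun_prop)).integral_eq
    rw [hexp, hS2, ea2, ea4, Finset.card_insert_of_notMem ha]
    push_cast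
    have hs0 : (0 : ℝ) ≤ s.card := by positivity
    have hk0 : 0 ≤ ∫ ω, ξ 0 ω ^ 4 ∂μ := integral_nonneg fun ω => by positivity
    nlinarith [mul_le_mul_of_nonneg_left hvar hs0]

/-- The second moment of a sum of i.i.d. centred random vectors is of linear order. -/
lemma integral_norm_sum_sq (hind : iIndepFun ξ μ) (hm : ∀ i, Measurable (ξ i))
    (hid : ∀ i, IdentDistrib (ξ i) (ξ 0) μ μ) (h0 : ∀ k, ∫ ω, ξ 0 ω k ∂μ = 0)
    (hL : MemLp (ξ 0) 2 μ) (s : Finset ℕ) :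
    ∫ ω, ‖∑ i ∈ s, ξ i ω‖ ^ 2 ∂μ = s.card * ∫ ω, ‖ξ 0 ω‖ ^ 2 ∂μ := by
  have hLi : ∀ i, MemLp (ξ i) 2 μ := fun i => (hid i).symm.memLp_iff.1 hL
  simp only [EuclideanSpace.real_norm_sq_eq]
  rw [integral_finsetSum _ fun k _ => (memLp_coord (memLp_finsetSum _ fun i _ => hLi i) k).integrable_sq,
    integral_finsetSum _ fun k _ => (memLp_coord hL k).integrable_sq, Finset.mul_sum]
  refine Finset.sum_congr rfl fun k _ => ?_
  simpa using integral_sum_pow_le_of_iIndepFun (iIndepFun_coord hind k)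
    (fun i => by have := hm i; fun_prop) (identDistrib_coord hid k) (h0 k) (memLp_coord hL k) s

/-- The fourth moment of a sum of i.i.d. centred random vectors is of quadratic order. -/
lemma exists_integral_norm_sum_pow_four_le (hind : iIndepFun ξ μ) (hm : ∀ i, Measurable (ξ i))
    (hid : ∀ i, IdentDistrib (ξ i) (ξ 0) μ μ) (h0 : ∀ k, ∫ ω, ξ 0 ω k ∂μ = 0)
    (hL : MemLp (ξ 0) 4 μ) :
    ∃ C : ℝ, 0 ≤ C ∧ ∀ s : Finset ℕ, ∫ ω, ‖∑ i ∈ s, ξ i ω‖ ^ 4 ∂μ ≤ C * s.card ^ 2 := by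
  have hLi : ∀ i, MemLp (ξ i) 4 μ := fun i => (hid i).symm.memLp_iff.1 hL
  refine ⟨d * ∑ k, 3 * ∫ ω, ξ 0 ω k ^ 4 ∂μ, ?_, fun s => ?_⟩
  · exact mul_nonneg (by positivity) (Finset.sum_nonneg fun k _ =>
      mul_nonneg (by norm_num) (integral_nonneg fun ω => by positivity))
  have hint : ∀ k, Integrable (fun ω => (∑ i ∈ s, ξ i ω) k ^ 4) μ := fun k =>
    integrable_pow_four (memLp_coord (memLp_finsetSum _ fun i _ => hLi i) k)
  calc ∫ ω, ‖∑ i ∈ s, ξ i ω‖ ^ 4 ∂μ ≤ ∫ ω, d * ∑ k, (∑ i ∈ s, ξ i ω) k ^ 4 ∂μ :=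
        integral_mono_of_nonneg (ae_of_all _ fun ω => by positivity)
          ((integrable_finsetSum _ fun k _ => hint k).const_mul _)
          (ae_of_all _ fun ω => norm_pow_four_le _)
    _ = d * ∑ k, ∫ ω, (∑ i ∈ s, ξ i ω) k ^ 4 ∂μ := by
        rw [integral_const_mul, integral_finsetSum _ fun k _ => hint k]
    _ ≤ d * ∑ k, 3 * s.card ^ 2 * ∫ ω, ξ 0 ω k ^ 4 ∂μ := by
        refine mul_le_mul_of_nonneg_left (Finset.sum_le_sum fun k _ => ?_) (by positivity)
        simpa using integral_sum_pow_four_le_of_iIndepFun (iIndepFun_coord hind k)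
          (fun i => by have := hm i; fun_prop) (identDistrib_coord hid k) (h0 k)
          (memLp_coord hL k) s
    _ = _ := by
        rw [mul_assoc, Finset.sum_mul]
        congr 1
        exact Finset.sum_congr rfl fun k _ => by ring

end Moments

/-! ### The sampling model, integrability, and integrating out independent observations. -/

section Model

variable {Ω : Type*} [MeasurableSpace Ω] {μ : Measure Ω}

namespace IIDWithCopies

variable {𝒳 : Type*} [MeasurableSpace 𝒳] {X : ℕ → Ω → 𝒳} {X' Xt : Ω → 𝒳}

lemma measurable_obs (h : IIDWithCopies X X' Xt μ) (i : ℕ) : Measurable (X i) :=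
  h.measurable (Sum.inl i)

lemma measurable_copy (h : IIDWithCopies X X' Xt μ) : Measurable X' := h.measurable (Sum.inr 0)

lemma measurable_test (h : IIDWithCopies X X' Xt μ) : Measurable Xt := h.measurable (Sum.inr 1)

lemma identDistrib_obs (h : IIDWithCopies X X' Xt μ) (i : ℕ) : IdentDistrib (X i) (X 0) μ μ :=
  h.ident (Sum.inl i)

lemma identDistrib_copy (h : IIDWithCopies X X' Xt μ) : IdentDistrib X' (X 0) μ μ :=
  h.ident (Sum.inr 0)

lemma identDistrib_test (h : IIDWithCopies X X' Xt μ) : IdentDistrib Xt (X 0) μ μ :=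
  h.ident (Sum.inr 1)

lemma iIndepFun_obs (h : IIDWithCopies X X' Xt μ) : iIndepFun X μ :=
  h.indep.precomp (g := Sum.inl) Sum.inl_injective

lemma measurable_dataset (h : IIDWithCopies X X' Xt μ) : Measurable (dataset X) :=
  measurable_pi_lambda _ h.measurable_obs

end IIDWithCopies

variable {d : ℕ} {lam : ℝ} {W : Ω → EuclideanSpace ℝ (Fin d) × ℝ}

lemma memLp_inner_fst {p : ENNReal} (hZ : MemLp (fun ω => (W ω).1) p μ) (v : EuclideanSpace ℝ (Fin d)) :
    MemLp (fun ω => inner ℝ (W ω).1 v) p μ := hZ.inner_const v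

lemma memLp_fitResidual {p : ENNReal} (hZ : MemLp (fun ω => (W ω).1) p μ)
    (hY : MemLp (fun ω => (W ω).2) p μ) (θ : EuclideanSpace ℝ (Fin d)) : MemLp (fun ω => fitResidual θ (W ω)) p μ :=
  hY.sub (memLp_inner_fst hZ θ)

lemma memLp_score {p q : ENNReal} [ENNReal.HolderTriple p p q]
    (hZ : MemLp (fun ω => (W ω).1) p μ) (hY : MemLp (fun ω => (W ω).2) p μ) (θ : EuclideanSpace ℝ (Fin d)) :
    MemLp (fun ω => score θ (W ω)) q μ := by
  have := hZ.smul (r := q) (memLp_fitResidual hZ hY θ)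
  exact this

lemma memLp_norm_sq_fst {p q : ENNReal} [ENNReal.HolderTriple p p q]
    (hZ : MemLp (fun ω => (W ω).1) p μ) : MemLp (fun ω => ‖(W ω).1‖ ^ 2) q μ := by
  simp only [pow_two]
  exact hZ.norm.mul' hZ.norm

lemma memLp_inner_smul {p q : ENNReal} [ENNReal.HolderTriple p p q]
    (hZ : MemLp (fun ω => (W ω).1) p μ) (v : EuclideanSpace ℝ (Fin d)) :
    MemLp (fun ω => inner ℝ (W ω).1 v • (W ω).1) q μ := by
  have := hZ.smul (r := q) (memLp_inner_fst hZ v)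
  exact this

lemma memLp_obsBound (hZ : MemLp (fun ω => (W ω).1) 4 μ)
    (hY : MemLp (fun ω => (W ω).2) 4 μ) [IsFiniteMeasure μ] (θ : EuclideanSpace ℝ (Fin d)) :
    MemLp (fun ω => obsBound θ (W ω)) 2 μ := by
  have h1 : MemLp (fun ω => ‖(W ω).1‖ ^ 2) 2 μ := memLp_norm_sq_fst hZ
  have h2 := memLp_sq_of_four (memLp_fitResidual hZ hY θ)
  have h3 : MemLp (fun _ : Ω => (1 : ℝ)) 2 μ := memLp_const 1
  exact (h3.add h1).add h2

lemma memLp_norm_sq_ridgeEstimator (hlam : 0 < lam) {U : ℕ → Ω → EuclideanSpace ℝ (Fin d) × ℝ}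
    (hm : ∀ i, Measurable (U i)) (hU : ∀ i, MemLp (fun ω => (U i ω).2) 4 μ) (s : Finset ℕ) :
    MemLp (fun ω => ‖ridgeEstimator lam s (dataset U ω)‖ ^ 2) 2 μ := by
  have h1 : MemLp (fun ω => lam⁻¹ * ∑ i ∈ s, (U i ω).2 ^ 2) 2 μ :=
    (memLp_finsetSum s fun i _ => memLp_sq_of_four (hU i)).const_mul _
  refine h1.mono' ?_ (ae_of_all _ fun ω => ?_)
  · exact (((measurable_ridgeEstimator hlam s).comp
      (measurable_pi_lambda _ hm : Measurable (dataset U))).norm.pow_const 2).aestronglyMeasurable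
  · rw [Real.norm_of_nonneg (by positivity)]
    exact norm_sq_ridgeEstimator_le hlam s _

lemma measurable_sqLoss : Measurable fun p : (EuclideanSpace ℝ (Fin d) × ℝ) × EuclideanSpace ℝ (Fin d) => sqLoss p.1 p.2 := by
  unfold sqLoss
  exact Continuous.measurable (by fun_prop)

lemma sqLoss_le (x : EuclideanSpace ℝ (Fin d) × ℝ) (θ : EuclideanSpace ℝ (Fin d)) : sqLoss x θ ≤ 2 * x.2 ^ 2 + 2 * (‖x.1‖ ^ 2 * ‖θ‖ ^ 2) := by
  have h1 : inner ℝ x.1 θ ^ 2 ≤ ‖x.1‖ ^ 2 * ‖θ‖ ^ 2 := by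
    rw [← mul_pow, ← sq_abs]
    exact pow_le_pow_left₀ (abs_nonneg _) (abs_real_inner_le_norm _ _) 2
  rw [sqLoss]
  nlinarith [sq_nonneg (x.2 + inner ℝ x.1 θ)]

lemma sqLoss_nonneg (x : EuclideanSpace ℝ (Fin d) × ℝ) (θ : EuclideanSpace ℝ (Fin d)) : 0 ≤ sqLoss x θ := sq_nonneg _

/-- Without independence the product of two square integrable functions is only integrable. This
gain keeps the squared loss in L² under four moments. -/
lemma memLp_mul_of_indepFun {f g : Ω → ℝ} (hf : MemLp f 2 μ) (hg : MemLp g 2 μ)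
    (hfg : IndepFun f g μ) : MemLp (fun ω => f ω * g ω) 2 μ := by
  refine (memLp_two_iff_integrable_sq (hf.aestronglyMeasurable.mul hg.aestronglyMeasurable)).2 ?_
  have := (hfg.comp (φ := fun t : ℝ => t ^ 2) (ψ := fun t : ℝ => t ^ 2) (by fun_prop)
    (by fun_prop)).integrable_mul hf.integrable_sq hg.integrable_sq
  exact this.congr (ae_of_all _ fun ω => by simp [mul_pow])

lemma memLp_sqLoss_of_indepFun {T : Ω → EuclideanSpace ℝ (Fin d)} (hW : Measurable W) (hT : Measurable T)
    (hZ : MemLp (fun ω => (W ω).1) 4 μ) (hY : MemLp (fun ω => (W ω).2) 4 μ)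
    (hT2 : MemLp (fun ω => ‖T ω‖ ^ 2) 2 μ) (hWT : IndepFun W T μ) :
    MemLp (fun ω => sqLoss (W ω) (T ω)) 2 μ := by
  have h1 : MemLp (fun ω => ‖(W ω).1‖ ^ 2 * ‖T ω‖ ^ 2) 2 μ :=
    memLp_mul_of_indepFun (memLp_norm_sq_fst hZ) hT2
      (hWT.comp (φ := fun x : EuclideanSpace ℝ (Fin d) × ℝ => ‖x.1‖ ^ 2) (ψ := fun v : EuclideanSpace ℝ (Fin d) => ‖v‖ ^ 2)
        (by fun_prop) (by fun_prop))
  refine (((memLp_sq_of_four hY).const_mul 2).add (h1.const_mul 2)).mono' ?_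
    (ae_of_all _ fun ω => ?_)
  · exact (measurable_sqLoss.comp (hW.prodMk hT)).aestronglyMeasurable
  · rw [Real.norm_of_nonneg (sqLoss_nonneg _ _)]
    exact sqLoss_le _ _

/-- Integrating out one of two independent variables. -/
lemma integral_comp_of_indepFun {α β : Type*} [MeasurableSpace α] [MeasurableSpace β]
    {U : Ω → α} {V : Ω → β} {F : α × β → ℝ} [IsFiniteMeasure μ] (hV : Measurable V)
    (hU : Measurable U) (hF : Measurable F) (hVU : IndepFun V U μ)
    (hint : Integrable (fun ω => F (U ω, V ω)) μ) :
    ∫ ω, F (U ω, V ω) ∂μ = ∫ ω, ∫ ω', F (U ω, V ω') ∂μ ∂μ := by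
  have hmap : μ.map (fun ω => (U ω, V ω)) = (μ.map U).prod (μ.map V) :=
    (indepFun_iff_map_prod_eq_prod_map_map hU.aemeasurable hV.aemeasurable).1 hVU.symm
  have h1 : ∫ ω, F (U ω, V ω) ∂μ = ∫ p, F p ∂(μ.map fun ω => (U ω, V ω)) :=
    (integral_map (hU.prodMk hV).aemeasurable hF.aestronglyMeasurable).symm
  have h2 : Integrable F ((μ.map U).prod (μ.map V)) := by
    rw [← hmap]
    exact (integrable_map_measure hF.aestronglyMeasurable (hU.prodMk hV).aemeasurable).2 hint
  rw [h1, hmap, integral_prod _ h2, integral_map hU.aemeasurable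
    h2.aestronglyMeasurable.integral_prod_right']
  refine integral_congr_ae (ae_of_all _ fun ω => ?_)
  exact integral_map hV.aemeasurable (hF.comp measurable_prodMk_left).aestronglyMeasurable

/-- Integrating out a test observation that is independent of the training data. -/
lemma integral_mul_sqLoss_of_indepFun {α : Type*} [MeasurableSpace α] {U : Ω → α} {f : α → ℝ}
    {t : α → EuclideanSpace ℝ (Fin d)} [IsFiniteMeasure μ] (hW : Measurable W) (hU : Measurable U) (hf : Measurable f)
    (ht : Measurable t) (hWU : IndepFun W U μ)
    (hint : Integrable (fun ω => f (U ω) * sqLoss (W ω) (t (U ω))) μ) :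
    ∫ ω, f (U ω) * sqLoss (W ω) (t (U ω)) ∂μ
      = ∫ ω, f (U ω) * risk sqLoss W μ (t (U ω)) ∂μ := by
  have hg : Measurable fun p : α × (EuclideanSpace ℝ (Fin d) × ℝ) => f p.1 * sqLoss p.2 (t p.1) :=
    (hf.comp measurable_fst).mul
      (measurable_sqLoss.comp (measurable_snd.prodMk (ht.comp measurable_fst)))
  rw [integral_comp_of_indepFun hW hU hg hWU hint]
  simp only [integral_const_mul, risk]

/-- Conditioning on a sub-σ-algebra does not change the covariance with a measurable function. -/
lemma covariance_condExp_right {Ω : Type*} {m m0 : MeasurableSpace Ω} {μ : Measure Ω}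
    [IsProbabilityMeasure μ] (hm : m ≤ m0) {f g : Ω → ℝ}
    (hfm : StronglyMeasurable[m] f) (hf : MemLp f 2 μ) (hg : MemLp g 2 μ) :
    cov[f, μ[g | m]; μ] = cov[f, g; μ] := by
  have hgc : MemLp (μ[g | m]) 2 μ := hg.condExp one_le_two
  rw [covariance_eq_sub hf hgc, covariance_eq_sub hf hg, integral_condExp hm]
  congr 1
  have h1 : μ[f * g | m] =ᵐ[μ] f * μ[g | m] :=
    condExp_mul_of_stronglyMeasurable_left hfm (hf.integrable_mul hg)
      (hg.integrable one_le_two)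
  rw [← integral_condExp hm (f := f * g)]
  exact integral_congr_ae h1.symm

/-- Jensen's inequality, read off from the nonnegativity of the variance. -/
lemma tendsto_integral_of_tendsto_integral_sq [IsProbabilityMeasure μ] {f : ℕ → Ω → ℝ}
    (hf : ∀ᶠ n in atTop, MemLp (f n) 2 μ)
    (h : Tendsto (fun n => ∫ ω, f n ω ^ 2 ∂μ) atTop (𝓝 0)) :
    Tendsto (fun n => ∫ ω, f n ω ∂μ) atTop (𝓝 0) := by
  have h6 : Tendsto (fun n => (∫ ω, f n ω ∂μ) ^ 2) atTop (𝓝 0) := by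
    refine squeeze_zero' (Eventually.of_forall fun n => sq_nonneg _) (hf.mono fun n hn => ?_) h
    have h1 := variance_nonneg (f n) μ
    rw [variance_eq_sub hn] at h1
    simp only [Pi.pow_apply] at h1
    linarith
  have h7 := (Real.continuous_sqrt.tendsto 0).comp h6
  simp only [Function.comp_def, Real.sqrt_sq_eq_abs, Real.sqrt_zero] at h7
  exact (tendsto_zero_iff_abs_tendsto_zero _).2 h7

/-- The assumptions on the observations that enter the asymptotic expansion of ridge regression:
`M` is the second moment operator of the covariates, `θ` the population minimiser, and `w` the
direction in which the empirical score enters the expansion. -/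
structure RidgeModel (lam : ℝ) (X : ℕ → Ω → EuclideanSpace ℝ (Fin d) × ℝ) (X' Xt : Ω → EuclideanSpace ℝ (Fin d) × ℝ) (μ : Measure Ω)
    (M : EuclideanSpace ℝ (Fin d) →L[ℝ] EuclideanSpace ℝ (Fin d)) (θ w : EuclideanSpace ℝ (Fin d)) : Prop where
  iid : IIDWithCopies X X' Xt μ
  lam_pos : 0 < lam
  memLp_fst : MemLp (fun ω => (X 0 ω).1) 4 μ
  memLp_snd : MemLp (fun ω => (X 0 ω).2) 4 μ
  inner_op : ∀ u v, inner ℝ (M u) v = ∫ ω, inner ℝ (X 0 ω).1 u * inner ℝ (X 0 ω).1 v ∂μ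
  integral_score : ∀ u, ∫ ω, fitResidual θ (X 0 ω) * inner ℝ (X 0 ω).1 u ∂μ = lam * inner ℝ θ u
  direction : M w + lam • w = -(lam • θ)

end Model

/-! ### Risk expansion and moments of the empirical fluctuations. -/

section RidgeModelMoments

variable {Ω : Type*} [MeasurableSpace Ω] {μ : Measure Ω} {d : ℕ} {lam : ℝ}

/-- The score, centred at its mean under the population minimiser. -/
noncomputable def centredScore (lam : ℝ) (θ : EuclideanSpace ℝ (Fin d)) (x : EuclideanSpace ℝ (Fin d) × ℝ) : EuclideanSpace ℝ (Fin d) := score θ x - lam • θ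

/-- The contribution of one observation to the deviation of the second moment operator at `w`. -/
noncomputable def centredMoment (M : EuclideanSpace ℝ (Fin d) →L[ℝ] EuclideanSpace ℝ (Fin d)) (w : EuclideanSpace ℝ (Fin d)) (x : EuclideanSpace ℝ (Fin d) × ℝ) : EuclideanSpace ℝ (Fin d) :=
  inner ℝ x.1 w • x.1 - M w

@[fun_prop]
lemma measurable_centredScore (θ : EuclideanSpace ℝ (Fin d)) : Measurable (centredScore lam θ) :=
  ((continuous_score θ).sub continuous_const).measurable

@[fun_prop]
lemma measurable_centredMoment (M : EuclideanSpace ℝ (Fin d) →L[ℝ] EuclideanSpace ℝ (Fin d)) (w : EuclideanSpace ℝ (Fin d)) : Measurable (centredMoment M w) := by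
  unfold centredMoment
  exact Continuous.measurable (by fun_prop)

/-- Centring absorbs the penalty into the average. For empty s this fails: the inverse cardinality
is 0, so the average is 0 while the left side is −λθ. -/
lemma ridgeScore_eq_mean (θ : EuclideanSpace ℝ (Fin d)) {s : Finset ℕ} (hs : s.Nonempty) (x : ℕ → EuclideanSpace ℝ (Fin d) × ℝ) :
    ridgeScore lam θ s x = (s.card : ℝ)⁻¹ • ∑ i ∈ s, centredScore lam θ (x i) := by
  have hc : (s.card : ℝ) ≠ 0 := by exact_mod_cast hs.card_pos.ne'
  simp only [centredScore, Finset.sum_sub_distrib, Finset.sum_const, smul_sub, ridgeScore]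
  rw [← Nat.cast_smul_eq_nsmul ℝ, smul_smul _ (s.card : ℝ), inv_mul_cancel₀ hc, one_smul]

lemma sub_empSecondMoment_eq_mean (M : EuclideanSpace ℝ (Fin d) →L[ℝ] EuclideanSpace ℝ (Fin d)) (w : EuclideanSpace ℝ (Fin d)) {s : Finset ℕ} (hs : s.Nonempty)
    (x : ℕ → EuclideanSpace ℝ (Fin d) × ℝ) :
    M w - empSecondMoment s x w = -((s.card : ℝ)⁻¹ • ∑ i ∈ s, centredMoment M w (x i)) := by
  have hc : (s.card : ℝ) ≠ 0 := by exact_mod_cast hs.card_pos.ne'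
  simp only [centredMoment, Finset.sum_sub_distrib, Finset.sum_const, smul_sub,
    empSecondMoment_apply]
  rw [← Nat.cast_smul_eq_nsmul ℝ, smul_smul _ (s.card : ℝ), inv_mul_cancel₀ hc, one_smul, neg_sub]

lemma coord_eq_inner (v : EuclideanSpace ℝ (Fin d)) (k : Fin d) : v k = inner ℝ v (EuclideanSpace.single k 1) := by
  simp [EuclideanSpace.inner_single_right]

namespace RidgeModel

variable {X : ℕ → Ω → EuclideanSpace ℝ (Fin d) × ℝ} {X' Xt : Ω → EuclideanSpace ℝ (Fin d) × ℝ} {M : EuclideanSpace ℝ (Fin d) →L[ℝ] EuclideanSpace ℝ (Fin d)} {θ w : EuclideanSpace ℝ (Fin d)}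

lemma op_symm (h : RidgeModel lam X X' Xt μ M θ w) (u v : EuclideanSpace ℝ (Fin d)) :
    inner ℝ (M u) v = inner ℝ (M v) u := by
  rw [h.inner_op, h.inner_op]
  exact integral_congr_ae (ae_of_all _ fun ω => mul_comm _ _)

lemma memLp_fst_of_identDistrib (h : RidgeModel lam X X' Xt μ M θ w) {W : Ω → EuclideanSpace ℝ (Fin d) × ℝ}
    (hW : IdentDistrib W (X 0) μ μ) : MemLp (fun ω => (W ω).1) 4 μ :=
  (hW.comp measurable_fst).memLp_iff.2 h.memLp_fst

lemma memLp_snd_of_identDistrib (h : RidgeModel lam X X' Xt μ M θ w) {W : Ω → EuclideanSpace ℝ (Fin d) × ℝ}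
    (hW : IdentDistrib W (X 0) μ μ) : MemLp (fun ω => (W ω).2) 4 μ :=
  (hW.comp measurable_snd).memLp_iff.2 h.memLp_snd

variable [IsProbabilityMeasure μ]

lemma memLp_inner_two (h : RidgeModel lam X X' Xt μ M θ w) (v : EuclideanSpace ℝ (Fin d)) :
    MemLp (fun ω => inner ℝ (X 0 ω).1 v) 2 μ :=
  (memLp_inner_fst h.memLp_fst v).mono_exponent (by norm_num)

lemma memLp_fitResidual_two (h : RidgeModel lam X X' Xt μ M θ w) (v : EuclideanSpace ℝ (Fin d)) :
    MemLp (fun ω => fitResidual v (X 0 ω)) 2 μ :=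
  (memLp_fitResidual h.memLp_fst h.memLp_snd v).mono_exponent (by norm_num)

/-- The risk as a quadratic function around the population minimiser. -/
lemma risk_eq (h : RidgeModel lam X X' Xt μ M θ w) (v : EuclideanSpace ℝ (Fin d)) :
    risk sqLoss Xt μ v = ∫ ω, fitResidual θ (X 0 ω) ^ 2 ∂μ
      + (-(2 * (lam * inner ℝ θ (v - θ))) + inner ℝ (M (v - θ)) (v - θ)) := by
  have h1 : risk sqLoss Xt μ v = ∫ ω, sqLoss (X 0 ω) v ∂μ :=
    (h.iid.identDistrib_test.comp (u := fun x => sqLoss x v)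
      (measurable_sqLoss.comp (measurable_id.prodMk measurable_const))).integral_eq
  have h2 : ∀ ω, sqLoss (X 0 ω) v = fitResidual θ (X 0 ω) ^ 2
      - 2 * (fitResidual θ (X 0 ω) * inner ℝ (X 0 ω).1 (v - θ))
      + inner ℝ (X 0 ω).1 (v - θ) * inner ℝ (X 0 ω).1 (v - θ) := fun ω => by
    rw [sqLoss_eq, fitResidual_eq_sub v θ]; ring
  have i1 := (h.memLp_fitResidual_two θ).integrable_sq
  have i2 := integrable_mul_of_memLp_two (h.memLp_fitResidual_two θ) (h.memLp_inner_two (v - θ))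
  have i3 := integrable_mul_of_memLp_two (h.memLp_inner_two (v - θ)) (h.memLp_inner_two (v - θ))
  simp only [h1, h2]
  rw [integral_add (i1.sub' (i2.const_mul 2)) i3, integral_sub i1 (i2.const_mul 2),
    integral_const_mul, h.integral_score, h.inner_op]
  ring

/-- The central expansion: a constant, a mean of independent centred terms, and a quadratically
small remainder. It is an exact identity for every data set. -/
lemma risk_ridgeEstimator (h : RidgeModel lam X X' Xt μ M θ w) (s : Finset ℕ)
    (x : ℕ → EuclideanSpace ℝ (Fin d) × ℝ) :
    risk sqLoss Xt μ (ridgeEstimator lam s x) = ∫ ω, fitResidual θ (X 0 ω) ^ 2 ∂μ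
      + (2 * inner ℝ w (ridgeScore lam θ s x) + ridgeRemainder lam M θ w s x) := by
  rw [h.risk_eq, quadratic_ridgeEstimator_sub h.lam_pos h.direction]

lemma measurable_risk (h : RidgeModel lam X X' Xt μ M θ w) :
    Measurable fun v => risk sqLoss Xt μ v := by
  simp only [h.risk_eq]
  exact Continuous.measurable (by fun_prop)

/-- Quadratic growth of the risk, used to transfer integrability from the squared norm of the
estimator. -/
lemma exists_risk_le (h : RidgeModel lam X X' Xt μ M θ w) :
    ∃ C : ℝ, 0 ≤ C ∧ ∀ v, |risk sqLoss Xt μ v| ≤ C * (1 + ‖v‖ ^ 2) := by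
  refine ⟨2 * (∫ ω, ((X 0 ω).2 ^ 2 + ‖(X 0 ω).1‖ ^ 2) ∂μ), ?_, fun v => ?_⟩
  · exact mul_nonneg two_pos.le (integral_nonneg fun ω => by positivity)
  have h1 : risk sqLoss Xt μ v = ∫ ω, sqLoss (X 0 ω) v ∂μ :=
    (h.iid.identDistrib_test.comp (u := fun x => sqLoss x v)
      (measurable_sqLoss.comp (measurable_id.prodMk measurable_const))).integral_eq
  have i1 : Integrable (fun ω => (X 0 ω).2 ^ 2 + ‖(X 0 ω).1‖ ^ 2) μ :=
    ((h.memLp_snd.mono_exponent (by norm_num : (2 : ENNReal) ≤ 4)).integrable_sq).add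
      ((memLp_norm_sq_fst (q := 2) h.memLp_fst).integrable one_le_two)
  rw [h1, abs_of_nonneg (integral_nonneg fun ω => sqLoss_nonneg _ _)]
  calc ∫ ω, sqLoss (X 0 ω) v ∂μ
      ≤ ∫ ω, 2 * (1 + ‖v‖ ^ 2) * ((X 0 ω).2 ^ 2 + ‖(X 0 ω).1‖ ^ 2) ∂μ := by
        refine integral_mono_of_nonneg (ae_of_all _ fun ω => sqLoss_nonneg _ _)
          (i1.const_mul _) (ae_of_all _ fun ω => (sqLoss_le _ _).trans ?_)
        have := mul_nonneg (sq_nonneg ‖v‖) (sq_nonneg (X 0 ω).2)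
        have := sq_nonneg ‖(X 0 ω).1‖
        dsimp only
        linarith
    _ = _ := by rw [integral_const_mul]; ring

lemma memLp_centredScore {p q : ENNReal} [ENNReal.HolderTriple p p q]
    (hZ : MemLp (fun ω => (X 0 ω).1) p μ) (hY : MemLp (fun ω => (X 0 ω).2) p μ) :
    MemLp (fun ω => centredScore lam θ (X 0 ω)) q μ :=
  (memLp_score hZ hY θ).sub (memLp_const _)

lemma memLp_centredMoment {p q : ENNReal} [ENNReal.HolderTriple p p q]
    (hZ : MemLp (fun ω => (X 0 ω).1) p μ) :
    MemLp (fun ω => centredMoment M w (X 0 ω)) q μ :=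
  (memLp_inner_smul hZ w).sub (memLp_const _)

lemma integral_inner_centredScore (h : RidgeModel lam X X' Xt μ M θ w) (v : EuclideanSpace ℝ (Fin d)) :
    ∫ ω, inner ℝ (centredScore lam θ (X 0 ω)) v ∂μ = 0 := by
  simp only [centredScore, score, inner_sub_left, real_inner_smul_left]
  rw [integral_sub (integrable_mul_of_memLp_two (h.memLp_fitResidual_two θ) (h.memLp_inner_two v))
    (integrable_const _), h.integral_score]
  simp

lemma integral_inner_centredMoment (h : RidgeModel lam X X' Xt μ M θ w) (v : EuclideanSpace ℝ (Fin d)) :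
    ∫ ω, inner ℝ (centredMoment M w (X 0 ω)) v ∂μ = 0 := by
  simp only [centredMoment, inner_sub_left, real_inner_smul_left]
  rw [integral_sub (integrable_mul_of_memLp_two (h.memLp_inner_two w) (h.memLp_inner_two v))
    (integrable_const _), h.inner_op]
  simp

lemma integral_norm_sq_ridgeScore (h : RidgeModel lam X X' Xt μ M θ w) {s : Finset ℕ}
    (hs : s.Nonempty) :
    ∫ ω, ‖ridgeScore lam θ s (dataset X ω)‖ ^ 2 ∂μ
      = (s.card : ℝ)⁻¹ * ∫ ω, ‖centredScore lam θ (X 0 ω)‖ ^ 2 ∂μ := by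
  have hc : (s.card : ℝ) ≠ 0 := by exact_mod_cast hs.card_pos.ne'
  have h1 := integral_norm_sum_sq (ξ := fun i ω => centredScore lam θ (X i ω))
    (h.iid.iIndepFun_obs.comp (fun _ => centredScore lam θ) fun _ => measurable_centredScore θ)
    (fun i => (measurable_centredScore θ).comp (h.iid.measurable_obs i))
    (fun i => (h.iid.identDistrib_obs i).comp (measurable_centredScore θ))
    (fun k => by simp only [coord_eq_inner]; exact h.integral_inner_centredScore _)
    (memLp_centredScore h.memLp_fst h.memLp_snd) s
  simp only [ridgeScore_eq_mean θ hs, norm_smul, mul_pow, dataset]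
  rw [integral_const_mul, h1, norm_inv, Real.norm_natCast]
  field_simp

lemma integral_norm_sq_sub_empSecondMoment (h : RidgeModel lam X X' Xt μ M θ w)
    {s : Finset ℕ} (hs : s.Nonempty) :
    ∫ ω, ‖M w - empSecondMoment s (dataset X ω) w‖ ^ 2 ∂μ
      = (s.card : ℝ)⁻¹ * ∫ ω, ‖centredMoment M w (X 0 ω)‖ ^ 2 ∂μ := by
  have hc : (s.card : ℝ) ≠ 0 := by exact_mod_cast hs.card_pos.ne'
  have h1 := integral_norm_sum_sq (ξ := fun i ω => centredMoment M w (X i ω))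
    (h.iid.iIndepFun_obs.comp (fun _ => centredMoment M w) fun _ => measurable_centredMoment M w)
    (fun i => (measurable_centredMoment M w).comp (h.iid.measurable_obs i))
    (fun i => (h.iid.identDistrib_obs i).comp (measurable_centredMoment M w))
    (fun k => by simp only [coord_eq_inner]; exact h.integral_inner_centredMoment _)
    (memLp_centredMoment h.memLp_fst) s
  simp only [sub_empSecondMoment_eq_mean M w hs, norm_neg, norm_smul, mul_pow, dataset]
  rw [integral_const_mul, h1, norm_inv, Real.norm_natCast]
  field_simp

/-- The score is quadratic in the observation, so a fourth moment of its mean costs eight moments of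
covariates and responses. -/
lemma exists_integral_norm_pow_four_ridgeScore_le (h : RidgeModel lam X X' Xt μ M θ w)
    (hZ : MemLp (fun ω => (X 0 ω).1) 8 μ) (hY : MemLp (fun ω => (X 0 ω).2) 8 μ) :
    ∃ C : ℝ, 0 ≤ C ∧ ∀ s : Finset ℕ, s.Nonempty →
      ∫ ω, ‖ridgeScore lam θ s (dataset X ω)‖ ^ 4 ∂μ ≤ C * ((s.card : ℝ)⁻¹) ^ 2 := by
  obtain ⟨C, hC, h1⟩ := exists_integral_norm_sum_pow_four_le
    (ξ := fun i ω => centredScore lam θ (X i ω))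
    (h.iid.iIndepFun_obs.comp (fun _ => centredScore lam θ) fun _ => measurable_centredScore θ)
    (fun i => (measurable_centredScore θ).comp (h.iid.measurable_obs i))
    (fun i => (h.iid.identDistrib_obs i).comp (measurable_centredScore θ))
    (fun k => by simp only [coord_eq_inner]; exact h.integral_inner_centredScore _)
    (memLp_centredScore hZ hY)
  refine ⟨C, hC, fun s hs => ?_⟩
  have hc : (s.card : ℝ) ≠ 0 := by exact_mod_cast hs.card_pos.ne'
  simp only [ridgeScore_eq_mean θ hs, norm_smul, mul_pow, dataset]
  rw [integral_const_mul, norm_inv, Real.norm_natCast]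
  calc _ ≤ ((s.card : ℝ)⁻¹) ^ 4 * (C * s.card ^ 2) :=
        mul_le_mul_of_nonneg_left (h1 s) (by positivity)
    _ = _ := by field_simp

lemma exists_integral_norm_pow_four_sub_empSecondMoment_le
    (h : RidgeModel lam X X' Xt μ M θ w) (hZ : MemLp (fun ω => (X 0 ω).1) 8 μ) :
    ∃ C : ℝ, 0 ≤ C ∧ ∀ s : Finset ℕ, s.Nonempty →
      ∫ ω, ‖M w - empSecondMoment s (dataset X ω) w‖ ^ 4 ∂μ ≤ C * ((s.card : ℝ)⁻¹) ^ 2 := by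
  obtain ⟨C, hC, h1⟩ := exists_integral_norm_sum_pow_four_le
    (ξ := fun i ω => centredMoment M w (X i ω))
    (h.iid.iIndepFun_obs.comp (fun _ => centredMoment M w) fun _ => measurable_centredMoment M w)
    (fun i => (measurable_centredMoment M w).comp (h.iid.measurable_obs i))
    (fun i => (h.iid.identDistrib_obs i).comp (measurable_centredMoment M w))
    (fun k => by simp only [coord_eq_inner]; exact h.integral_inner_centredMoment _)
    (memLp_centredMoment hZ)
  refine ⟨C, hC, fun s hs => ?_⟩
  have hc : (s.card : ℝ) ≠ 0 := by exact_mod_cast hs.card_pos.ne'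
  simp only [sub_empSecondMoment_eq_mean M w hs, norm_neg, norm_smul, mul_pow, dataset]
  rw [integral_const_mul, norm_inv, Real.norm_natCast]
  calc _ ≤ ((s.card : ℝ)⁻¹) ^ 4 * (C * s.card ^ 2) :=
        mul_le_mul_of_nonneg_left (h1 s) (by positivity)
    _ = _ := by field_simp

lemma memLp_ridgeScore (h : RidgeModel lam X X' Xt μ M θ w) {p q : ENNReal}
    [ENNReal.HolderTriple p p q] (hZ : MemLp (fun ω => (X 0 ω).1) p μ)
    (hY : MemLp (fun ω => (X 0 ω).2) p μ) (s : Finset ℕ) :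
    MemLp (fun ω => ridgeScore lam θ s (dataset X ω)) q μ := by
  have h1 : ∀ i, MemLp (fun ω => score θ (X i ω)) q μ := fun i =>
    ((h.iid.identDistrib_obs i).comp (continuous_score θ).measurable).memLp_iff.2
      (memLp_score hZ hY θ)
  have h2 : MemLp (fun ω => (s.card : ℝ)⁻¹ • ∑ i ∈ s, score θ (X i ω)) q μ :=
    (memLp_finsetSum s fun i _ => h1 i).const_smul (s.card : ℝ)⁻¹
  exact h2.sub (memLp_const (lam • θ))

lemma memLp_sub_empSecondMoment (h : RidgeModel lam X X' Xt μ M θ w) {p q : ENNReal}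
    [ENNReal.HolderTriple p p q] (hZ : MemLp (fun ω => (X 0 ω).1) p μ) (s : Finset ℕ) :
    MemLp (fun ω => M w - empSecondMoment s (dataset X ω) w) q μ := by
  have h1 : ∀ i, MemLp (fun ω => inner ℝ (X i ω).1 w • (X i ω).1) q μ := fun i =>
    ((h.iid.identDistrib_obs i).comp (u := fun x : EuclideanSpace ℝ (Fin d) × ℝ => inner ℝ x.1 w • x.1)
      (by fun_prop)).memLp_iff.2 (memLp_inner_smul hZ w)
  simp only [empSecondMoment_apply]
  have h2 : MemLp (fun ω => (s.card : ℝ)⁻¹ • ∑ i ∈ s, inner ℝ (X i ω).1 w • (X i ω).1) q μ :=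
    (memLp_finsetSum s fun i _ => h1 i).const_smul (s.card : ℝ)⁻¹
  exact (memLp_const (M w)).sub h2

end RidgeModel

end RidgeModelMoments

/-! ### Convergence of the average loss and of the leave-one-out deviations. -/

section Rho

variable {Ω : Type*} [MeasurableSpace Ω] {μ : Measure Ω} {d : ℕ} {lam : ℝ}

/-- Freezing a coordinate removes the dependence on it; leave-one-out quantities thereby become
independent of the deleted observation. -/
lemma DependsOn.comp_update {ι α β : Type*} [DecidableEq ι] {G : (ι → α) → β} {s : Finset ι}
    (hG : DependsOn G s) (i : ι) (c : α) :
    DependsOn (fun u => G (Function.update u i c)) ↑(s.erase i) := by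
  intro x y hxy
  refine hG fun j hj => ?_
  by_cases hji : j = i
  · subst hji; simp
  · rw [Function.update_of_ne hji, Function.update_of_ne hji]
    exact hxy j (by simpa [hji] using hj)

/-- The deviation of the leave-one-out quantities from their limits. -/
noncomputable def looDeviation (lam : ℝ) (M : EuclideanSpace ℝ (Fin d) →L[ℝ] EuclideanSpace ℝ (Fin d)) (θ w : EuclideanSpace ℝ (Fin d)) (l : ℕ)
    (x : ℕ → EuclideanSpace ℝ (Fin d) × ℝ) : ℝ :=
  ‖M w - empSecondMoment (Finset.range l) (Function.update x 0 0) w‖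
    + ‖ridgeEstimator lam (Finset.range l) (Function.update x 0 0) - θ‖
    + ‖M w - empSecondMoment (Finset.range l) (Function.update x 0 0) w‖ ^ 2
    + ‖ridgeEstimator lam (Finset.range l) (Function.update x 0 0) - θ‖ ^ 2

lemma measurable_update_zero {𝒳 : Type*} [MeasurableSpace 𝒳] (c : 𝒳) :
    Measurable fun x : ℕ → 𝒳 => Function.update x 0 c :=
  measurable_pi_lambda _ fun i => by
    by_cases hi : i = 0
    · subst hi; simp
    · simpa [Function.update_of_ne hi] using measurable_pi_apply i

lemma measurable_empSecondMoment (s : Finset ℕ) (w : EuclideanSpace ℝ (Fin d)) :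
    Measurable fun x : ℕ → EuclideanSpace ℝ (Fin d) × ℝ => empSecondMoment s x w := by
  simp only [empSecondMoment_apply]
  exact Continuous.measurable (by fun_prop)

lemma measurable_looDeviation (hlam : 0 < lam) (M : EuclideanSpace ℝ (Fin d) →L[ℝ] EuclideanSpace ℝ (Fin d)) (θ w : EuclideanSpace ℝ (Fin d)) (l : ℕ) :
    Measurable (looDeviation lam M θ w l) := by
  have h1 : Measurable fun x : ℕ → EuclideanSpace ℝ (Fin d) × ℝ =>
      ‖M w - empSecondMoment (Finset.range l) (Function.update x 0 0) w‖ :=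
    (measurable_const.sub
      ((measurable_empSecondMoment _ w).comp (measurable_update_zero 0))).norm
  have h2 : Measurable fun x : ℕ → EuclideanSpace ℝ (Fin d) × ℝ =>
      ‖ridgeEstimator lam (Finset.range l) (Function.update x 0 0) - θ‖ :=
    (((measurable_ridgeEstimator hlam _).comp (measurable_update_zero 0)).sub
      measurable_const).norm
  exact ((h1.add h2).add (h1.pow_const 2)).add (h2.pow_const 2)

lemma dependsOn_looDeviation (M : EuclideanSpace ℝ (Fin d) →L[ℝ] EuclideanSpace ℝ (Fin d)) (θ w : EuclideanSpace ℝ (Fin d)) (l : ℕ) :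
    DependsOn (looDeviation lam M θ w l) ↑((Finset.range l).erase 0) := by
  intro x y hxy
  have h1 := (dependsOn_empSecondMoment (d := d) (Finset.range l)).comp_update 0 0 hxy
  have h2 := (dependsOn_ridgeEstimator (d := d) (lam := lam) (Finset.range l)).comp_update 0 0 hxy
  simp only at h1 h2
  rw [looDeviation, looDeviation, h1, h2]

lemma norm_add_sq_le_two (u v : EuclideanSpace ℝ (Fin d)) : ‖u + v‖ ^ 2 ≤ 2 * ‖u‖ ^ 2 + 2 * ‖v‖ ^ 2 := by
  have h1 := pow_le_pow_left₀ (norm_nonneg _) (norm_add_le u v) 2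
  nlinarith [sq_nonneg (‖u‖ - ‖v‖)]

lemma measurable_leverageBound (l : ℕ) :
    Measurable (leverageBound lam l : EuclideanSpace ℝ (Fin d) × ℝ → ℝ) := by
  unfold leverageBound
  exact Continuous.measurable (by fun_prop)

lemma leverageBound_nonneg (hlam : 0 < lam) (l : ℕ) (x : EuclideanSpace ℝ (Fin d) × ℝ) : 0 ≤ leverageBound lam l x :=
  le_min zero_le_one (by positivity)

/-- Pointwise only, not uniformly in x; it is used through dominated convergence with the bound 1.
-/
lemma tendsto_leverageBound (x : EuclideanSpace ℝ (Fin d) × ℝ) :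
    Tendsto (fun l => leverageBound lam l x) atTop (𝓝 0) := by
  have h1 : Tendsto (fun l : ℕ => ‖x.1‖ ^ 2 / (lam * l)) atTop (𝓝 0) := by
    have := (tendsto_const_div_atTop_nhds_zero_nat (‖x.1‖ ^ 2 / lam))
    simpa only [div_div] using this
  have h2 := (tendsto_const_nhds (x := (1 : ℝ))).min h1
  rwa [min_eq_right zero_le_one] at h2

namespace RidgeModel

variable {X : ℕ → Ω → EuclideanSpace ℝ (Fin d) × ℝ} {X' Xt : Ω → EuclideanSpace ℝ (Fin d) × ℝ} {M : EuclideanSpace ℝ (Fin d) →L[ℝ] EuclideanSpace ℝ (Fin d)} {θ w : EuclideanSpace ℝ (Fin d)}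

lemma lam_inv_bound (h : RidgeModel lam X X' Xt μ M θ w) (s : Finset ℕ) (x : ℕ → EuclideanSpace ℝ (Fin d) × ℝ) :
    ‖ridgeEstimator lam s x - θ‖ ≤ lam⁻¹ * ‖ridgeScore lam θ s x‖ := by
  rw [inv_mul_eq_div, le_div_iff₀ h.lam_pos, mul_comm]
  exact norm_ridgeEstimator_sub_le h.lam_pos s x θ

lemma measurable_ridgeEstimator_dataset (h : RidgeModel lam X X' Xt μ M θ w) (s : Finset ℕ) :
    Measurable fun ω => ridgeEstimator lam s (dataset X ω) :=
  (measurable_ridgeEstimator h.lam_pos s).comp h.iid.measurable_dataset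

variable [IsProbabilityMeasure μ]

lemma memLp_ridgeEstimator_sub (h : RidgeModel lam X X' Xt μ M θ w) (s : Finset ℕ) :
    MemLp (fun ω => ridgeEstimator lam s (dataset X ω) - θ) 2 μ :=
  ((h.memLp_ridgeScore h.memLp_fst h.memLp_snd s).norm.const_mul lam⁻¹).mono'
    ((h.measurable_ridgeEstimator_dataset s).sub_const θ).aestronglyMeasurable
    (ae_of_all _ fun _ => h.lam_inv_bound s _)

lemma tendsto_integral_norm_sq_ridgeEstimator_sub (h : RidgeModel lam X X' Xt μ M θ w) :
    Tendsto (fun l : ℕ => ∫ ω, ‖ridgeEstimator lam (Finset.range l) (dataset X ω) - θ‖ ^ 2 ∂μ)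
      atTop (𝓝 0) := by
  have h1 : Tendsto (fun l : ℕ => lam⁻¹ ^ 2 *
      ((l : ℝ)⁻¹ * ∫ ω, ‖centredScore lam θ (X 0 ω)‖ ^ 2 ∂μ)) atTop (𝓝 0) := by
    have := ((tendsto_inv_atTop_nhds_zero_nat (𝕜 := ℝ)).mul_const
      (∫ ω, ‖centredScore lam θ (X 0 ω)‖ ^ 2 ∂μ)).const_mul (lam⁻¹ ^ 2)
    rwa [zero_mul, mul_zero] at this
  refine squeeze_zero' (Eventually.of_forall fun l => integral_nonneg fun ω => by positivity) ?_ h1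
  filter_upwards [eventually_gt_atTop 0] with l hl
  have h2 := h.integral_norm_sq_ridgeScore (Finset.nonempty_range_iff.2 hl.ne')
  rw [Finset.card_range] at h2
  rw [← h2, ← integral_const_mul]
  have h3 : MemLp (fun ω => ridgeScore lam θ (Finset.range l) (dataset X ω)) 2 μ :=
    h.memLp_ridgeScore h.memLp_fst h.memLp_snd _
  refine integral_mono_of_nonneg (ae_of_all _ fun ω => by positivity)
    (((memLp_two_iff_integrable_sq_norm h3.aestronglyMeasurable).1 h3).const_mul _)
    (ae_of_all _ fun ω => ?_)
  dsimp only
  rw [← mul_pow]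
  exact pow_le_pow_left₀ (norm_nonneg _) (h.lam_inv_bound _ _) 2

lemma measurable_meanLoss (h : RidgeModel lam X X' Xt μ M θ w) (l : ℕ) :
    Measurable (meanLoss (ridgeEstimator lam) sqLoss X μ l) := by
  have h1 : StronglyMeasurable (Function.uncurry fun (x : EuclideanSpace ℝ (Fin d) × ℝ) ω =>
      sqLoss x (ridgeEstimator lam (Finset.range l) (dataset X ω))) :=
    (measurable_sqLoss.comp (measurable_fst.prodMk
      ((h.measurable_ridgeEstimator_dataset _).comp measurable_snd))).stronglyMeasurable
  exact h1.integral_prod_right.measurable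

/-- The average loss converges to the loss of the population minimiser. -/
lemma exists_abs_meanLoss_sub_le (h : RidgeModel lam X X' Xt μ M θ w) :
    ∃ κ : ℕ → ℝ, Tendsto κ atTop (𝓝 0) ∧ ∀ l x,
      |meanLoss (ridgeEstimator lam) sqLoss X μ l x - fitResidual θ x ^ 2|
        ≤ κ l * obsBound θ x := by
  have hL := fun l => h.memLp_ridgeEstimator_sub (Finset.range l)
  have hsq := fun l => (memLp_two_iff_integrable_sq_norm (hL l).aestronglyMeasurable).1 (hL l)
  have h2 := h.tendsto_integral_norm_sq_ridgeEstimator_sub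
  have h1 := tendsto_integral_of_tendsto_integral_sq
    (f := fun l ω => ‖ridgeEstimator lam (Finset.range l) (dataset X ω) - θ‖)
    (Eventually.of_forall fun l => (hL l).norm) h2
  -- The rate is E‖δ‖ + E‖δ‖²: the loss difference is linear plus quadratic in δ, with coefficients
  -- that `obsBound` dominates.
  refine ⟨fun l => ∫ ω, ‖ridgeEstimator lam (Finset.range l) (dataset X ω) - θ‖ ∂μ
    + ∫ ω, ‖ridgeEstimator lam (Finset.range l) (dataset X ω) - θ‖ ^ 2 ∂μ,
    by simpa using h1.add h2, fun l x => ?_⟩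
  set δ := fun ω => ridgeEstimator lam (Finset.range l) (dataset X ω) - θ with hδ
  have hP : 0 ≤ obsBound θ x := by unfold obsBound; positivity
  have hpt : ∀ ω, sqLoss x (ridgeEstimator lam (Finset.range l) (dataset X ω))
      - fitResidual θ x ^ 2
      = -(2 * fitResidual θ x * inner ℝ x.1 (δ ω)) + inner ℝ x.1 (δ ω) ^ 2 := fun ω => by
    rw [sqLoss_eq, fitResidual_eq_sub _ θ]; ring
  have i1 : Integrable (fun ω => inner ℝ x.1 (δ ω)) μ := ((hL l).const_inner x.1).integrable one_le_two
  have i2 : Integrable (fun ω => inner ℝ x.1 (δ ω) ^ 2) μ := ((hL l).const_inner x.1).integrable_sq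
  have i3 := ((i1.const_mul (2 * fitResidual θ x)).neg).add i2
  have hint : Integrable (fun ω => sqLoss x (ridgeEstimator lam (Finset.range l) (dataset X ω))) μ := by
    refine (i3.add (integrable_const (fitResidual θ x ^ 2))).congr (ae_of_all _ fun ω => ?_)
    have := hpt ω
    simp only [Pi.add_apply, Pi.neg_apply]
    linarith
  have heq : meanLoss (ridgeEstimator lam) sqLoss X μ l x - fitResidual θ x ^ 2
      = ∫ ω, (sqLoss x (ridgeEstimator lam (Finset.range l) (dataset X ω))
        - fitResidual θ x ^ 2) ∂μ := by
    rw [integral_sub hint (integrable_const _)]; simp [meanLoss]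
  dsimp only
  rw [heq, ← integral_add ((hL l).norm.integrable one_le_two) (hsq l), ← integral_mul_const]
  refine (abs_integral_le_integral_abs).trans (integral_mono_of_nonneg
    (ae_of_all _ fun ω => abs_nonneg _) ?_ (ae_of_all _ fun ω => ?_))
  · exact (((hL l).norm.integrable one_le_two).add (hsq l)).mul_const _
  dsimp only
  rw [hpt]
  have ha : |inner ℝ x.1 (δ ω)| ≤ ‖x.1‖ * ‖δ ω‖ := abs_real_inner_le_norm _ _
  have hb : 2 * |fitResidual θ x| * ‖x.1‖ ≤ obsBound θ x := by
    rw [obsBound, ← sq_abs (fitResidual θ x)]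
    nlinarith [sq_nonneg (|fitResidual θ x| - ‖x.1‖)]
  have hc : ‖x.1‖ ^ 2 ≤ obsBound θ x := by
    rw [obsBound]; nlinarith [sq_nonneg (fitResidual θ x)]
  calc |-(2 * fitResidual θ x * inner ℝ x.1 (δ ω)) + inner ℝ x.1 (δ ω) ^ 2|
      ≤ 2 * |fitResidual θ x| * |inner ℝ x.1 (δ ω)| + |inner ℝ x.1 (δ ω)| ^ 2 := by
        refine (abs_add_le _ _).trans (le_of_eq ?_)
        simp [abs_mul]
    _ ≤ 2 * |fitResidual θ x| * (‖x.1‖ * ‖δ ω‖) + (‖x.1‖ * ‖δ ω‖) ^ 2 := by gcongr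
    _ = (2 * |fitResidual θ x| * ‖x.1‖) * ‖δ ω‖ + ‖x.1‖ ^ 2 * ‖δ ω‖ ^ 2 := by ring
    _ ≤ obsBound θ x * ‖δ ω‖ + obsBound θ x * ‖δ ω‖ ^ 2 := by gcongr
    _ = _ := by ring

/-- The leave-one-out deviation is integrable and vanishes in mean. -/
lemma tendsto_integral_looDeviation (h : RidgeModel lam X X' Xt μ M θ w) :
    (∀ l : ℕ, 0 < l → Integrable (fun ω => looDeviation lam M θ w l (dataset X ω)) μ) ∧
    Tendsto (fun l => ∫ ω, looDeviation lam M θ w l (dataset X ω) ∂μ) atTop (𝓝 0) := by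
  set A : ℕ → Ω → EuclideanSpace ℝ (Fin d) := fun l ω =>
    M w - empSecondMoment (Finset.range l) (Function.update (dataset X ω) 0 0) w with hA
  set B : ℕ → Ω → EuclideanSpace ℝ (Fin d) := fun l ω =>
    ridgeEstimator lam (Finset.range l) (Function.update (dataset X ω) 0 0) - θ with hB
  -- The leave-one-out deviations are not centred; each is compared with the full-sample one, from
  -- which it differs by a single observation divided by l.
  have eA : ∀ l, 0 < l → A l = fun ω => (M w - empSecondMoment (Finset.range l) (dataset X ω) w)
      + (l : ℝ)⁻¹ • (inner ℝ (X 0 ω).1 w • (X 0 ω).1) := fun l hl => by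
    funext ω
    have := empSecondMoment_update l (dataset X ω) hl w
    simp only [hA, this, dataset, smul_smul]
    abel
  have eS : ∀ l, 0 < l → (fun ω => ridgeScore lam θ (Finset.range l)
      (Function.update (dataset X ω) 0 0)) = fun ω => ridgeScore lam θ (Finset.range l) (dataset X ω)
      + (-(l : ℝ)⁻¹) • score θ (X 0 ω) := fun l hl => by
    funext ω
    have := ridgeScore_update (lam := lam) (θ := θ) l (dataset X ω) hl
    rw [this]
    simp only [dataset, neg_smul]
    abel
  have m1 : MemLp (fun ω => inner ℝ (X 0 ω).1 w • (X 0 ω).1) 2 μ := memLp_inner_smul h.memLp_fst w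
  have m2 : MemLp (fun ω => score θ (X 0 ω)) 2 μ := memLp_score h.memLp_fst h.memLp_snd θ
  have m3 := fun l : ℕ => h.memLp_sub_empSecondMoment (q := 2) h.memLp_fst (Finset.range l)
  have m4 := fun l : ℕ => h.memLp_ridgeScore (q := 2) h.memLp_fst h.memLp_snd (Finset.range l)
  have LA : ∀ l, 0 < l → MemLp (A l) 2 μ := fun l hl => by
    rw [eA l hl]; exact (m3 l).add (m1.const_smul (l : ℝ)⁻¹)
  have LS : ∀ l, 0 < l → MemLp (fun ω => ridgeScore lam θ (Finset.range l)
      (Function.update (dataset X ω) 0 0)) 2 μ := fun l hl => by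
    rw [eS l hl]; exact (m4 l).add (m2.const_smul (-(l : ℝ)⁻¹))
  have LB : ∀ l, 0 < l → MemLp (B l) 2 μ := fun l hl =>
    ((LS l hl).norm.const_mul lam⁻¹).mono'
      ((((measurable_ridgeEstimator h.lam_pos _).comp ((measurable_update_zero 0).comp
        h.iid.measurable_dataset)).sub_const θ).aestronglyMeasurable)
      (ae_of_all _ fun _ => h.lam_inv_bound _ _)
  have sqi : ∀ {f : Ω → EuclideanSpace ℝ (Fin d)}, MemLp f 2 μ → Integrable (fun ω => ‖f ω‖ ^ 2) μ := fun hf =>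
    (memLp_two_iff_integrable_sq_norm hf.aestronglyMeasurable).1 hf
  have hinv : Tendsto (fun l : ℕ => (l : ℝ)⁻¹) atTop (𝓝 0) := tendsto_inv_atTop_nhds_zero_nat
  have tend : ∀ a b : ℝ, Tendsto (fun l : ℕ => 2 * ((l : ℝ)⁻¹ * a) + 2 * ((l : ℝ)⁻¹ ^ 2 * b))
      atTop (𝓝 0) := fun a b => by
    simpa using ((hinv.mul_const a).const_mul 2).add (((hinv.pow 2).mul_const b).const_mul 2)
  have TA : Tendsto (fun l => ∫ ω, ‖A l ω‖ ^ 2 ∂μ) atTop (𝓝 0) := by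
    refine squeeze_zero' (Eventually.of_forall fun l => integral_nonneg fun ω => by positivity) ?_
      (tend (∫ ω, ‖centredMoment M w (X 0 ω)‖ ^ 2 ∂μ)
        (∫ ω, ‖inner ℝ (X 0 ω).1 w • (X 0 ω).1‖ ^ 2 ∂μ))
    filter_upwards [eventually_gt_atTop 0] with l hl
    have e := h.integral_norm_sq_sub_empSecondMoment (Finset.nonempty_range_iff.2 hl.ne')
    rw [Finset.card_range] at e
    rw [← e, ← integral_const_mul, ← integral_const_mul, ← integral_const_mul,
      ← integral_add ((sqi (m3 l)).const_mul _) (((sqi m1).const_mul _).const_mul _), eA l hl]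
    refine integral_mono_of_nonneg (ae_of_all _ fun ω => by positivity)
      (((sqi (m3 l)).const_mul _).add (((sqi m1).const_mul _).const_mul _))
      (ae_of_all _ fun ω => ?_)
    refine (norm_add_sq_le_two _ _).trans (le_of_eq ?_)
    rw [norm_smul (l : ℝ)⁻¹, mul_pow, norm_inv, Real.norm_natCast]
  have TS : Tendsto (fun l => ∫ ω, ‖ridgeScore lam θ (Finset.range l)
      (Function.update (dataset X ω) 0 0)‖ ^ 2 ∂μ) atTop (𝓝 0) := by
    refine squeeze_zero' (Eventually.of_forall fun l => integral_nonneg fun ω => by positivity) ?_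
      (tend (∫ ω, ‖centredScore lam θ (X 0 ω)‖ ^ 2 ∂μ) (∫ ω, ‖score θ (X 0 ω)‖ ^ 2 ∂μ))
    filter_upwards [eventually_gt_atTop 0] with l hl
    have e := h.integral_norm_sq_ridgeScore (Finset.nonempty_range_iff.2 hl.ne')
    rw [Finset.card_range] at e
    have e2 := fun ω => congrFun (eS l hl) ω
    simp only [e2]
    rw [← e, ← integral_const_mul, ← integral_const_mul, ← integral_const_mul,
      ← integral_add ((sqi (m4 l)).const_mul _) (((sqi m2).const_mul _).const_mul _)]
    refine integral_mono_of_nonneg (ae_of_all _ fun ω => by positivity)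
      (((sqi (m4 l)).const_mul _).add (((sqi m2).const_mul _).const_mul _))
      (ae_of_all _ fun ω => ?_)
    refine (norm_add_sq_le_two _ _).trans (le_of_eq ?_)
    rw [norm_smul (-(l : ℝ)⁻¹), mul_pow, norm_neg, norm_inv, Real.norm_natCast]
  -- The fit is never expanded here: its error is dominated by the deleted-sample score at θ, just
  -- treated.
  have TB : Tendsto (fun l => ∫ ω, ‖B l ω‖ ^ 2 ∂μ) atTop (𝓝 0) := by
    have := TS.const_mul (lam⁻¹ ^ 2)
    rw [mul_zero] at this
    refine squeeze_zero' (Eventually.of_forall fun l => integral_nonneg fun ω => by positivity) ?_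
      this
    filter_upwards [eventually_gt_atTop 0] with l hl
    rw [← integral_const_mul]
    refine integral_mono_of_nonneg (ae_of_all _ fun ω => by positivity)
      ((sqi (LS l hl)).const_mul _) (ae_of_all _ fun ω => ?_)
    dsimp only
    rw [← mul_pow]
    exact pow_le_pow_left₀ (norm_nonneg _) (h.lam_inv_bound _ _) 2
  have ev : ∀ {f : ℕ → Ω → EuclideanSpace ℝ (Fin d)}, (∀ l, 0 < l → MemLp (f l) 2 μ) →
      ∀ᶠ l in atTop, MemLp (fun ω => ‖f l ω‖) 2 μ := fun hf =>
    (eventually_gt_atTop 0).mono fun l hl => (hf l hl).norm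
  have TA1 := tendsto_integral_of_tendsto_integral_sq (ev LA) TA
  have TB1 := tendsto_integral_of_tendsto_integral_sq (ev LB) TB
  have i1 := fun l hl => ((LA l hl).norm.integrable one_le_two).fun_add
    ((LB l hl).norm.integrable one_le_two)
  have i2 := fun l hl => (i1 l hl).fun_add (sqi (LA l hl))
  have i3 := fun l hl => (i2 l hl).fun_add (sqi (LB l hl))
  refine ⟨i3, ?_⟩
  have := ((TA1.add TB1).add TA).add TB
  simp only [add_zero] at this
  refine this.congr' ?_
  filter_upwards [eventually_gt_atTop 0] with l hl
  simp only [looDeviation]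
  rw [integral_add (i2 l hl) (sqi (LB l hl)), integral_add (i1 l hl) (sqi (LA l hl)),
    integral_add ((LA l hl).norm.integrable one_le_two) ((LB l hl).norm.integrable one_le_two)]

end RidgeModel

end Rho

/-! ### Reducing the covariance in ρ to a covariance with the risk. -/

section RhoLimit

variable {Ω : Type*} [MeasurableSpace Ω] {μ : Measure Ω} {d : ℕ} {lam : ℝ}

namespace IIDWithCopies

variable {𝒳 : Type*} [MeasurableSpace 𝒳] [Inhabited 𝒳] {X : ℕ → Ω → 𝒳} {X' Xt : Ω → 𝒳}
  {α : Type*} [MeasurableSpace α]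

/-- An observation is independent of functions of the other observations. -/
lemma indepFun_obs (h : IIDWithCopies X X' Xt μ) (i : ℕ) {s : Finset ℕ} (hi : i ∉ s)
    {G : (ℕ → 𝒳) → α} (hG : Measurable G) (hGs : DependsOn G s) :
    IndepFun (X i) (fun ω => G (dataset X ω)) μ :=
  indepFun_of_dependsOn h.iIndepFun_obs h.measurable_obs (S := {i}) (T := s)
    (F := fun x => x i) (by simpa using hi) (measurable_pi_apply i) hG
    (fun x y hxy => hxy i (by simp)) hGs

/-- The test observation is independent of functions of the data. -/
lemma indepFun_test (h : IIDWithCopies X X' Xt μ) {s : Finset ℕ}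
    {G : (ℕ → 𝒳) → α} (hG : Measurable G) (hGs : DependsOn G s) :
    IndepFun Xt (fun ω => G (dataset X ω)) μ := by
  classical
  refine indepFun_of_dependsOn h.indep h.measurable (S := {Sum.inr 1})
    (T := s.map Function.Embedding.inl) (F := fun x => x (Sum.inr 1))
    (G := fun x => G fun i => x (Sum.inl i)) ?_ (measurable_pi_apply _)
    (hG.comp (measurable_pi_lambda _ fun i => measurable_pi_apply _))
    (fun x y hxy => hxy _ (by simp)) (fun x y hxy => hGs fun i hi => hxy _ ?_)
  · simp
  · simpa using hi

lemma indepFun_test_replaced (h : IIDWithCopies X X' Xt μ) {s : Finset ℕ}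
    {G : (ℕ → 𝒳) → α} (hG : Measurable G) (hGs : DependsOn G s) :
    IndepFun Xt (fun ω => G (datasetReplaced X X' ω)) μ := by
  classical
  have hm : Measurable fun x : ℕ ⊕ Fin 2 → 𝒳 =>
      Function.update (fun i => x (Sum.inl i)) 0 (x (Sum.inr 0)) :=
    measurable_pi_lambda _ fun i => by
      by_cases hi : i = 0
      · subst hi; simpa using measurable_pi_apply _
      · simpa [Function.update_of_ne hi] using measurable_pi_apply _
  refine indepFun_of_dependsOn h.indep h.measurable (S := {Sum.inr 1})
    (T := insert (Sum.inr 0) (s.map Function.Embedding.inl)) (F := fun x => x (Sum.inr 1))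
    (G := fun x => G (Function.update (fun i => x (Sum.inl i)) 0 (x (Sum.inr 0)))) ?_
    (measurable_pi_apply _) (hG.comp hm) (fun x y hxy => hxy _ (by simp))
    (fun x y hxy => hGs fun i hi => ?_)
  · simp
  · by_cases hi0 : i = 0
    · subst hi0; simpa using hxy (Sum.inr 0) (by simp)
    · simpa [Function.update_of_ne hi0] using hxy (Sum.inl i) (by simpa using hi)

/-- After the replacement no coordinate refers to `X 0`: index 0 is erased and the copy takes its
place, so `X 0` remains independent even jointly with the test observation. -/
lemma indepFun_obs_replaced (h : IIDWithCopies X X' Xt μ) {s : Finset ℕ}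
    {G : (ℕ → 𝒳) → 𝒳 → α} (hG : Measurable fun p : (ℕ → 𝒳) × 𝒳 => G p.1 p.2)
    (hGs : ∀ t, DependsOn (fun x => G x t) s) :
    IndepFun (X 0) (fun ω => G (datasetReplaced X X' ω) (Xt ω)) μ := by
  classical
  have hm : Measurable fun x : ℕ ⊕ Fin 2 → 𝒳 =>
      (Function.update (fun i => x (Sum.inl i)) 0 (x (Sum.inr 0)), x (Sum.inr 1)) :=
    (measurable_pi_lambda _ fun i => by
      by_cases hi : i = 0
      · subst hi; simpa using measurable_pi_apply _
      · simpa [Function.update_of_ne hi] using measurable_pi_apply _).prodMk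
      (measurable_pi_apply _)
  refine indepFun_of_dependsOn h.indep h.measurable (S := {Sum.inl 0})
    (T := insert (Sum.inr 1) (insert (Sum.inr 0) ((s.erase 0).map Function.Embedding.inl)))
    (F := fun x => x (Sum.inl 0))
    (G := fun x => G (Function.update (fun i => x (Sum.inl i)) 0 (x (Sum.inr 0)))
      (x (Sum.inr 1))) ?_ (measurable_pi_apply _) (hG.comp hm) (fun x y hxy => hxy _ (by simp))
    (fun x y hxy => ?_)
  · simp
  · dsimp only
    rw [hxy (Sum.inr 1) (by simp)]
    refine hGs _ fun i hi => ?_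
    by_cases hi0 : i = 0
    · subst hi0; simpa using hxy (Sum.inr 0) (by simp)
    · simpa [Function.update_of_ne hi0] using hxy (Sum.inl i) (by simpa [hi0] using hi)

end IIDWithCopies

namespace RidgeModel

variable {X : ℕ → Ω → EuclideanSpace ℝ (Fin d) × ℝ} {X' Xt : Ω → EuclideanSpace ℝ (Fin d) × ℝ} {M : EuclideanSpace ℝ (Fin d) →L[ℝ] EuclideanSpace ℝ (Fin d)} {θ w : EuclideanSpace ℝ (Fin d)}

lemma memLp_norm_sq_ridge (h : RidgeModel lam X X' Xt μ M θ w) (s : Finset ℕ) :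
    MemLp (fun ω => ‖ridgeEstimator lam s (dataset X ω)‖ ^ 2) 2 μ :=
  memLp_norm_sq_ridgeEstimator h.lam_pos h.iid.measurable_obs
    (fun i => h.memLp_snd_of_identDistrib (h.iid.identDistrib_obs i)) s

/-- Dominated convergence, with the leverage bounded by 1, so that no moment beyond the
integrability of Q is spent. -/
lemma tendsto_integral_mul_leverageBound (h : RidgeModel lam X X' Xt μ M θ w) {Q : EuclideanSpace ℝ (Fin d) × ℝ → ℝ}
    (hQ : Integrable (fun ω => Q (X 0 ω)) μ) :
    Tendsto (fun l => ∫ ω, Q (X 0 ω) * leverageBound lam l (X 0 ω) ∂μ) atTop (𝓝 0) := by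
  have := tendsto_integral_of_dominated_convergence (μ := μ)
    (F := fun l ω => Q (X 0 ω) * leverageBound lam l (X 0 ω)) (f := fun _ => 0)
    (fun ω => |Q (X 0 ω)|)
    (fun l => hQ.aestronglyMeasurable.mul
      ((measurable_leverageBound l).comp (h.iid.measurable_obs 0)).aestronglyMeasurable)
    hQ.abs (fun l => ae_of_all _ fun ω => ?_) (ae_of_all _ fun ω => ?_)
  · simpa using this
  · rw [Real.norm_eq_abs, abs_mul, abs_of_nonneg (leverageBound_nonneg h.lam_pos _ _)]
    exact mul_le_of_le_one_right (abs_nonneg _) (min_le_left _ _)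
  · simpa using (tendsto_leverageBound (lam := lam) (X 0 ω)).const_mul (Q (X 0 ω))

variable [IsProbabilityMeasure μ]

lemma measurable_datasetReplaced (h : RidgeModel lam X X' Xt μ M θ w) :
    Measurable (datasetReplaced X X') :=
  measurable_pi_lambda _ fun i => by
    unfold datasetReplaced
    by_cases hi : i = 0
    · subst hi; simpa using h.iid.measurable_copy
    · simpa [Function.update_of_ne hi, dataset] using h.iid.measurable_obs i

lemma memLp_norm_sq_ridge_replaced (h : RidgeModel lam X X' Xt μ M θ w) (s : Finset ℕ) :
    MemLp (fun ω => ‖ridgeEstimator lam s (datasetReplaced X X' ω)‖ ^ 2) 2 μ := by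
  have h1 : ∀ i, IdentDistrib (fun ω => datasetReplaced X X' ω i) (X 0) μ μ := fun i => by
    unfold datasetReplaced
    by_cases hi : i = 0
    · subst hi; simpa using h.iid.identDistrib_copy
    · simpa [Function.update_of_ne hi, dataset] using h.iid.identDistrib_obs i
  exact memLp_norm_sq_ridgeEstimator h.lam_pos (U := fun i ω => datasetReplaced X X' ω i)
    (fun i => (measurable_pi_apply i).comp h.measurable_datasetReplaced)
    (fun i => h.memLp_snd_of_identDistrib (h1 i)) s

lemma memLp_risk_of_norm_sq (h : RidgeModel lam X X' Xt μ M θ w) {T : Ω → EuclideanSpace ℝ (Fin d)}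
    (hT : Measurable T) (hT2 : MemLp (fun ω => ‖T ω‖ ^ 2) 2 μ) :
    MemLp (fun ω => risk sqLoss Xt μ (T ω)) 2 μ := by
  obtain ⟨C, _, h1⟩ := h.exists_risk_le
  have h2 : MemLp (fun ω => C * (1 + ‖T ω‖ ^ 2)) 2 μ :=
    ((memLp_const (1 : ℝ)).add hT2).const_mul C
  exact h2.mono' (h.measurable_risk.comp hT).aestronglyMeasurable (ae_of_all _ fun ω => h1 _)

lemma memLp_sqLoss_test (h : RidgeModel lam X X' Xt μ M θ w) (s : Finset ℕ) :
    MemLp (fun ω => sqLoss (Xt ω) (ridgeEstimator lam s (dataset X ω))) 2 μ :=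
  memLp_sqLoss_of_indepFun h.iid.measurable_test (h.measurable_ridgeEstimator_dataset s)
    (h.memLp_fst_of_identDistrib h.iid.identDistrib_test)
    (h.memLp_snd_of_identDistrib h.iid.identDistrib_test) (h.memLp_norm_sq_ridge s)
    (h.iid.indepFun_test (measurable_ridgeEstimator h.lam_pos s) (dependsOn_ridgeEstimator s))

lemma memLp_sqLoss_test_replaced (h : RidgeModel lam X X' Xt μ M θ w) (s : Finset ℕ) :
    MemLp (fun ω => sqLoss (Xt ω) (ridgeEstimator lam s (datasetReplaced X X' ω))) 2 μ :=
  memLp_sqLoss_of_indepFun h.iid.measurable_test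
    ((measurable_ridgeEstimator h.lam_pos s).comp h.measurable_datasetReplaced)
    (h.memLp_fst_of_identDistrib h.iid.identDistrib_test)
    (h.memLp_snd_of_identDistrib h.iid.identDistrib_test) (h.memLp_norm_sq_ridge_replaced s)
    (h.iid.indepFun_test_replaced (measurable_ridgeEstimator h.lam_pos s)
      (dependsOn_ridgeEstimator s))

/-- The covariance in the definition of `ρ` is a covariance with the risk of the estimator. -/
lemma covariance_condExp_stabilityOne (h : RidgeModel lam X X' Xt μ M θ w) {l : ℕ} (hl : 0 < l)
    {f : EuclideanSpace ℝ (Fin d) × ℝ → ℝ} (hf : Measurable f) (hf2 : MemLp (fun ω => f (X 0 ω)) 2 μ) :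
    cov[fun ω => f (X 0 ω), μ[stabilityOne (ridgeEstimator lam) sqLoss X X' Xt l |
        MeasurableSpace.comap (X 0) inferInstance]; μ]
      = cov[fun ω => f (X 0 ω),
        fun ω => risk sqLoss Xt μ (ridgeEstimator lam (Finset.range l) (dataset X ω)); μ] := by
  have hR := measurable_ridgeEstimator (d := d) h.lam_pos (Finset.range l)
  have hD := dependsOn_ridgeEstimator (d := d) (lam := lam) (Finset.range l)
  have L1 := h.memLp_sqLoss_test (Finset.range l)
  have L2 := h.memLp_sqLoss_test_replaced (Finset.range l)
  have hβ : MemLp (stabilityOne (ridgeEstimator lam) sqLoss X X' Xt l) 2 μ := L1.sub L2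
  have hfm : StronglyMeasurable[MeasurableSpace.comap (X 0) inferInstance] fun ω => f (X 0 ω) :=
    (hf.comp (comap_measurable (X 0))).stronglyMeasurable
  -- The replaced half of the stability does not see `X 0` and contributes nothing.
  have hcov0 : cov[fun ω => f (X 0 ω), fun ω => sqLoss (Xt ω)
      (ridgeEstimator lam (Finset.range l) (datasetReplaced X X' ω)); μ] = 0 := by
    refine IndepFun.covariance_eq_zero ?_ hf2 L2
    exact (h.iid.indepFun_obs_replaced (s := Finset.range l)
      (G := fun x t => sqLoss t (ridgeEstimator lam (Finset.range l) x))
      (measurable_sqLoss.comp (measurable_snd.prodMk (hR.comp measurable_fst)))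
      (fun t x y hxy => by simp only [hD hxy])).comp hf measurable_id
  rw [covariance_condExp_right (h.iid.measurable_obs 0).comap_le hfm hf2 hβ]
  have h1 : stabilityOne (ridgeEstimator lam) sqLoss X X' Xt l = fun ω =>
      sqLoss (Xt ω) (ridgeEstimator lam (Finset.range l) (dataset X ω)) - sqLoss (Xt ω)
      (ridgeEstimator lam (Finset.range l) (datasetReplaced X X' ω)) := rfl
  rw [h1, covariance_fun_sub_right hf2 L1 L2, hcov0, sub_zero]
  have L3 := h.memLp_risk_of_norm_sq (h.measurable_ridgeEstimator_dataset (Finset.range l))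
    (h.memLp_norm_sq_ridge (Finset.range l))
  rw [covariance_eq_sub hf2 L1, covariance_eq_sub hf2 L3]
  -- The test point must be independent of the pair, since the fit itself depends on `X 0`.
  -- Positivity of l puts index 0 into the sample.
  have hind : IndepFun Xt (fun ω => (X 0 ω, ridgeEstimator lam (Finset.range l) (dataset X ω))) μ :=
    h.iid.indepFun_test (s := Finset.range l)
      (G := fun x => (x 0, ridgeEstimator lam (Finset.range l) x))
      ((measurable_pi_apply 0).prodMk hR)
      (fun x y hxy => by simp only [hD hxy, hxy 0 (by simpa using hl)])
  have hU := (h.iid.measurable_obs 0).prodMk (h.measurable_ridgeEstimator_dataset (Finset.range l))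
  have e1 := integral_mul_sqLoss_of_indepFun (μ := μ) (f := fun p : (EuclideanSpace ℝ (Fin d) × ℝ) × EuclideanSpace ℝ (Fin d) => f p.1)
    (t := fun p => p.2) h.iid.measurable_test hU (hf.comp measurable_fst) measurable_snd hind
    (hf2.integrable_mul L1)
  have e2 := integral_mul_sqLoss_of_indepFun (μ := μ) (f := fun _ : (EuclideanSpace ℝ (Fin d) × ℝ) × EuclideanSpace ℝ (Fin d) => (1 : ℝ))
    (t := fun p => p.2) h.iid.measurable_test hU measurable_const measurable_snd hind
    (by simpa using L1.integrable one_le_two)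
  simp only [one_mul] at e2
  simp only [Pi.mul_apply]
  rw [e1, e2]

/-- The leave-one-out deviation is independent of `X 0`, so expectations factorise and only the
integrability of Q is needed; one factor of each product tends to 0. -/
lemma tendsto_integral_mul_looDeviation (h : RidgeModel lam X X' Xt μ M θ w) {Q : EuclideanSpace ℝ (Fin d) × ℝ → ℝ}
    (hQm : Measurable Q) (hQ : Integrable (fun ω => Q (X 0 ω)) μ) :
    (∀ l, 0 < l → Integrable (fun ω => Q (X 0 ω) * looDeviation lam M θ w l (dataset X ω)
      + Q (X 0 ω) * leverageBound lam l (X 0 ω)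
        * (1 + looDeviation lam M θ w l (dataset X ω))) μ) ∧
    Tendsto (fun l => ∫ ω, (Q (X 0 ω) * looDeviation lam M θ w l (dataset X ω)
      + Q (X 0 ω) * leverageBound lam l (X 0 ω)
        * (1 + looDeviation lam M θ w l (dataset X ω))) ∂μ) atTop (𝓝 0) := by
  obtain ⟨hVi, hV⟩ := h.tendsto_integral_looDeviation
  have hind : ∀ l, IndepFun (X 0) (fun ω => looDeviation lam M θ w l (dataset X ω)) μ := fun l =>
    h.iid.indepFun_obs 0 (by simp) (measurable_looDeviation h.lam_pos M θ w l)
      (dependsOn_looDeviation M θ w l)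
  have hQl : ∀ l, Integrable (fun ω => Q (X 0 ω) * leverageBound lam l (X 0 ω)) μ := fun l =>
    hQ.mono ((hQ.aestronglyMeasurable).mul
      ((measurable_leverageBound l).comp (h.iid.measurable_obs 0)).aestronglyMeasurable)
      (ae_of_all _ fun ω => by
        rw [norm_mul, Real.norm_of_nonneg (leverageBound_nonneg h.lam_pos _ _)]
        exact mul_le_of_le_one_right (norm_nonneg _) (min_le_left _ _))
  have hI1 : ∀ l, IndepFun (fun ω => Q (X 0 ω))
      (fun ω => looDeviation lam M θ w l (dataset X ω)) μ := fun l =>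
    (hind l).comp hQm measurable_id
  have hI2 : ∀ l, IndepFun (fun ω => Q (X 0 ω) * leverageBound lam l (X 0 ω))
      (fun ω => 1 + looDeviation lam M θ w l (dataset X ω)) μ := fun l =>
    (hind l).comp (φ := fun x => Q x * leverageBound lam l x) (ψ := fun v : ℝ => 1 + v)
      (hQm.mul (measurable_leverageBound l)) (by fun_prop)
  have i1 : ∀ l, 0 < l → Integrable (fun ω => Q (X 0 ω) * looDeviation lam M θ w l (dataset X ω)) μ :=
    fun l hl => (hI1 l).integrable_mul hQ (hVi l hl)
  have i2 : ∀ l, 0 < l → Integrable (fun ω => Q (X 0 ω) * leverageBound lam l (X 0 ω)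
        * (1 + looDeviation lam M θ w l (dataset X ω))) μ :=
    fun l hl => (hI2 l).integrable_mul (hQl l) ((integrable_const 1).add (hVi l hl))
  refine ⟨fun l hl => (i1 l hl).add (i2 l hl), ?_⟩
  have t1 := hV.const_mul (∫ ω, Q (X 0 ω) ∂μ)
  have t2 := (h.tendsto_integral_mul_leverageBound hQ).mul (hV.const_add 1)
  have t3 := t1.add t2
  simp only [mul_zero, zero_mul, add_zero] at t3
  refine t3.congr' ?_
  filter_upwards [eventually_gt_atTop 0] with l hl
  rw [integral_add (i1 l hl) (i2 l hl),
    (hI1 l).integral_fun_mul_eq_mul_integral hQ.aestronglyMeasurable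
      (hVi l hl).aestronglyMeasurable,
    (hI2 l).integral_fun_mul_eq_mul_integral (hQl l).aestronglyMeasurable
      ((integrable_const 1).add (hVi l hl)).aestronglyMeasurable,
    integral_add (integrable_const 1) (hVi l hl)]
  simp

end RidgeModel

end RhoLimit

/-! ### The limit ρ under four moments. -/

section RhoTheorem

variable {Ω : Type*} [MeasurableSpace Ω] {μ : Measure Ω} {d : ℕ} {lam : ℝ}

lemma obsBound_pos (θ : EuclideanSpace ℝ (Fin d)) (x : EuclideanSpace ℝ (Fin d) × ℝ) : 0 < obsBound θ x := by unfold obsBound; positivity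

lemma sq_fitResidual_le_obsBound (θ : EuclideanSpace ℝ (Fin d)) (x : EuclideanSpace ℝ (Fin d) × ℝ) : fitResidual θ x ^ 2 ≤ obsBound θ x := by
  unfold obsBound; nlinarith [sq_nonneg ‖x.1‖]

@[fun_prop]
lemma measurable_obsBound (θ : EuclideanSpace ℝ (Fin d)) : Measurable (obsBound θ) := by
  unfold obsBound
  exact Continuous.measurable (by fun_prop)

lemma tendsto_zero_of_sq {ι : Type*} {l : Filter ι} {a : ι → ℝ}
    (h : Tendsto (fun n => a n ^ 2) l (𝓝 0)) : Tendsto a l (𝓝 0) := by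
  have h7 := (Real.continuous_sqrt.tendsto 0).comp h
  simp only [Function.comp_def, Real.sqrt_sq_eq_abs, Real.sqrt_zero] at h7
  exact (tendsto_zero_iff_abs_tendsto_zero _).2 h7

namespace RidgeModel

variable {X : ℕ → Ω → EuclideanSpace ℝ (Fin d) × ℝ} {X' Xt : Ω → EuclideanSpace ℝ (Fin d) × ℝ} {M : EuclideanSpace ℝ (Fin d) →L[ℝ] EuclideanSpace ℝ (Fin d)} {θ w : EuclideanSpace ℝ (Fin d)}
  [IsProbabilityMeasure μ]

lemma memLp_inner_score (h : RidgeModel lam X X' Xt μ M θ w) :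
    MemLp (fun ω => inner ℝ w (score θ (X 0 ω))) 2 μ :=
  (memLp_score h.memLp_fst h.memLp_snd θ).const_inner w

/-- The risk of the estimator, with the influence of the first observation split off. -/
lemma mul_covariance_risk (h : RidgeModel lam X X' Xt μ M θ w) {l : ℕ} (hl : 0 < l)
    {f : EuclideanSpace ℝ (Fin d) × ℝ → ℝ} (hf : Measurable f) (hf2 : MemLp (fun ω => f (X 0 ω)) 2 μ) :
    MemLp (fun ω => (l : ℝ) * (ridgeRemainder lam M θ w (Finset.range l) (dataset X ω)
      - ridgeRemainder lam M θ w (Finset.range l) (Function.update (dataset X ω) 0 0))) 2 μ ∧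
    l * cov[fun ω => f (X 0 ω),
        fun ω => risk sqLoss Xt μ (ridgeEstimator lam (Finset.range l) (dataset X ω)); μ]
      = 2 * cov[fun ω => f (X 0 ω), fun ω => inner ℝ w (score θ (X 0 ω)); μ]
        + cov[fun ω => f (X 0 ω), fun ω => (l : ℝ) *
          (ridgeRemainder lam M θ w (Finset.range l) (dataset X ω)
          - ridgeRemainder lam M θ w (Finset.range l) (Function.update (dataset X ω) 0 0)); μ] := by
  have hl' : (l : ℝ) ≠ 0 := by exact_mod_cast hl.ne'
  have hR := measurable_ridgeEstimator (d := d) h.lam_pos (Finset.range l)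
  set R := fun ω => risk sqLoss Xt μ (ridgeEstimator lam (Finset.range l) (dataset X ω)) with hRdef
  set R₀ := fun ω => risk sqLoss Xt μ
    (ridgeEstimator lam (Finset.range l) (Function.update (dataset X ω) 0 0)) with hR₀def
  set s := fun ω => inner ℝ w (score θ (X 0 ω)) with hs
  set D := fun ω => (l : ℝ) * (ridgeRemainder lam M θ w (Finset.range l) (dataset X ω)
      - ridgeRemainder lam M θ w (Finset.range l) (Function.update (dataset X ω) 0 0)) with hD
  have hup : Measurable fun ω => Function.update (dataset X ω) 0 0 :=
    (measurable_update_zero 0).comp h.iid.measurable_dataset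
  have LR : MemLp R 2 μ := h.memLp_risk_of_norm_sq (h.measurable_ridgeEstimator_dataset _)
    (h.memLp_norm_sq_ridge _)
  have LR₀ : MemLp R₀ 2 μ := by
    refine h.memLp_risk_of_norm_sq (hR.comp hup) ?_
    refine memLp_norm_sq_ridgeEstimator h.lam_pos
      (U := fun i ω => Function.update (dataset X ω) 0 0 i)
      (fun i => (measurable_pi_apply i).comp hup) (fun i => ?_) _
    by_cases hi : i = 0
    · subst hi; simp
    · simpa [Function.update_of_ne hi, dataset] using
        h.memLp_snd_of_identDistrib (h.iid.identDistrib_obs i)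
  have Ls : MemLp s 2 μ := h.memLp_inner_score
  -- The risk expansion is applied to both samples; their linear parts differ by exactly one score
  -- over l. This also gives square integrability of D without estimating it.
  have hdec : D = fun ω => l * (R ω - R₀ ω) - 2 * s ω := by
    funext ω
    simp only [hD, hRdef, hR₀def, hs, h.risk_ridgeEstimator]
    rw [ridgeScore_update l (dataset X ω) hl, inner_add_right, real_inner_smul_right]
    simp only [dataset]
    field_simp
    ring
  have LD : MemLp D 2 μ := by
    rw [hdec]; exact ((LR.sub LR₀).const_mul _).sub (Ls.const_mul 2)
  refine ⟨LD, ?_⟩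
  have hind : cov[fun ω => f (X 0 ω), R₀; μ] = 0 := by
    refine IndepFun.covariance_eq_zero ?_ hf2 LR₀
    have h1 := h.iid.indepFun_obs 0 (s := (Finset.range l).erase 0)
      (G := fun x => ridgeEstimator lam (Finset.range l) (Function.update x 0 0)) (by simp)
      (hR.comp (measurable_update_zero 0)) ((dependsOn_ridgeEstimator _).comp_update 0 0)
    exact h1.comp hf h.measurable_risk
  have hRe : (fun ω => l * R ω) = fun ω => (l * R₀ ω + 2 * s ω) + D ω := by
    funext ω; rw [hdec]; ring
  rw [← covariance_const_mul_right, hRe]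
  have e1 := covariance_add_right hf2 ((LR₀.const_mul (l : ℝ)).add (Ls.const_mul 2)) LD
  have e2 := covariance_add_right hf2 (LR₀.const_mul (l : ℝ)) (Ls.const_mul 2)
  refine e1.trans ?_
  rw [e2, covariance_const_mul_right, covariance_const_mul_right, hind]
  ring

/-- The limit `ρ` exists, for ridge regression with covariates and responses with four moments. -/
theorem isRho (h : RidgeModel lam X X' Xt μ M θ w) :
    IsRho (ridgeEstimator lam) sqLoss X X' Xt μ
      (2 * cov[fun ω => fitResidual θ (X 0 ω) ^ 2, fun ω => inner ℝ w (score θ (X 0 ω)); μ]) := by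
  obtain ⟨κ, hκ, hmean⟩ := h.exists_abs_meanLoss_sub_le
  set f := meanLoss (ridgeEstimator lam) sqLoss X μ with hfdef
  have hfm : ∀ l, Measurable (f l) := h.measurable_meanLoss
  have LP : MemLp (fun ω => obsBound θ (X 0 ω)) 2 μ := memLp_obsBound h.memLp_fst h.memLp_snd θ
  have Lr : MemLp (fun ω => fitResidual θ (X 0 ω) ^ 2) 2 μ :=
    memLp_sq_of_four (memLp_fitResidual h.memLp_fst h.memLp_snd θ)
  have Ls := h.memLp_inner_score
  have Ldiff : ∀ l, MemLp (fun ω => f l (X 0 ω) - fitResidual θ (X 0 ω) ^ 2) 2 μ := fun l =>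
    (LP.const_mul (κ l)).mono' ((((hfm l).comp (h.iid.measurable_obs 0)).aestronglyMeasurable).sub
      Lr.aestronglyMeasurable) (ae_of_all _ fun ω => hmean l _)
  have Lf : ∀ l, MemLp (fun ω => f l (X 0 ω)) 2 μ := fun l => by
    have := (Ldiff l).add Lr
    convert this using 1
    funext ω
    simp
  -- the leading term
  have T1 : Tendsto (fun l => 2 * cov[fun ω => f l (X 0 ω),
      fun ω => inner ℝ w (score θ (X 0 ω)); μ]) atTop
      (𝓝 (2 * cov[fun ω => fitResidual θ (X 0 ω) ^ 2,
        fun ω => inner ℝ w (score θ (X 0 ω)); μ])) := by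
    have h1 : Tendsto (fun l => 2 * cov[fun ω => f l (X 0 ω) - fitResidual θ (X 0 ω) ^ 2,
        fun ω => inner ℝ w (score θ (X 0 ω)); μ]) atTop (𝓝 0) := by
      refine tendsto_zero_of_sq ?_
      have h2 : Tendsto (fun l => 4 * (κ l ^ 2 * (∫ ω, obsBound θ (X 0 ω) ^ 2 ∂μ)
          * Var[fun ω => inner ℝ w (score θ (X 0 ω)); μ])) atTop (𝓝 0) := by
        have := (((hκ.pow 2).mul_const (∫ ω, obsBound θ (X 0 ω) ^ 2 ∂μ)).mul_const
          (Var[fun ω => inner ℝ w (score θ (X 0 ω)); μ])).const_mul 4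
        simpa using this
      refine squeeze_zero (fun l => sq_nonneg _) (fun l => ?_) h2
      refine (sq_covariance_le (Ldiff l) Ls).trans ?_
      refine mul_le_mul_of_nonneg_left (mul_le_mul_of_nonneg_right ?_ (variance_nonneg _ _))
        (by norm_num)
      refine (variance_le_expectation_sq (Ldiff l).aestronglyMeasurable).trans ?_
      rw [← integral_const_mul]
      refine integral_mono_of_nonneg (ae_of_all _ fun ω => sq_nonneg _)
        (LP.integrable_sq.const_mul _) (ae_of_all _ fun ω => ?_)
      simp only [Pi.pow_apply]
      rw [← mul_pow, ← sq_abs]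
      exact pow_le_pow_left₀ (abs_nonneg _) (hmean l _) 2
    have h3 := h1.add_const (2 * cov[fun ω => fitResidual θ (X 0 ω) ^ 2,
        fun ω => inner ℝ w (score θ (X 0 ω)); μ])
    rw [zero_add] at h3
    refine h3.congr fun l => ?_
    rw [covariance_fun_sub_left (Lf l) Lr Ls]
    ring
  -- the remainder
  set c₀ := 2 * ∫ ω, obsBound θ (X 0 ω) ∂μ with hc₀
  -- The first factor bounds the centred average loss, the second comes from the leave-one-out
  -- estimate. The product has degree four, exactly what the moment assumption allows.
  set Q : EuclideanSpace ℝ (Fin d) × ℝ → ℝ := fun x => (2 * obsBound θ x + c₀) * obsBound θ x with hQ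
  have hQm : Measurable Q := by
    have := measurable_obsBound (d := d) θ
    exact ((this.const_mul 2).add_const c₀).mul this
  have LQ : MemLp (fun ω => 2 * obsBound θ (X 0 ω) + c₀) 2 μ :=
    (LP.const_mul 2).add (memLp_const c₀)
  have hQi : Integrable (fun ω => Q (X 0 ω)) μ := LQ.integrable_mul LP
  obtain ⟨hi, ht⟩ := h.tendsto_integral_mul_looDeviation hQm hQi
  set C := 2 * lam⁻¹ + 4 * ‖w‖ + 4 * ‖M‖ * lam⁻¹ with hC
  -- The bound does not depend on l₂; this uniformity is what makes the limit a joint one.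
  have hbound : ∀ l₂, κ l₂ ≤ 1 → ∀ l : ℕ, 0 < l →
      |cov[fun ω => f l₂ (X 0 ω), fun ω => (l : ℝ) *
          (ridgeRemainder lam M θ w (Finset.range l) (dataset X ω)
          - ridgeRemainder lam M θ w (Finset.range l) (Function.update (dataset X ω) 0 0)); μ]|
      ≤ C * ∫ ω, (Q (X 0 ω) * looDeviation lam M θ w l (dataset X ω)
      + Q (X 0 ω) * leverageBound lam l (X 0 ω)
        * (1 + looDeviation lam M θ w l (dataset X ω))) ∂μ := by
    intro l₂ hκ1 l hl
    have hfle : ∀ x, |f l₂ x| ≤ 2 * obsBound θ x := fun x => by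
      have h1 := hmean l₂ x
      have h2 := mul_le_mul_of_nonneg_right hκ1 (obsBound_pos θ x).le
      have h3 := sq_fitResidual_le_obsBound θ x
      have h4 := abs_sub_abs_le_abs_sub (f l₂ x) (fitResidual θ x ^ 2)
      rw [abs_of_nonneg (sq_nonneg (fitResidual θ x))] at h4
      linarith
    have hEf : |∫ ω, f l₂ (X 0 ω) ∂μ| ≤ c₀ := by
      refine abs_integral_le_integral_abs.trans ?_
      rw [hc₀, ← integral_const_mul]
      exact integral_mono_of_nonneg (ae_of_all _ fun ω => abs_nonneg _)
        ((LP.integrable one_le_two).const_mul 2) (ae_of_all _ fun ω => hfle _)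
    obtain ⟨LD, -⟩ := h.mul_covariance_risk hl (hfm l₂) (Lf l₂)
    set D := fun ω => (l : ℝ) * (ridgeRemainder lam M θ w (Finset.range l) (dataset X ω)
      - ridgeRemainder lam M θ w (Finset.range l) (Function.update (dataset X ω) 0 0)) with hD
    have hDle : ∀ ω, |D ω| ≤ C * (obsBound θ (X 0 ω) * looDeviation lam M θ w l (dataset X ω)
        + obsBound θ (X 0 ω) * leverageBound lam l (X 0 ω)
          * (1 + looDeviation lam M θ w l (dataset X ω))) := fun ω => by
      rw [hD]
      simp only [abs_mul, Nat.abs_cast]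
      exact ridgeRemainder_leave_one_out h.lam_pos h.op_symm l hl (dataset X ω) _ rfl _ rfl
    -- Only the first variable is centred, so the pointwise bound on D suffices.
    have hcov : cov[fun ω => f l₂ (X 0 ω), D; μ]
        = ∫ ω, (f l₂ (X 0 ω) - ∫ ω', f l₂ (X 0 ω') ∂μ) * D ω ∂μ := by
      rw [covariance_eq_sub (Lf l₂) LD]
      simp only [sub_mul, Pi.mul_apply]
      rw [integral_sub (integrable_mul_of_memLp_two (Lf l₂) LD)
        ((LD.integrable one_le_two).const_mul _),
        integral_const_mul (∫ ω', f l₂ (X 0 ω') ∂μ) D]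
    rw [hcov, ← integral_const_mul]
    refine abs_integral_le_integral_abs.trans (integral_mono_of_nonneg
      (ae_of_all _ fun ω => abs_nonneg _) ((hi l hl).const_mul C) (ae_of_all _ fun ω => ?_))
    dsimp only
    rw [abs_mul]
    calc |f l₂ (X 0 ω) - ∫ ω', f l₂ (X 0 ω') ∂μ| * |D ω|
        ≤ (2 * obsBound θ (X 0 ω) + c₀) * |D ω| := by
          refine mul_le_mul_of_nonneg_right ?_ (abs_nonneg _)
          exact (abs_sub _ _).trans (add_le_add (hfle _) hEf)
      _ ≤ (2 * obsBound θ (X 0 ω) + c₀) * _ := by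
          refine mul_le_mul_of_nonneg_left (hDle ω) ?_
          have := obsBound_pos θ (X 0 ω)
          have := (abs_nonneg _).trans hEf
          linarith
      _ = _ := by simp only [hQ]; ring
  have T2 : Tendsto (fun l : ℕ × ℕ => cov[fun ω => f l.2 (X 0 ω), fun ω => (l.1 : ℝ) *
          (ridgeRemainder lam M θ w (Finset.range l.1) (dataset X ω)
          - ridgeRemainder lam M θ w (Finset.range l.1) (Function.update (dataset X ω) 0 0)); μ])
      (atTop ×ˢ atTop) (𝓝 0) := by
    rw [tendsto_zero_iff_abs_tendsto_zero]
    have h1 := (ht.const_mul C).comp (tendsto_fst (f := (atTop : Filter ℕ)) (g := (atTop : Filter ℕ)))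
    rw [mul_zero] at h1
    refine squeeze_zero' (Eventually.of_forall fun l => abs_nonneg _) ?_ h1
    filter_upwards [tendsto_fst.eventually (eventually_gt_atTop 0),
      tendsto_snd.eventually (hκ.eventually (eventually_le_nhds zero_lt_one))] with l hl hl2
    exact hbound l.2 hl2 l.1 hl
  have T3 := (T1.comp (tendsto_snd (f := (atTop : Filter ℕ)) (g := (atTop : Filter ℕ)))).add T2
  rw [add_zero] at T3
  refine T3.congr' ?_
  filter_upwards [tendsto_fst.eventually (eventually_gt_atTop 0)] with l hl
  rw [h.covariance_condExp_stabilityOne hl (hfm l.2) (Lf l.2),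
    (h.mul_covariance_risk hl (hfm l.2) (Lf l.2)).2]
  rfl

end RidgeModel

end RhoTheorem

/-! ### The limits σ₁² and σ₂². -/

section SigmaTheorems

variable {Ω : Type*} [MeasurableSpace Ω] {μ : Measure Ω} {d : ℕ} {lam : ℝ}

lemma variance_sum_of_iIndepFun {𝒳 : Type*} [MeasurableSpace 𝒳] {X : ℕ → Ω → 𝒳}
    [IsProbabilityMeasure μ] (hind : iIndepFun X μ) (hid : ∀ i, IdentDistrib (X i) (X 0) μ μ)
    {f : ℕ → 𝒳 → ℝ} (hf : ∀ i, Measurable (f i)) (hL : ∀ i, MemLp (fun ω => f i (X 0 ω)) 2 μ)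
    (s : Finset ℕ) :
    Var[fun ω => ∑ i ∈ s, f i (X i ω); μ] = ∑ i ∈ s, Var[fun ω => f i (X 0 ω); μ] := by
  have hd : ∀ i, IdentDistrib (fun ω => f i (X i ω)) (fun ω => f i (X 0 ω)) μ μ := fun i =>
    (hid i).comp (hf i)
  have h1 := IndepFun.variance_sum (μ := μ) (X := fun i ω => f i (X i ω)) (s := s)
    (fun i _ => (hd i).symm.memLp_snd (hL i))
    (fun i _ j _ hij => (hind.indepFun hij).comp (hf i) (hf j))
  rw [← Finset.sum_congr rfl fun i _ => (hd i).variance_eq, ← h1]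
  congr 1
  funext ω
  simp

/-- The mean conditional variance of the loss at an independent test observation. -/
lemma integral_condVar_of_indepFun {𝒳 Θ : Type*} [MeasurableSpace 𝒳] [mΘ : MeasurableSpace Θ]
    [IsProbabilityMeasure μ] {L : 𝒳 → Θ → ℝ} (hL : Measurable (Function.uncurry L))
    {V : Ω → 𝒳} {T : Ω → Θ} (hV : Measurable V) (hT : Measurable T) (hVT : IndepFun V T μ)
    (hL2 : MemLp (fun ω => L (V ω) (T ω)) 2 μ) (hR : Measurable fun θ => risk L V μ θ)
    (hR2 : MemLp (fun ω => risk L V μ (T ω)) 2 μ) :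
    ∫ ω, (Var[fun ω' => L (V ω') (T ω'); μ | mΘ.comap T]) ω ∂μ
      = ∫ ω, ∫ ω', L (V ω') (T ω) ^ 2 ∂μ ∂μ - ∫ ω, risk L V μ (T ω) ^ 2 ∂μ := by
  have hm := hT.comap_le
  -- By independence, conditioning on T means freezing it; checked on the generating events {T ∈ t}
  -- by Fubini.
  have hcond : (fun ω => risk L V μ (T ω)) =ᵐ[μ]
      μ[fun ω' => L (V ω') (T ω') | mΘ.comap T] := by
    refine ae_eq_condExp_of_forall_setIntegral_eq hm (hL2.integrable one_le_two)
      (fun s _ _ => (hR2.integrable one_le_two).integrableOn) ?_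
      (hR.comp (comap_measurable T)).stronglyMeasurable.aestronglyMeasurable
    rintro _ ⟨t, ht, rfl⟩ -
    have hF : Measurable fun p : Θ × 𝒳 => t.indicator (fun _ => (1 : ℝ)) p.1 * L p.2 p.1 :=
      ((measurable_const.indicator ht).comp measurable_fst).mul
        (hL.comp (measurable_snd.prodMk measurable_fst))
    have hint : Integrable (fun ω => t.indicator (fun _ => (1 : ℝ)) (T ω) * L (V ω) (T ω)) μ := by
      refine (hL2.integrable one_le_two).mono
        (hF.comp (hT.prodMk hV)).aestronglyMeasurable (ae_of_all _ fun ω => ?_)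
      by_cases h : T ω ∈ t <;> simp [h]
    have h1 := integral_comp_of_indepFun hV hT hF hVT hint
    rw [← integral_indicator (hT ht), ← integral_indicator (hT ht)]
    calc _ = ∫ ω, ∫ ω', t.indicator (fun _ => (1 : ℝ)) (T ω) * L (V ω') (T ω) ∂μ ∂μ := by
          refine integral_congr_ae (ae_of_all _ fun ω => ?_)
          by_cases h : T ω ∈ t <;> simp [h, risk]
      _ = _ := h1.symm
      _ = _ := by
          refine integral_congr_ae (ae_of_all _ fun ω => ?_)
          by_cases h : T ω ∈ t <;> simp [h]
  rw [integral_congr_ae (condVar_ae_eq_condExp_sq_sub_sq_condExp hm hL2)]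
  have e : (μ[(fun ω' => L (V ω') (T ω')) ^ 2 | mΘ.comap T]
      - μ[fun ω' => L (V ω') (T ω') | mΘ.comap T] ^ 2) =ᵐ[μ]
      fun ω => (μ[(fun ω' => L (V ω') (T ω')) ^ 2 | mΘ.comap T]) ω - risk L V μ (T ω) ^ 2 := by
    filter_upwards [hcond] with ω hω
    simp [hω]
  rw [integral_congr_ae e, integral_sub integrable_condExp hR2.integrable_sq, integral_condExp hm]
  congr 1
  exact integral_comp_of_indepFun (F := fun p : Θ × 𝒳 => L p.2 p.1 ^ 2) hV hT
    ((hL.comp (measurable_snd.prodMk measurable_fst)).pow_const 2) hVT hL2.integrable_sq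

namespace RidgeModel

variable {X : ℕ → Ω → EuclideanSpace ℝ (Fin d) × ℝ} {X' Xt : Ω → EuclideanSpace ℝ (Fin d) × ℝ} {M : EuclideanSpace ℝ (Fin d) →L[ℝ] EuclideanSpace ℝ (Fin d)} {θ w : EuclideanSpace ℝ (Fin d)}
  [IsProbabilityMeasure μ]

/-- Read off from the exact expansion as risk minus linear part, so four moments suffice here; the
quantitative bound below needs eight. -/
lemma memLp_ridgeRemainder (h : RidgeModel lam X X' Xt μ M θ w) (s : Finset ℕ) :
    MemLp (fun ω => ridgeRemainder lam M θ w s (dataset X ω)) 2 μ := by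
  have h1 := ((h.memLp_risk_of_norm_sq (h.measurable_ridgeEstimator_dataset s)
    (h.memLp_norm_sq_ridge s)).sub (memLp_const (∫ ω, fitResidual θ (X 0 ω) ^ 2 ∂μ))).sub
    (((h.memLp_ridgeScore h.memLp_fst h.memLp_snd s).const_inner w).const_mul 2)
  convert h1 using 1
  funext ω
  simp only [Pi.sub_apply, h.risk_ridgeEstimator]
  ring

/-- The remainder is dominated by squares of mean deviations, so its second moment reduces to their
fourth moments. -/
lemma exists_integral_sq_ridgeRemainder_le (h : RidgeModel lam X X' Xt μ M θ w)
    (hZ : MemLp (fun ω => (X 0 ω).1) 8 μ) (hY : MemLp (fun ω => (X 0 ω).2) 8 μ) :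
    ∃ C : ℝ, 0 ≤ C ∧ ∀ s : Finset ℕ, s.Nonempty →
      ∫ ω, ridgeRemainder lam M θ w s (dataset X ω) ^ 2 ∂μ ≤ C * ((s.card : ℝ)⁻¹) ^ 2 := by
  obtain ⟨C₁, hC₁, h1⟩ := h.exists_integral_norm_pow_four_ridgeScore_le hZ hY
  obtain ⟨C₂, hC₂, h2⟩ := h.exists_integral_norm_pow_four_sub_empSecondMoment_le hZ
  set a := lam⁻¹ ^ 2 * (1 + ‖M‖)
  refine ⟨2 * a ^ 2 * C₁ + 2 * C₂, by positivity, fun s hs => ?_⟩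
  have I1 := (integrable_pow_four (h.memLp_ridgeScore hZ hY (q := 4) s).norm).const_mul (2 * a ^ 2)
  have I2 := (integrable_pow_four (h.memLp_sub_empSecondMoment hZ (q := 4) s).norm).const_mul 2
  calc _ ≤ ∫ ω, 2 * a ^ 2 * ‖ridgeScore lam θ s (dataset X ω)‖ ^ 4
          + 2 * ‖M w - empSecondMoment s (dataset X ω) w‖ ^ 4 ∂μ := by
        refine integral_mono_of_nonneg (ae_of_all _ fun ω => sq_nonneg _) (I1.add I2)
          (ae_of_all _ fun ω => ?_)
        dsimp only
        have h3 := abs_ridgeRemainder_le (M := M) (θ := θ) (w := w) h.lam_pos s (dataset X ω)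
        have h4 := pow_le_pow_left₀ (abs_nonneg _) h3 2
        rw [sq_abs] at h4
        refine h4.trans ?_
        nlinarith [sq_nonneg (a * ‖ridgeScore lam θ s (dataset X ω)‖ ^ 2
          - ‖M w - empSecondMoment s (dataset X ω) w‖ ^ 2)]
    _ = 2 * a ^ 2 * ∫ ω, ‖ridgeScore lam θ s (dataset X ω)‖ ^ 4 ∂μ
          + 2 * ∫ ω, ‖M w - empSecondMoment s (dataset X ω) w‖ ^ 4 ∂μ := by
        rw [integral_add I1 I2, integral_const_mul, integral_const_mul]
    _ ≤ 2 * a ^ 2 * (C₁ * ((s.card : ℝ)⁻¹) ^ 2) + 2 * (C₂ * ((s.card : ℝ)⁻¹) ^ 2) := by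
        gcongr
        · exact h1 s hs
        · exact h2 s hs
    _ = _ := by ring

lemma variance_inner_ridgeScore (h : RidgeModel lam X X' Xt μ M θ w) {s : Finset ℕ}
    (hs : s.Nonempty) :
    Var[fun ω => inner ℝ w (ridgeScore lam θ s (dataset X ω)); μ]
      = (s.card : ℝ)⁻¹ * Var[fun ω => inner ℝ w (score θ (X 0 ω)); μ] := by
  have hc : (s.card : ℝ) ≠ 0 := by exact_mod_cast hs.card_ne_zero
  have h1 := variance_sum_of_iIndepFun h.iid.iIndepFun_obs h.iid.identDistrib_obs
    (f := fun _ x => inner ℝ w (score θ x))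
    (fun _ => (continuous_const.inner (continuous_score θ)).measurable)
    (fun _ => h.memLp_inner_score) s
  have e : (fun ω => inner ℝ w (ridgeScore lam θ s (dataset X ω)))
      = fun ω => (s.card : ℝ)⁻¹ * ∑ i ∈ s, inner ℝ w (score θ (X i ω))
        + -(lam * inner ℝ w θ) := by
    funext ω
    rw [ridgeScore, inner_sub_right, real_inner_smul_right, real_inner_smul_right, inner_sum]
    rfl
  have hm : AEStronglyMeasurable
      (fun ω => (s.card : ℝ)⁻¹ * ∑ i ∈ s, inner ℝ w (score θ (X i ω))) μ := by
    refine (Measurable.const_mul (Finset.measurable_fun_sum s fun i _ => ?_) _).aestronglyMeasurable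
    exact (continuous_const.inner (continuous_score θ)).measurable.comp (h.iid.measurable_obs i)
  rw [e, variance_add_const hm, variance_const_mul, h1, Finset.sum_const, nsmul_eq_mul]
  field_simp

/-- The limit `σ₂²` exists, for covariates and responses with eight moments. -/
theorem isSigmaTwoSq (h : RidgeModel lam X X' Xt μ M θ w)
    (hZ : MemLp (fun ω => (X 0 ω).1) 8 μ) (hY : MemLp (fun ω => (X 0 ω).2) 8 μ) :
    IsSigmaTwoSq (ridgeEstimator lam) sqLoss X Xt μ
      (4 * Var[fun ω => inner ℝ w (score θ (X 0 ω)); μ]) := by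
  obtain ⟨C, hC, hrem⟩ := h.exists_integral_sq_ridgeRemainder_le hZ hY
  set R₀ := ∫ ω, fitResidual θ (X 0 ω) ^ 2 ∂μ with hR₀
  set V := Var[fun ω => inner ℝ w (score θ (X 0 ω)); μ] with hV
  have hlin : ∀ l : ℕ, MemLp (fun ω =>
      2 * inner ℝ w (ridgeScore lam θ (Finset.range l) (dataset X ω))) 2 μ := fun l =>
    ((h.memLp_ridgeScore h.memLp_fst h.memLp_snd _).const_inner w).const_mul 2
  have h1 : Tendsto (fun l : ℕ => (l : ℝ) * Var[fun ω => R₀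
      + 2 * inner ℝ w (ridgeScore lam θ (Finset.range l) (dataset X ω)); μ]) atTop
      (𝓝 (4 * V)) := by
    -- The scaled variance of the linear part is already equal to its limit once l > 0.
    refine tendsto_const_nhds.congr' ?_
    filter_upwards [eventually_gt_atTop 0] with l hl
    have hl' : (l : ℝ) ≠ 0 := by exact_mod_cast hl.ne'
    rw [variance_const_add (hlin l).aestronglyMeasurable, variance_const_mul,
      h.variance_inner_ridgeScore (Finset.nonempty_range_iff.2 hl.ne'), Finset.card_range, ← hV]
    field_simp
    ring
  have h2 : Tendsto (fun l : ℕ => (l : ℝ) * ∫ ω,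
      ridgeRemainder lam M θ w (Finset.range l) (dataset X ω) ^ 2 ∂μ) atTop (𝓝 0) := by
    have h1 : Tendsto (fun l : ℕ => C * (l : ℝ)⁻¹) atTop (𝓝 0) := by
      simpa using (tendsto_inv_atTop_nhds_zero_nat (𝕜 := ℝ)).const_mul C
    refine squeeze_zero' (Eventually.of_forall fun l =>
      mul_nonneg (Nat.cast_nonneg l) (integral_nonneg fun ω => sq_nonneg _)) ?_ h1
    filter_upwards [eventually_gt_atTop 0] with l hl
    have hl' : (l : ℝ) ≠ 0 := by exact_mod_cast hl.ne'
    have h2 := hrem (Finset.range l) (Finset.nonempty_range_iff.2 hl.ne')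
    rw [Finset.card_range] at h2
    refine (mul_le_mul_of_nonneg_left h2 (Nat.cast_nonneg l)).trans (le_of_eq ?_)
    field_simp
  refine (tendsto_mul_variance_add (fun l => Nat.cast_nonneg l)
    (Eventually.of_forall fun l => (memLp_const R₀).add (hlin l))
    (Eventually.of_forall fun l => h.memLp_ridgeRemainder _) h1 h2).congr fun l => ?_
  simp only [h.risk_ridgeEstimator, Pi.add_apply, add_assoc, ← hR₀]

/-- The limit `σ₁²`, if the kurtosis of all residuals is that of a normal distribution. -/
theorem isSigmaOneSq (h : RidgeModel lam X X' Xt μ M θ w)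
    (hZ : MemLp (fun ω => (X 0 ω).1) 8 μ) (hY : MemLp (fun ω => (X 0 ω).2) 8 μ)
    (hG : ∀ v, ∫ ω, fitResidual v (X 0 ω) ^ 4 ∂μ = 3 * (∫ ω, fitResidual v (X 0 ω) ^ 2 ∂μ) ^ 2) :
    IsSigmaOneSq (ridgeEstimator lam) sqLoss X Xt μ
      (2 * (∫ ω, fitResidual θ (X 0 ω) ^ 2 ∂μ) ^ 2) := by
  set R₀ := ∫ ω, fitResidual θ (X 0 ω) ^ 2 ∂μ with hR₀
  have hm := fun l : ℕ => h.measurable_ridgeEstimator_dataset (Finset.range l)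
  have LR : ∀ l : ℕ, MemLp (fun ω => risk sqLoss Xt μ
      (ridgeEstimator lam (Finset.range l) (dataset X ω))) 2 μ := fun l =>
    h.memLp_risk_of_norm_sq (hm l) (h.memLp_norm_sq_ridge _)
  have hrisk : ∀ v, risk sqLoss Xt μ v = ∫ ω, fitResidual v (X 0 ω) ^ 2 ∂μ := fun v =>
    (h.iid.identDistrib_test.comp
      ((continuous_fitResidual v).measurable.pow_const 2)).integral_eq
  have hcv : ∀ l : ℕ, ∫ ω, (Var[fun ω' => sqLoss (Xt ω')
        (ridgeEstimator lam (Finset.range l) (dataset X ω')); μ |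
        MeasurableSpace.comap (fun ω' => ridgeEstimator lam (Finset.range l) (dataset X ω'))
          inferInstance]) ω ∂μ
      = 2 * ∫ ω, risk sqLoss Xt μ (ridgeEstimator lam (Finset.range l) (dataset X ω)) ^ 2 ∂μ := by
    intro l
    rw [integral_condVar_of_indepFun measurable_sqLoss h.iid.measurable_test (hm l)
      (h.iid.indepFun_test (measurable_ridgeEstimator h.lam_pos _) (dependsOn_ridgeEstimator _))
      (h.memLp_sqLoss_test _) h.measurable_risk (LR l)]
    -- The kurtosis assumption turns the mean conditional variance into 3 E R² − E R² = 2 E R²,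
    -- leaving only convergence of the risk in L².
    have h4 : ∀ v, ∫ ω, sqLoss (Xt ω) v ^ 2 ∂μ = 3 * risk sqLoss Xt μ v ^ 2 := fun v => by
      rw [hrisk, ← hG]
      have := (h.iid.identDistrib_test.comp
        ((continuous_fitResidual v).measurable.pow_const 4)).integral_eq
      refine Eq.trans ?_ this
      refine integral_congr_ae (ae_of_all _ fun ω => ?_)
      simp only [Function.comp_apply, sqLoss_eq]
      ring
    simp only [h4]
    rw [integral_const_mul]
    ring
  have hD : ∀ l : ℕ, MemLp (fun ω => risk sqLoss Xt μ
      (ridgeEstimator lam (Finset.range l) (dataset X ω)) - R₀) 2 μ := fun l =>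
    (LR l).sub (memLp_const _)
  have hsq : Tendsto (fun l : ℕ => ∫ ω, (risk sqLoss Xt μ
      (ridgeEstimator lam (Finset.range l) (dataset X ω)) - R₀) ^ 2 ∂μ) atTop (𝓝 0) := by
    obtain ⟨C, hC, hrem⟩ := h.exists_integral_sq_ridgeRemainder_le hZ hY
    set B := ∫ ω, ‖centredScore lam θ (X 0 ω)‖ ^ 2 ∂μ
    have h1 : Tendsto (fun l : ℕ => 8 * ‖w‖ ^ 2 * ((l : ℝ)⁻¹ * B) + 2 * (C * (l : ℝ)⁻¹ ^ 2))
        atTop (𝓝 0) := by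
      have hi := tendsto_inv_atTop_nhds_zero_nat (𝕜 := ℝ)
      simpa using ((hi.mul_const B).const_mul (8 * ‖w‖ ^ 2)).add
        (((hi.pow 2).const_mul C).const_mul 2)
    refine squeeze_zero' (Eventually.of_forall fun l => integral_nonneg fun ω => sq_nonneg _) ?_ h1
    filter_upwards [eventually_gt_atTop 0] with l hl
    have hne := Finset.nonempty_range_iff.2 hl.ne'
    have Ls := h.memLp_ridgeScore h.memLp_fst h.memLp_snd (q := 2) (Finset.range l)
    have I1 := ((memLp_two_iff_integrable_sq_norm Ls.aestronglyMeasurable).1 Ls).const_mul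
      (8 * ‖w‖ ^ 2)
    have I2 := (h.memLp_ridgeRemainder (Finset.range l)).integrable_sq.const_mul 2
    have h2 := hrem _ hne
    have h3 := h.integral_norm_sq_ridgeScore hne
    rw [Finset.card_range] at h2 h3
    calc _ ≤ ∫ ω, 8 * ‖w‖ ^ 2 * ‖ridgeScore lam θ (Finset.range l) (dataset X ω)‖ ^ 2
            + 2 * ridgeRemainder lam M θ w (Finset.range l) (dataset X ω) ^ 2 ∂μ := by
          refine integral_mono_of_nonneg (ae_of_all _ fun ω => sq_nonneg _) (I1.add I2)
            (ae_of_all _ fun ω => ?_)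
          simp only [h.risk_ridgeEstimator, add_sub_cancel_left, ← hR₀]
          have h5 : inner ℝ w (ridgeScore lam θ (Finset.range l) (dataset X ω)) ^ 2
              ≤ ‖w‖ ^ 2 * ‖ridgeScore lam θ (Finset.range l) (dataset X ω)‖ ^ 2 := by
            rw [← mul_pow, ← sq_abs]
            exact pow_le_pow_left₀ (abs_nonneg _) (abs_real_inner_le_norm _ _) 2
          nlinarith [sq_nonneg (2 * inner ℝ w (ridgeScore lam θ (Finset.range l) (dataset X ω))
            - ridgeRemainder lam M θ w (Finset.range l) (dataset X ω))]
      _ = 8 * ‖w‖ ^ 2 * ((l : ℝ)⁻¹ * B)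
            + 2 * ∫ ω, ridgeRemainder lam M θ w (Finset.range l) (dataset X ω) ^ 2 ∂μ := by
          rw [integral_add I1 I2, integral_const_mul, integral_const_mul, h3]
      _ ≤ _ := by gcongr
  have hlim := tendsto_integral_of_tendsto_integral_sq (Eventually.of_forall hD) hsq
  have h5 : Tendsto (fun l : ℕ => 2 * (∫ ω, (risk sqLoss Xt μ
      (ridgeEstimator lam (Finset.range l) (dataset X ω)) - R₀) ^ 2 ∂μ
      + 2 * R₀ * ∫ ω, (risk sqLoss Xt μ
      (ridgeEstimator lam (Finset.range l) (dataset X ω)) - R₀) ∂μ + R₀ ^ 2)) atTop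
      (𝓝 (2 * R₀ ^ 2)) := by
    simpa using ((hsq.add (hlim.const_mul (2 * R₀))).add_const (R₀ ^ 2)).const_mul 2
  refine h5.congr fun l => ?_
  rw [hcv l, ← integral_const_mul, ← integral_add (hD l).integrable_sq
    (((hD l).integrable one_le_two).const_mul _)]
  congr 1
  have : R₀ ^ 2 = ∫ _ω, R₀ ^ 2 ∂μ := by simp
  have I : Integrable (fun ω => (risk sqLoss Xt μ
      (ridgeEstimator lam (Finset.range l) (dataset X ω)) - R₀) ^ 2 + 2 * R₀ * (risk sqLoss Xt μ
      (ridgeEstimator lam (Finset.range l) (dataset X ω)) - R₀)) μ :=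
    (hD l).integrable_sq.add (((hD l).integrable one_le_two).const_mul _)
  rw [this, ← integral_add I (integrable_const _)]
  refine integral_congr_ae (ae_of_all _ fun ω => ?_)
  dsimp only
  ring

end RidgeModel

end SigmaTheorems

/-! ### Linearising the loss on one test fold. -/

section Folds

variable {Ω : Type*} [MeasurableSpace Ω] {μ : Measure Ω} {d : ℕ} {lam : ℝ}

/-- The remainder in the linearisation of the loss on the test fold `I` of the ridge estimator
trained on `T`. -/
noncomputable def foldRemainder (lam : ℝ) (θ w : EuclideanSpace ℝ (Fin d)) (I T : Finset ℕ) (x : ℕ → EuclideanSpace ℝ (Fin d) × ℝ) : ℝ :=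
  ∑ i ∈ I, sqLoss (x i) (ridgeEstimator lam T x) - (∑ i ∈ I, fitResidual θ (x i) ^ 2
    + 2 * I.card * inner ℝ w (ridgeScore lam θ T x))

/-- Expand each squared residual around θ and replace the test scores by their mean λθ plus a
centred part. The mean part is turned into the training score by the same duality as for the risk.
-/
lemma foldRemainder_eq (hlam : 0 < lam) {M : EuclideanSpace ℝ (Fin d) →L[ℝ] EuclideanSpace ℝ (Fin d)} {θ w : EuclideanSpace ℝ (Fin d)}
    (hw : M w + lam • w = -(lam • θ)) (I T : Finset ℕ) (x : ℕ → EuclideanSpace ℝ (Fin d) × ℝ) :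
    foldRemainder lam θ w I T x
      = 2 * I.card * inner ℝ (ridgeEstimator lam T x - θ) (M w - empSecondMoment T x w)
        - 2 * inner ℝ (∑ i ∈ I, centredScore lam θ (x i)) (ridgeEstimator lam T x - θ)
        + ∑ i ∈ I, inner ℝ (x i).1 (ridgeEstimator lam T x - θ) ^ 2 := by
  have h1 := neg_inner_ridgeEstimator_sub hlam hw T x
  set δ := ridgeEstimator lam T x - θ with hδ
  have h2 : ∑ i ∈ I, sqLoss (x i) (ridgeEstimator lam T x) = ∑ i ∈ I, fitResidual θ (x i) ^ 2
      - 2 * inner ℝ (∑ i ∈ I, centredScore lam θ (x i)) δ - 2 * I.card * (lam * inner ℝ θ δ)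
      + ∑ i ∈ I, inner ℝ (x i).1 δ ^ 2 := by
    rw [sum_inner, Finset.mul_sum, mul_comm 2 (I.card : ℝ), mul_assoc, ← nsmul_eq_mul,
      ← Finset.sum_const, ← Finset.sum_sub_distrib, ← Finset.sum_sub_distrib,
      ← Finset.sum_add_distrib]
    refine Finset.sum_congr rfl fun i _ => ?_
    rw [sqLoss_eq, fitResidual_eq_sub _ θ, ← hδ, centredScore, score, inner_sub_left,
      real_inner_smul_left, real_inner_smul_left]
    ring
  rw [foldRemainder, h2]
  linear_combination 2 * (I.card : ℝ) * h1

/-- The weights in the cross term between test scores G and training error δ are |I|⁻² on ‖G‖⁴ and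
|I|² on ‖δ‖⁴, balancing ‖G‖² of order |I| against ‖δ‖² of order 1/|T|. -/
lemma sq_foldRemainder_le (hlam : 0 < lam) {M : EuclideanSpace ℝ (Fin d) →L[ℝ] EuclideanSpace ℝ (Fin d)} {θ w : EuclideanSpace ℝ (Fin d)}
    (hw : M w + lam • w = -(lam • θ)) {I : Finset ℕ} (hI : I.Nonempty) (T : Finset ℕ)
    (x : ℕ → EuclideanSpace ℝ (Fin d) × ℝ) :
    foldRemainder lam θ w I T x ^ 2
      ≤ 12 * lam⁻¹ ^ 4 * I.card ^ 2 * ‖ridgeScore lam θ T x‖ ^ 4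
        + 6 * I.card ^ 2 * ‖M w - empSecondMoment T x w‖ ^ 4
        + 6 * (I.card : ℝ)⁻¹ ^ 2 * ‖∑ i ∈ I, centredScore lam θ (x i)‖ ^ 4
        + 3 * lam⁻¹ ^ 4 * I.card * ∑ i ∈ I, ‖(x i).1‖ ^ 4 * ‖ridgeScore lam θ T x‖ ^ 4 := by
  rw [foldRemainder_eq hlam hw]
  have hδ : ‖ridgeEstimator lam T x - θ‖ ≤ lam⁻¹ * ‖ridgeScore lam θ T x‖ := by
    rw [inv_mul_eq_div, le_div_iff₀ hlam, mul_comm]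
    exact norm_ridgeEstimator_sub_le hlam T x θ
  have hm : (0 : ℝ) < I.card := by exact_mod_cast hI.card_pos
  set m : ℝ := (I.card : ℝ)
  set δ := ridgeEstimator lam T x - θ
  set D := M w - empSecondMoment T x w
  set G := ∑ i ∈ I, centredScore lam θ (x i)
  set S := ‖ridgeScore lam θ T x‖
  have hδ4 : ‖δ‖ ^ 4 ≤ lam⁻¹ ^ 4 * S ^ 4 := by
    rw [← mul_pow]; exact pow_le_pow_left₀ (norm_nonneg _) hδ 4
  have h1 : inner ℝ δ D ^ 2 ≤ ‖δ‖ ^ 2 * ‖D‖ ^ 2 := by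
    rw [← mul_pow, ← sq_abs]
    exact pow_le_pow_left₀ (abs_nonneg _) (abs_real_inner_le_norm _ _) 2
  have h2 : inner ℝ G δ ^ 2 ≤ ‖G‖ ^ 2 * ‖δ‖ ^ 2 := by
    rw [← mul_pow, ← sq_abs]
    exact pow_le_pow_left₀ (abs_nonneg _) (abs_real_inner_le_norm _ _) 2
  have h3 : (∑ i ∈ I, inner ℝ (x i).1 δ ^ 2) ^ 2 ≤ m * ∑ i ∈ I, ‖(x i).1‖ ^ 4 * ‖δ‖ ^ 4 := by
    refine (sq_sum_le_card_mul_sum_sq (s := I)).trans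
      (mul_le_mul_of_nonneg_left (Finset.sum_le_sum fun i _ => ?_) hm.le)
    rw [← mul_pow, ← pow_mul, ← Even.pow_abs (by decide : Even 4)]
    exact pow_le_pow_left₀ (abs_nonneg _) (abs_real_inner_le_norm _ _) 4
  have h4 : m ^ 2 * (‖δ‖ ^ 2 * ‖D‖ ^ 2) * 2 ≤ m ^ 2 * (‖δ‖ ^ 4 + ‖D‖ ^ 4) := by
    nlinarith [mul_nonneg (sq_nonneg m) (sq_nonneg (‖δ‖ ^ 2 - ‖D‖ ^ 2))]
  have h5 : ‖G‖ ^ 2 * ‖δ‖ ^ 2 * 2 ≤ m⁻¹ ^ 2 * ‖G‖ ^ 4 + m ^ 2 * ‖δ‖ ^ 4 := by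
    have e : m⁻¹ * m = 1 := inv_mul_cancel₀ hm.ne'
    have := sq_nonneg (m⁻¹ * ‖G‖ ^ 2 - m * ‖δ‖ ^ 2)
    have e2 : m⁻¹ * ‖G‖ ^ 2 * (m * ‖δ‖ ^ 2) = ‖G‖ ^ 2 * ‖δ‖ ^ 2 := by
      linear_combination ‖G‖ ^ 2 * ‖δ‖ ^ 2 * e
    nlinarith
  have h6 : ∑ i ∈ I, ‖(x i).1‖ ^ 4 * ‖δ‖ ^ 4
      ≤ lam⁻¹ ^ 4 * ∑ i ∈ I, ‖(x i).1‖ ^ 4 * S ^ 4 := by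
    rw [Finset.mul_sum]
    refine Finset.sum_le_sum fun i _ => ?_
    calc _ ≤ ‖(x i).1‖ ^ 4 * (lam⁻¹ ^ 4 * S ^ 4) := by gcongr
      _ = _ := by ring
  have h7 := mul_le_mul_of_nonneg_left h6 hm.le
  have h8 := mul_le_mul_of_nonneg_left hδ4 (sq_nonneg m)
  have h9 := mul_le_mul_of_nonneg_left h1 (sq_nonneg m)
  set p := inner ℝ δ D
  set q := inner ℝ G δ
  set z := ∑ i ∈ I, inner ℝ (x i).1 δ ^ 2
  have h10 : (2 * m * p - 2 * q + z) ^ 2 ≤ 3 * (4 * (m ^ 2 * p ^ 2) + 4 * q ^ 2 + z ^ 2) := by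
    nlinarith [sq_nonneg (2 * m * p + 2 * q), sq_nonneg (2 * m * p - z), sq_nonneg (2 * q + z)]
  refine h10.trans ?_
  linarith

namespace RidgeModel

variable {X : ℕ → Ω → EuclideanSpace ℝ (Fin d) × ℝ} {X' Xt : Ω → EuclideanSpace ℝ (Fin d) × ℝ} {M : EuclideanSpace ℝ (Fin d) →L[ℝ] EuclideanSpace ℝ (Fin d)} {θ w : EuclideanSpace ℝ (Fin d)}
  [IsProbabilityMeasure μ]

/-- The unnormalised remainder stays bounded in L²: the squared training error is of order 1/|T| and
|I| ≤ 2|T|, while disjointness makes each test covariate independent of the training score, so their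
fourth moments factorise. -/
lemma exists_integral_sq_foldRemainder_le (h : RidgeModel lam X X' Xt μ M θ w)
    (hZ : MemLp (fun ω => (X 0 ω).1) 8 μ) (hY : MemLp (fun ω => (X 0 ω).2) 8 μ) :
    ∃ C : ℝ, 0 ≤ C ∧ ∀ I T : Finset ℕ, Disjoint I T → T.Nonempty → I.card ≤ 2 * T.card →
      ∫ ω, foldRemainder lam θ w I T (dataset X ω) ^ 2 ∂μ ≤ C := by
  obtain ⟨C₁, hC₁, h1⟩ := h.exists_integral_norm_pow_four_ridgeScore_le hZ hY
  obtain ⟨C₂, hC₂, h2⟩ := h.exists_integral_norm_pow_four_sub_empSecondMoment_le hZ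
  have hcs : ∀ i, IdentDistrib (fun ω => centredScore lam θ (X i ω))
      (fun ω => centredScore lam θ (X 0 ω)) μ μ := fun i =>
    (h.iid.identDistrib_obs i).comp (measurable_centredScore θ)
  have Lg0 : MemLp (fun ω => centredScore lam θ (X 0 ω)) 4 μ := memLp_centredScore hZ hY
  obtain ⟨C₃, hC₃, h3⟩ := exists_integral_norm_sum_pow_four_le (μ := μ)
    (ξ := fun i ω => centredScore lam θ (X i ω))
    (h.iid.iIndepFun_obs.comp (fun _ => centredScore lam θ) fun _ => measurable_centredScore θ)
    (fun i => (measurable_centredScore θ).comp (h.iid.measurable_obs i)) hcs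
    (fun k => by simpa only [coord_eq_inner] using h.integral_inner_centredScore _) Lg0
  set Q := ∫ ω, ‖(X 0 ω).1‖ ^ 4 ∂μ with hQ
  have hQ0 : 0 ≤ Q := integral_nonneg fun ω => by positivity
  have ha : 0 ≤ lam⁻¹ := inv_nonneg.2 h.lam_pos.le
  refine ⟨48 * lam⁻¹ ^ 4 * C₁ + 24 * C₂ + 6 * C₃ + 12 * lam⁻¹ ^ 4 * Q * C₁, by positivity,
    fun I T hIT hT hcard => ?_⟩
  -- An empty test fold has remainder zero; the general estimate divides by |I|.
  rcases I.eq_empty_or_nonempty with rfl | hI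
  · simp only [foldRemainder, Finset.sum_empty, Finset.card_empty, Nat.cast_zero, mul_zero,
      zero_mul, add_zero, sub_zero, ne_eq, OfNat.ofNat_ne_zero, not_false_eq_true, zero_pow,
      integral_zero]
    positivity
  have LS := h.memLp_ridgeScore hZ hY (q := 4) T
  have I1 := integrable_pow_four LS.norm
  have I2 := integrable_pow_four (h.memLp_sub_empSecondMoment hZ (q := 4) T).norm
  have LG : MemLp (fun ω => ∑ i ∈ I, centredScore lam θ (X i ω)) 4 μ :=
    memLp_finsetSum I fun i _ => (hcs i).symm.memLp_snd Lg0
  have I3 := integrable_pow_four LG.norm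
  have hid : ∀ i, IdentDistrib (fun ω => ‖(X i ω).1‖ ^ 4) (fun ω => ‖(X 0 ω).1‖ ^ 4) μ μ :=
    fun i => (h.iid.identDistrib_obs i).comp (u := fun x : EuclideanSpace ℝ (Fin d) × ℝ => ‖x.1‖ ^ 4) (by fun_prop)
  have hind : ∀ i ∈ I, IndepFun (fun ω => ‖(X i ω).1‖ ^ 4)
      (fun ω => ‖ridgeScore lam θ T (dataset X ω)‖ ^ 4) μ := fun i hi =>
    (h.iid.indepFun_obs i (Finset.disjoint_left.1 hIT hi)
      (continuous_ridgeScore θ T).measurable (dependsOn_ridgeScore θ T)).comp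
      (φ := fun x : EuclideanSpace ℝ (Fin d) × ℝ => ‖x.1‖ ^ 4) (ψ := fun v : EuclideanSpace ℝ (Fin d) => ‖v‖ ^ 4) (by fun_prop) (by fun_prop)
  have Iz : ∀ i, Integrable (fun ω => ‖(X i ω).1‖ ^ 4) μ := fun i =>
    (hid i).symm.integrable_snd (integrable_pow_four h.memLp_fst.norm)
  have I4 : ∀ i ∈ I, Integrable (fun ω => ‖(X i ω).1‖ ^ 4
      * ‖ridgeScore lam θ T (dataset X ω)‖ ^ 4) μ := fun i hi =>
    (hind i hi).integrable_mul (Iz i) I1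
  have hm : (0 : ℝ) < I.card := by exact_mod_cast hI.card_pos
  have ht : (0 : ℝ) < T.card := by exact_mod_cast hT.card_pos
  have hmt : (I.card : ℝ) * (T.card : ℝ)⁻¹ ≤ 2 := by
    rw [← div_eq_mul_inv, div_le_iff₀ ht]; exact_mod_cast hcard
  have hmt2 : (I.card : ℝ) ^ 2 * (T.card : ℝ)⁻¹ ^ 2 ≤ 4 := by
    rw [← mul_pow]
    calc _ ≤ (2 : ℝ) ^ 2 := pow_le_pow_left₀ (by positivity) hmt 2
      _ = 4 := by norm_num
  have hE1 := h1 T hT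
  have hE2 := h2 T hT
  have hE3 := h3 I
  set m : ℝ := (I.card : ℝ) with hmdef
  set t : ℝ := (T.card : ℝ)
  set E1 := ∫ ω, ‖ridgeScore lam θ T (dataset X ω)‖ ^ 4 ∂μ with hE1def
  set E2 := ∫ ω, ‖M w - empSecondMoment T (dataset X ω) w‖ ^ 4 ∂μ with hE2def
  set E3 := ∫ ω, ‖∑ i ∈ I, centredScore lam θ (X i ω)‖ ^ 4 ∂μ with hE3def
  have hE4 : ∀ i ∈ I, ∫ ω, ‖(X i ω).1‖ ^ 4 * ‖ridgeScore lam θ T (dataset X ω)‖ ^ 4 ∂μ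
      = Q * E1 := fun i hi => by
    rw [(hind i hi).integral_fun_mul_eq_mul_integral (Iz i).aestronglyMeasurable
      I1.aestronglyMeasurable, (hid i).integral_eq]
  have J1 := I1.const_mul (12 * lam⁻¹ ^ 4 * m ^ 2)
  have J2 := I2.const_mul (6 * m ^ 2)
  have J3 := I3.const_mul (6 * m⁻¹ ^ 2)
  have J4 := (integrable_finsetSum I I4).const_mul (3 * lam⁻¹ ^ 4 * m)
  have J12 := J1.fun_add J2
  have J123 := J12.fun_add J3
  have b1 : m ^ 2 * E1 ≤ 4 * C₁ := by
    calc _ ≤ m ^ 2 * (C₁ * t⁻¹ ^ 2) := by gcongr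
      _ = C₁ * (m ^ 2 * t⁻¹ ^ 2) := by ring
      _ ≤ C₁ * 4 := by gcongr
      _ = _ := by ring
  have b2 : m ^ 2 * E2 ≤ 4 * C₂ := by
    calc _ ≤ m ^ 2 * (C₂ * t⁻¹ ^ 2) := by gcongr
      _ = C₂ * (m ^ 2 * t⁻¹ ^ 2) := by ring
      _ ≤ C₂ * 4 := by gcongr
      _ = _ := by ring
  have b3 : m⁻¹ ^ 2 * E3 ≤ C₃ := by
    calc _ ≤ m⁻¹ ^ 2 * (C₃ * m ^ 2) := by gcongr
      _ = C₃ := by field_simp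
  calc _ ≤ ∫ ω, 12 * lam⁻¹ ^ 4 * m ^ 2 * ‖ridgeScore lam θ T (dataset X ω)‖ ^ 4
        + 6 * m ^ 2 * ‖M w - empSecondMoment T (dataset X ω) w‖ ^ 4
        + 6 * m⁻¹ ^ 2 * ‖∑ i ∈ I, centredScore lam θ (X i ω)‖ ^ 4
        + 3 * lam⁻¹ ^ 4 * m * ∑ i ∈ I, ‖(X i ω).1‖ ^ 4
          * ‖ridgeScore lam θ T (dataset X ω)‖ ^ 4 ∂μ :=
        integral_mono_of_nonneg (ae_of_all _ fun ω => sq_nonneg _) (J123.fun_add J4)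
          (ae_of_all _ fun ω => sq_foldRemainder_le h.lam_pos h.direction hI T (dataset X ω))
    _ = 12 * lam⁻¹ ^ 4 * m ^ 2 * E1 + 6 * m ^ 2 * E2 + 6 * m⁻¹ ^ 2 * E3
        + 3 * lam⁻¹ ^ 4 * m * (m * (Q * E1)) := by
        rw [integral_add J123 J4, integral_add J12 J3, integral_add J1 J2, integral_const_mul,
          integral_const_mul, integral_const_mul, integral_const_mul, integral_finsetSum I I4,
          Finset.sum_congr rfl hE4, Finset.sum_const, nsmul_eq_mul]
    _ = 12 * lam⁻¹ ^ 4 * (m ^ 2 * E1) + 6 * (m ^ 2 * E2) + 6 * (m⁻¹ ^ 2 * E3)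
        + 3 * lam⁻¹ ^ 4 * Q * (m ^ 2 * E1) := by ring
    _ ≤ 12 * lam⁻¹ ^ 4 * (4 * C₁) + 6 * (4 * C₂) + 6 * C₃
        + 3 * lam⁻¹ ^ 4 * Q * (4 * C₁) := by gcongr
    _ = _ := by ring

lemma memLp_foldRemainder (h : RidgeModel lam X X' Xt μ M θ w) {I T : Finset ℕ}
    (hIT : Disjoint I T) :
    MemLp (fun ω => foldRemainder lam θ w I T (dataset X ω)) 2 μ := by
  have h1 : MemLp (fun ω => ∑ i ∈ I, sqLoss (X i ω) (ridgeEstimator lam T (dataset X ω))) 2 μ :=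
    memLp_finsetSum I fun i hi => memLp_sqLoss_of_indepFun (h.iid.measurable_obs i)
      (h.measurable_ridgeEstimator_dataset T)
      (h.memLp_fst_of_identDistrib (h.iid.identDistrib_obs i))
      (h.memLp_snd_of_identDistrib (h.iid.identDistrib_obs i)) (h.memLp_norm_sq_ridge T)
      (h.iid.indepFun_obs i (Finset.disjoint_left.1 hIT hi)
        (measurable_ridgeEstimator h.lam_pos T) (dependsOn_ridgeEstimator T))
  have h2 : MemLp (fun ω => ∑ i ∈ I, fitResidual θ (X i ω) ^ 2) 2 μ :=
    memLp_finsetSum I fun i _ => memLp_sq_of_four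
      (memLp_fitResidual (h.memLp_fst_of_identDistrib (h.iid.identDistrib_obs i))
        (h.memLp_snd_of_identDistrib (h.iid.identDistrib_obs i)) θ)
  exact h1.sub (h2.add
    (((h.memLp_ridgeScore h.memLp_fst h.memLp_snd T).const_inner w).const_mul _))

end RidgeModel

end Folds

/-! ### Sizes of balanced folds. -/

section BalancedFolds

variable {K : ℕ}

/-- The test fold `j`. -/
def testFold (b : ℕ → Fin K) (n : ℕ) (j : Fin K) : Finset ℕ := {i ∈ Finset.range n | b i = j}

/-- The training set belonging to the test fold `j`. -/
def trainFold (b : ℕ → Fin K) (n : ℕ) (j : Fin K) : Finset ℕ := {i ∈ Finset.range n | b i ≠ j}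

lemma disjoint_testFold_trainFold (b : ℕ → Fin K) (n : ℕ) (j : Fin K) :
    Disjoint (testFold b n j) (trainFold b n j) := Finset.disjoint_filter_filter_not _ _ _

lemma card_testFold_add_card_trainFold (b : ℕ → Fin K) (n : ℕ) (j : Fin K) :
    (testFold b n j).card + (trainFold b n j).card = n := by
  have := Finset.card_filter_add_card_filter_not (s := Finset.range n) (fun i => b i = j)
  rwa [Finset.card_range] at this

lemma sum_card_testFold (b : ℕ → Fin K) (n : ℕ) : ∑ j, (testFold b n j).card = n := by
  have := Finset.card_eq_sum_card_fiberwise (s := Finset.range n) (t := Finset.univ) (f := b)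
    (fun i _ => by simp)
  rw [Finset.card_range] at this
  exact this.symm

/-- Summing the pairwise comparison over all folds: the total is n and each comparison costs at most
1, hence K altogether. -/
lemma BalancedFolds.card_testFold {b : ℕ → Fin K} {n : ℕ} (h : BalancedFolds b n) (j : Fin K) :
    K * (testFold b n j).card ≤ n + K ∧ n ≤ K * (testFold b n j).card + K := by
  have hs := sum_card_testFold b n
  have h1 : ∑ _j' : Fin K, (testFold b n j).card ≤ ∑ j', ((testFold b n j').card + 1) :=
    Finset.sum_le_sum fun j' _ => h j j'
  have h2 : ∑ j', (testFold b n j').card ≤ ∑ _j' : Fin K, ((testFold b n j).card + 1) :=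
    Finset.sum_le_sum fun j' _ => h j' j
  simp only [Finset.sum_add_distrib, Finset.sum_const, Finset.card_univ, Fintype.card_fin,
    smul_eq_mul, mul_one, hs] at h1 h2
  exact ⟨h1, h2⟩

/-- For K ≥ 2 a test fold has at most n/2 + 1 elements, so the training set has at least n/2 − 1;
n/2 + 1 ≤ 2(n/2 − 1) is the condition n ≥ 6. -/
lemma BalancedFolds.card_testFold_le {b : ℕ → Fin K} {n : ℕ} (h : BalancedFolds b n)
    (hK : 2 ≤ K) (hn : 6 ≤ n) (j : Fin K) :
    (trainFold b n j).Nonempty ∧ (testFold b n j).card ≤ 2 * (trainFold b n j).card := by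
  have h1 := (h.card_testFold j).1
  have h2 := card_testFold_add_card_trainFold b n j
  have h3 : 2 * (testFold b n j).card ≤ n + 2 := by
    by_contra! h4
    have : K * (2 * (testFold b n j).card) ≤ 2 * n + 2 * K := by
      rw [← mul_assoc, mul_comm K 2, mul_assoc]; omega
    nlinarith
  have h4 : (testFold b n j).card ≤ 2 * (trainFold b n j).card := by omega
  refine ⟨Finset.card_pos.1 ?_, h4⟩
  omega

variable {b : ℕ → ℕ → Fin K}

lemma tendsto_card_testFold (hb : ∀ n, BalancedFolds (b n) n) (j : Fin K) :
    Tendsto (fun n : ℕ => ((testFold (b n) n j).card : ℝ) / n) atTop (𝓝 (K : ℝ)⁻¹) := by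
  have hK : (0 : ℝ) < K := by exact_mod_cast j.pos
  have hi := tendsto_inv_atTop_nhds_zero_nat (𝕜 := ℝ)
  have l1 : Tendsto (fun n : ℕ => (K : ℝ)⁻¹ - (n : ℝ)⁻¹) atTop (𝓝 (K : ℝ)⁻¹) := by
    simpa using hi.const_sub (K : ℝ)⁻¹
  have l2 : Tendsto (fun n : ℕ => (K : ℝ)⁻¹ + (n : ℝ)⁻¹) atTop (𝓝 (K : ℝ)⁻¹) := by
    simpa using hi.const_add (K : ℝ)⁻¹
  refine tendsto_of_tendsto_of_tendsto_of_le_of_le' l1 l2 ?_ ?_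
  · filter_upwards [eventually_gt_atTop 0] with n hn
    have hn' : (0 : ℝ) < n := by exact_mod_cast hn
    have h1 : (n : ℝ) ≤ K * (testFold (b n) n j).card + K := by
      exact_mod_cast ((hb n).card_testFold j).2
    rw [le_div_iff₀ hn', sub_mul, inv_mul_cancel₀ hn'.ne', sub_le_iff_le_add,
      inv_mul_le_iff₀ hK]
    linarith
  · filter_upwards [eventually_gt_atTop 0] with n hn
    have hn' : (0 : ℝ) < n := by exact_mod_cast hn
    have h1 : (K * (testFold (b n) n j).card : ℝ) ≤ n + K := by
      exact_mod_cast ((hb n).card_testFold j).1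
    rw [div_le_iff₀ hn', add_mul, inv_mul_cancel₀ hn'.ne', ← sub_le_iff_le_add,
      le_inv_mul_iff₀ hK]
    linarith

lemma tendsto_card_testFold_div_trainFold (hK : 2 ≤ K) (hb : ∀ n, BalancedFolds (b n) n)
    (j : Fin K) :
    Tendsto (fun n : ℕ => ((testFold (b n) n j).card : ℝ) / (trainFold (b n) n j).card) atTop
      (𝓝 ((K : ℝ) - 1)⁻¹) := by
  have hK' : (2 : ℝ) ≤ K := by exact_mod_cast hK
  have h1 := tendsto_card_testFold hb j
  have h2 : (1 - (K : ℝ)⁻¹) ≠ 0 := by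
    have : (K : ℝ)⁻¹ ≤ 2⁻¹ := inv_anti₀ (by norm_num) hK'
    linarith
  have h3 := h1.div (h1.const_sub 1) h2
  have e : (K : ℝ)⁻¹ / (1 - (K : ℝ)⁻¹) = ((K : ℝ) - 1)⁻¹ := by
    have : (K : ℝ) - 1 ≠ 0 := by linarith
    field_simp
  rw [e] at h3
  refine h3.congr' ?_
  filter_upwards [eventually_gt_atTop 0] with n hn
  have hn' : (n : ℝ) ≠ 0 := by exact_mod_cast hn.ne'
  have h4 : ((trainFold (b n) n j).card : ℝ) = n - (testFold (b n) n j).card := by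
    rw [eq_sub_iff_add_eq, add_comm]
    exact_mod_cast card_testFold_add_card_trainFold (b n) n j
  rw [Pi.div_apply, h4, one_sub_div hn', div_div_div_cancel_right₀ hn']

end BalancedFolds

/-! ### Asymptotic variance of cross-validation and of the split. -/

section FoldStatistic

variable {Ω : Type*} [MeasurableSpace Ω] {μ : Measure Ω} {d : ℕ} {lam : ℝ} {K : ℕ}

/-- The weighted sum of the losses on all test folds. -/
noncomputable def foldStatistic (lam : ℝ) (q : Fin K → ℝ) (b : ℕ → Fin K) (n : ℕ)
    (x : ℕ → EuclideanSpace ℝ (Fin d) × ℝ) : ℝ :=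
  (n : ℝ)⁻¹ * ∑ j, q j * ∑ i ∈ testFold b n j, sqLoss (x i) (ridgeEstimator lam (trainFold b n j) x)

lemma cvRisk_eq_foldStatistic (b : ℕ → Fin K) (n : ℕ) (x : ℕ → EuclideanSpace ℝ (Fin d) × ℝ) :
    cvRisk (ridgeEstimator lam) sqLoss b n x = foldStatistic lam (fun _ => 1) b n x := by
  rw [cvRisk, foldStatistic, ← Finset.sum_fiberwise (Finset.range n) b]
  congr 1
  refine Finset.sum_congr rfl fun j _ => ?_
  rw [one_mul]
  refine Finset.sum_congr rfl fun i hi => ?_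
  rw [(Finset.mem_filter.1 hi).2]
  rfl

lemma splitRisk_eq_foldStatistic (b : ℕ → Fin K) (j : Fin K) (n : ℕ) (x : ℕ → EuclideanSpace ℝ (Fin d) × ℝ) :
    splitRisk (ridgeEstimator lam) sqLoss b j n x
      = foldStatistic lam (Pi.single j (K : ℝ)) b n x := by
  rw [splitRisk, foldStatistic, Finset.sum_eq_single j
    (fun j' _ hj' => by rw [Pi.single_eq_of_ne hj', zero_mul]) (by simp), Pi.single_eq_same,
    ← mul_assoc, inv_mul_eq_div]
  rfl

/-- The total weight with which the test folds depend on the training fold `j`. -/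
noncomputable def trainWeight (q : Fin K → ℝ) (b : ℕ → Fin K) (n : ℕ) (j : Fin K) : ℝ :=
  ∑ j' ∈ Finset.univ.erase j, 2 * q j' * ((testFold b n j').card / (trainFold b n j').card)

/-- Regrouping by observation instead of by fold: each observation enters once as a test point and
once for every other fold as a training point. The deterministic penalty terms go into c, which does
not affect the variance. -/
lemma foldStatistic_eq (θ w : EuclideanSpace ℝ (Fin d)) (q : Fin K → ℝ) (b : ℕ → Fin K) (n : ℕ) :
    ∃ c : ℝ, ∀ x : ℕ → EuclideanSpace ℝ (Fin d) × ℝ, foldStatistic lam q b n x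
      = (c + (n : ℝ)⁻¹ * ∑ k ∈ Finset.range n, (q (b k) * fitResidual θ (x k) ^ 2
          + trainWeight q b n (b k) * inner ℝ w (score θ (x k))))
        + (n : ℝ)⁻¹ * ∑ j, q j * foldRemainder lam θ w (testFold b n j) (trainFold b n j) x := by
  refine ⟨-((n : ℝ)⁻¹ * ∑ j, q j * (2 * (testFold b n j).card * (lam * inner ℝ w θ))),
    fun x => ?_⟩
  have h1 : ∀ j, ∑ i ∈ testFold b n j, sqLoss (x i) (ridgeEstimator lam (trainFold b n j) x)
      = ∑ i ∈ testFold b n j, fitResidual θ (x i) ^ 2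
        + 2 * ((testFold b n j).card / (trainFold b n j).card)
          * ∑ k ∈ trainFold b n j, inner ℝ w (score θ (x k))
        - 2 * (testFold b n j).card * (lam * inner ℝ w θ)
        + foldRemainder lam θ w (testFold b n j) (trainFold b n j) x := fun j => by
    rw [foldRemainder, ridgeScore, inner_sub_right, real_inner_smul_right, real_inner_smul_right,
      inner_sum]
    ring
  have h2 : ∑ j, q j * ∑ i ∈ testFold b n j, fitResidual θ (x i) ^ 2
      = ∑ k ∈ Finset.range n, q (b k) * fitResidual θ (x k) ^ 2 := by
    rw [← Finset.sum_fiberwise (Finset.range n) b]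
    refine Finset.sum_congr rfl fun j _ => ?_
    rw [Finset.mul_sum]
    refine Finset.sum_congr rfl fun i hi => ?_
    rw [(Finset.mem_filter.1 hi).2]
  have h3 : ∑ j, q j * (2 * ((testFold b n j).card / (trainFold b n j).card)
          * ∑ k ∈ trainFold b n j, inner ℝ w (score θ (x k)))
      = ∑ k ∈ Finset.range n, trainWeight q b n (b k) * inner ℝ w (score θ (x k)) := by
    simp only [trainWeight, Finset.sum_mul, Finset.mul_sum]
    rw [Finset.sum_sigma', Finset.sum_sigma']
    -- Exchange of summation: k is in the training set of fold j exactly when j is not the fold of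
    -- k.
    refine Finset.sum_bij' (fun p _ => ⟨p.2, p.1⟩) (fun p _ => ⟨p.2, p.1⟩) ?_ ?_ ?_ ?_ ?_
    · rintro ⟨j, k⟩ h
      simp only [Finset.mem_sigma, Finset.mem_univ, true_and, trainFold, Finset.mem_filter] at h
      simpa using ⟨by simpa using h.1, Ne.symm h.2⟩
    · rintro ⟨k, j⟩ h
      simp only [Finset.mem_sigma, Finset.mem_erase, Finset.mem_univ, and_true] at h
      simp only [Finset.mem_sigma, Finset.mem_univ, true_and, trainFold, Finset.mem_filter]
      exact ⟨h.1, Ne.symm h.2⟩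
    · intro p _; rfl
    · intro p _; rfl
    · rintro ⟨j, k⟩ _
      dsimp only
      ring
  simp only [foldStatistic, h1, mul_add, mul_sub, Finset.sum_add_distrib, Finset.sum_sub_distrib]
  rw [h2, h3]
  ring

namespace RidgeModel

variable {X : ℕ → Ω → EuclideanSpace ℝ (Fin d) × ℝ} {X' Xt : Ω → EuclideanSpace ℝ (Fin d) × ℝ} {M : EuclideanSpace ℝ (Fin d) →L[ℝ] EuclideanSpace ℝ (Fin d)} {θ w : EuclideanSpace ℝ (Fin d)}
  [IsProbabilityMeasure μ]

/-- Independence makes the variance additive; each fold holds a fraction tending to 1/K of the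
observations, and its training weight converges since |I|/|T| → 1/(K − 1). -/
lemma tendsto_mul_variance_foldLinear (h : RidgeModel lam X X' Xt μ M θ w) (hK : 2 ≤ K)
    {b : ℕ → ℕ → Fin K} (hb : ∀ n, BalancedFolds (b n) n) (q : Fin K → ℝ) (c : ℕ → ℝ) :
    Tendsto (fun n : ℕ => (n : ℝ) * Var[fun ω => c n + (n : ℝ)⁻¹ *
        ∑ k ∈ Finset.range n, (q (b n k) * fitResidual θ (X k ω) ^ 2
          + trainWeight q (b n) n (b n k) * inner ℝ w (score θ (X k ω))); μ]) atTop
      (𝓝 (∑ j, (K : ℝ)⁻¹ * (q j ^ 2 * Var[fun ω => fitResidual θ (X 0 ω) ^ 2; μ]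
        + 2 * q j * (2 * ((K : ℝ) - 1)⁻¹ * ∑ j' ∈ Finset.univ.erase j, q j')
          * cov[fun ω => fitResidual θ (X 0 ω) ^ 2, fun ω => inner ℝ w (score θ (X 0 ω)); μ]
        + (2 * ((K : ℝ) - 1)⁻¹ * ∑ j' ∈ Finset.univ.erase j, q j') ^ 2
          * Var[fun ω => inner ℝ w (score θ (X 0 ω)); μ]))) := by
  have Lr : MemLp (fun ω => fitResidual θ (X 0 ω) ^ 2) 2 μ :=
    memLp_sq_of_four (memLp_fitResidual h.memLp_fst h.memLp_snd θ)
  have Ls := h.memLp_inner_score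
  have hw : ∀ j, Tendsto (fun n => trainWeight q (b n) n j) atTop
      (𝓝 (2 * ((K : ℝ) - 1)⁻¹ * ∑ j' ∈ Finset.univ.erase j, q j')) := fun j => by
    have := tendsto_finsetSum (Finset.univ.erase j) fun j' _ =>
      (tendsto_card_testFold_div_trainFold hK hb j').const_mul (2 * q j')
    have e : 2 * ((K : ℝ) - 1)⁻¹ * ∑ j' ∈ Finset.univ.erase j, q j'
        = ∑ j' ∈ Finset.univ.erase j, 2 * q j' * ((K : ℝ) - 1)⁻¹ := by
      rw [Finset.mul_sum]
      exact Finset.sum_congr rfl fun j' _ => by ring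
    rw [e]
    exact this
  have hf : ∀ a c' : ℝ, Measurable fun x : EuclideanSpace ℝ (Fin d) × ℝ =>
      a * fitResidual θ x ^ 2 + c' * inner ℝ w (score θ x) := fun a c' =>
    Continuous.measurable (by fun_prop)
  have hv : ∀ a c' : ℝ, Var[fun ω => a * fitResidual θ (X 0 ω) ^ 2
        + c' * inner ℝ w (score θ (X 0 ω)); μ]
      = a ^ 2 * Var[fun ω => fitResidual θ (X 0 ω) ^ 2; μ]
        + 2 * a * c'
          * cov[fun ω => fitResidual θ (X 0 ω) ^ 2, fun ω => inner ℝ w (score θ (X 0 ω)); μ]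
        + c' ^ 2 * Var[fun ω => inner ℝ w (score θ (X 0 ω)); μ] := fun a c' => by
    rw [variance_fun_add (Lr.const_mul a) (Ls.const_mul c'), variance_const_mul,
      variance_const_mul, covariance_const_mul_left, covariance_const_mul_right]
    ring
  refine (tendsto_finsetSum Finset.univ fun j _ => (tendsto_card_testFold hb j).mul
    (((tendsto_const_nhds (x := q j ^ 2 * Var[fun ω => fitResidual θ (X 0 ω) ^ 2; μ])).add
      (((hw j).const_mul (2 * q j)).mul_const
        cov[fun ω => fitResidual θ (X 0 ω) ^ 2, fun ω => inner ℝ w (score θ (X 0 ω)); μ])).add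
      (((hw j).pow 2).mul_const Var[fun ω => inner ℝ w (score θ (X 0 ω)); μ]))).congr' ?_
  filter_upwards [eventually_gt_atTop 0] with n hn
  have hn' : (n : ℝ) ≠ 0 := by exact_mod_cast hn.ne'
  have hm : AEStronglyMeasurable (fun ω => (n : ℝ)⁻¹ *
        ∑ k ∈ Finset.range n, (q (b n k) * fitResidual θ (X k ω) ^ 2
          + trainWeight q (b n) n (b n k) * inner ℝ w (score θ (X k ω)))) μ :=
    ((Finset.measurable_fun_sum _ fun k _ =>
      (hf (q (b n k)) (trainWeight q (b n) n (b n k))).comp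
        (h.iid.measurable_obs k)).const_mul _).aestronglyMeasurable
  rw [variance_const_add hm, variance_const_mul,
    variance_sum_of_iIndepFun h.iid.iIndepFun_obs h.iid.identDistrib_obs
      (f := fun k x => q (b n k) * fitResidual θ x ^ 2
        + trainWeight q (b n) n (b n k) * inner ℝ w (score θ x)) (fun k => hf _ _)
      (fun k => (Lr.const_mul _).add (Ls.const_mul _)),
    ← Finset.sum_fiberwise (Finset.range n) (b n), Finset.mul_sum, Finset.mul_sum]
  refine Finset.sum_congr rfl fun j _ => ?_
  rw [Finset.sum_congr rfl fun k hk => by rw [(Finset.mem_filter.1 hk).2, hv],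
    Finset.sum_const, nsmul_eq_mul, ← testFold]
  field_simp

/-- There are K remainders bounded in L², each divided by n, so n times the second moment is of
order 1/n. -/
lemma tendsto_mul_integral_sq_foldRemainder (h : RidgeModel lam X X' Xt μ M θ w)
    (hZ : MemLp (fun ω => (X 0 ω).1) 8 μ) (hY : MemLp (fun ω => (X 0 ω).2) 8 μ) (hK : 2 ≤ K)
    {b : ℕ → ℕ → Fin K} (hb : ∀ n, BalancedFolds (b n) n) (q : Fin K → ℝ) :
    Tendsto (fun n : ℕ => (n : ℝ) * ∫ ω, ((n : ℝ)⁻¹ * ∑ j, q j * foldRemainder lam θ w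
      (testFold (b n) n j) (trainFold (b n) n j) (dataset X ω)) ^ 2 ∂μ) atTop (𝓝 0) := by
  obtain ⟨C, hC, hrem⟩ := h.exists_integral_sq_foldRemainder_le hZ hY
  have LR : ∀ n j, MemLp (fun ω => foldRemainder lam θ w (testFold (b n) n j)
      (trainFold (b n) n j) (dataset X ω)) 2 μ := fun n j =>
    h.memLp_foldRemainder (disjoint_testFold_trainFold _ _ _)
  have h1 : Tendsto (fun n : ℕ => (n : ℝ)⁻¹ * (K * ∑ j, q j ^ 2 * C)) atTop (𝓝 0) := by
    simpa using (tendsto_inv_atTop_nhds_zero_nat (𝕜 := ℝ)).mul_const (K * ∑ j, q j ^ 2 * C)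
  refine squeeze_zero' (Eventually.of_forall fun n =>
    mul_nonneg (Nat.cast_nonneg n) (integral_nonneg fun ω => sq_nonneg _)) ?_ h1
  filter_upwards [eventually_ge_atTop 6] with n hn
  have hn' : (n : ℝ) ≠ 0 := by
    have : n ≠ 0 := by omega
    exact_mod_cast this
  have I : ∀ j, Integrable (fun ω => q j ^ 2 * foldRemainder lam θ w
    (testFold (b n) n j) (trainFold (b n) n j) (dataset X ω) ^ 2) μ := fun j =>
    (LR n j).integrable_sq.const_mul _
  calc _ = (n : ℝ)⁻¹ * ∫ ω, (∑ j, q j * foldRemainder lam θ w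
          (testFold (b n) n j) (trainFold (b n) n j) (dataset X ω)) ^ 2 ∂μ := by
        simp only [mul_pow, integral_const_mul]
        field_simp
    _ ≤ (n : ℝ)⁻¹ * ∫ ω, K * ∑ j, q j ^ 2 * foldRemainder lam θ w
          (testFold (b n) n j) (trainFold (b n) n j) (dataset X ω) ^ 2 ∂μ := by
        refine mul_le_mul_of_nonneg_left ?_ (by positivity)
        refine integral_mono_of_nonneg (ae_of_all _ fun ω => sq_nonneg _)
          ((integrable_finsetSum _ fun j _ => I j).const_mul _) (ae_of_all _ fun ω => ?_)
        have := sq_sum_le_card_mul_sum_sq (s := (Finset.univ : Finset (Fin K)))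
          (f := fun j => q j * foldRemainder lam θ w
          (testFold (b n) n j) (trainFold (b n) n j) (dataset X ω))
        simpa only [Finset.card_univ, Fintype.card_fin, mul_pow] using this
    _ = (n : ℝ)⁻¹ * (K * ∑ j, q j ^ 2 * ∫ ω, foldRemainder lam θ w
          (testFold (b n) n j) (trainFold (b n) n j) (dataset X ω) ^ 2 ∂μ) := by
        rw [integral_const_mul, integral_finsetSum _ fun j _ => I j]
        simp only [integral_const_mul]
    _ ≤ _ := by
        gcongr with j
        exact hrem _ _ (disjoint_testFold_trainFold _ _ _)
          ((hb n).card_testFold_le hK hn j).1 ((hb n).card_testFold_le hK hn j).2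

/-- The variance of a weighted sum of the losses on the test folds. -/
theorem tendsto_mul_variance_foldStatistic (h : RidgeModel lam X X' Xt μ M θ w)
    (hZ : MemLp (fun ω => (X 0 ω).1) 8 μ) (hY : MemLp (fun ω => (X 0 ω).2) 8 μ) (hK : 2 ≤ K)
    {b : ℕ → ℕ → Fin K} (hb : ∀ n, BalancedFolds (b n) n) (q : Fin K → ℝ) :
    Tendsto (fun n : ℕ => (n : ℝ) * Var[fun ω => foldStatistic lam q (b n) n (dataset X ω); μ])
      atTop
      (𝓝 (∑ j, (K : ℝ)⁻¹ * (q j ^ 2 * Var[fun ω => fitResidual θ (X 0 ω) ^ 2; μ]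
        + 2 * q j * (2 * ((K : ℝ) - 1)⁻¹ * ∑ j' ∈ Finset.univ.erase j, q j')
          * cov[fun ω => fitResidual θ (X 0 ω) ^ 2, fun ω => inner ℝ w (score θ (X 0 ω)); μ]
        + (2 * ((K : ℝ) - 1)⁻¹ * ∑ j' ∈ Finset.univ.erase j, q j') ^ 2
          * Var[fun ω => inner ℝ w (score θ (X 0 ω)); μ]))) := by
  choose c hc using fun n => foldStatistic_eq (lam := lam) θ w q (b n) n
  have Lr : ∀ k, MemLp (fun ω => fitResidual θ (X k ω) ^ 2) 2 μ := fun k =>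
    memLp_sq_of_four (memLp_fitResidual (h.memLp_fst_of_identDistrib (h.iid.identDistrib_obs k))
        (h.memLp_snd_of_identDistrib (h.iid.identDistrib_obs k)) θ)
  have Ls : ∀ k, MemLp (fun ω => inner ℝ w (score θ (X k ω))) 2 μ := fun k =>
    (memLp_score (h.memLp_fst_of_identDistrib (h.iid.identDistrib_obs k))
        (h.memLp_snd_of_identDistrib (h.iid.identDistrib_obs k)) θ).const_inner w
  have LR : ∀ n j, MemLp (fun ω => foldRemainder lam θ w (testFold (b n) n j)
      (trainFold (b n) n j) (dataset X ω)) 2 μ := fun n j =>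
    h.memLp_foldRemainder (disjoint_testFold_trainFold _ _ _)
  have LL : ∀ n : ℕ, MemLp (fun ω => c n + (n : ℝ)⁻¹ *
        ∑ k ∈ Finset.range n, (q (b n k) * fitResidual θ (X k ω) ^ 2
          + trainWeight q (b n) n (b n k) * inner ℝ w (score θ (X k ω)))) 2 μ := fun n =>
    (memLp_const (c n)).add ((memLp_finsetSum (Finset.range n) fun k _ =>
      ((Lr k).const_mul (q (b n k))).add
        ((Ls k).const_mul (trainWeight q (b n) n (b n k)))).const_mul (n : ℝ)⁻¹)
  have L0 : ∀ n : ℕ, MemLp (fun ω => (n : ℝ)⁻¹ * ∑ j, q j * foldRemainder lam θ w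
      (testFold (b n) n j) (trainFold (b n) n j) (dataset X ω)) 2 μ := fun n =>
    (memLp_finsetSum Finset.univ fun j _ => (LR n j).const_mul (q j)).const_mul (n : ℝ)⁻¹
  refine (tendsto_mul_variance_add (c := fun n => (n : ℝ))
    (L := fun n ω => c n + (n : ℝ)⁻¹ *
      ∑ k ∈ Finset.range n, (q (b n k) * fitResidual θ (X k ω) ^ 2
        + trainWeight q (b n) n (b n k) * inner ℝ w (score θ (X k ω))))
    (R := fun n ω => (n : ℝ)⁻¹ * ∑ j, q j * foldRemainder lam θ w
      (testFold (b n) n j) (trainFold (b n) n j) (dataset X ω))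
    (fun n => Nat.cast_nonneg n) (Eventually.of_forall LL) (Eventually.of_forall L0)
    (h.tendsto_mul_variance_foldLinear hK hb q c)
    (h.tendsto_mul_integral_sq_foldRemainder hZ hY hK hb q)).congr fun n => ?_
  simp only [hc]
  rfl

/-- The asymptotic variance of the cross-validated risk. -/
theorem tendsto_mul_variance_cvRisk (h : RidgeModel lam X X' Xt μ M θ w)
    (hZ : MemLp (fun ω => (X 0 ω).1) 8 μ) (hY : MemLp (fun ω => (X 0 ω).2) 8 μ) (hK : 2 ≤ K)
    {b : ℕ → ℕ → Fin K} (hb : ∀ n, BalancedFolds (b n) n) :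
    Tendsto (fun n : ℕ => (n : ℝ) * Var[fun ω => cvRisk (ridgeEstimator lam) sqLoss (b n) n
        (dataset X ω); μ]) atTop
      (𝓝 (Var[fun ω => fitResidual θ (X 0 ω) ^ 2; μ]
        + 4 * Var[fun ω => inner ℝ w (score θ (X 0 ω)); μ]
        + 2 * (2 * cov[fun ω => fitResidual θ (X 0 ω) ^ 2,
          fun ω => inner ℝ w (score θ (X 0 ω)); μ]))) := by
  have h1 := h.tendsto_mul_variance_foldStatistic hZ hY hK hb fun _ => 1
  simp only [cvRisk_eq_foldStatistic]
  convert h1 using 2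
  have hK' : (K : ℝ) - 1 ≠ 0 := by
    have : (2 : ℝ) ≤ K := by exact_mod_cast hK
    linarith
  have hK0 : (K : ℝ) ≠ 0 := by
    have : K ≠ 0 := by omega
    exact_mod_cast this
  -- Each observation trains K − 1 folds, cancelling (K − 1)⁻¹: its weight on the score is 2
  -- whatever K is.
  have e : ∀ j : Fin K, ∑ _j' ∈ Finset.univ.erase j, (1 : ℝ) = (K : ℝ) - 1 := fun j => by
    rw [Finset.sum_const, Finset.card_erase_of_mem (Finset.mem_univ j), Finset.card_univ,
      Fintype.card_fin, nsmul_eq_mul, mul_one, Nat.cast_sub (by omega), Nat.cast_one]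
  simp only [e, Finset.sum_const, Finset.card_univ, Fintype.card_fin, nsmul_eq_mul]
  field_simp
  ring

/-- The asymptotic variance of the train-test split risk. -/
theorem tendsto_mul_variance_splitRisk (h : RidgeModel lam X X' Xt μ M θ w)
    (hZ : MemLp (fun ω => (X 0 ω).1) 8 μ) (hY : MemLp (fun ω => (X 0 ω).2) 8 μ) (hK : 2 ≤ K)
    {b : ℕ → ℕ → Fin K} (hb : ∀ n, BalancedFolds (b n) n) (j : Fin K) :
    Tendsto (fun n : ℕ => (n : ℝ) * Var[fun ω => splitRisk (ridgeEstimator lam) sqLoss (b n) j n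
        (dataset X ω); μ]) atTop
      (𝓝 (K * (Var[fun ω => fitResidual θ (X 0 ω) ^ 2; μ]
        + ((K : ℝ) - 1)⁻¹ * (4 * Var[fun ω => inner ℝ w (score θ (X 0 ω)); μ])))) := by
  have h1 := h.tendsto_mul_variance_foldStatistic hZ hY hK hb (Pi.single j (K : ℝ))
  simp only [splitRisk_eq_foldStatistic]
  convert h1 using 2
  have hK' : (K : ℝ) - 1 ≠ 0 := by
    have : (2 : ℝ) ≤ K := by exact_mod_cast hK
    linarith
  have hK0 : (K : ℝ) ≠ 0 := by
    have : K ≠ 0 := by omega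
    exact_mod_cast this
  rw [← Finset.add_sum_erase _ _ (Finset.mem_univ j)]
  -- Test observations carry no score weight and training observations no loss weight, so the
  -- covariance term disappears.
  have e0 : ∑ j' ∈ Finset.univ.erase j, (Pi.single j (K : ℝ) : Fin K → ℝ) j' = 0 :=
    Finset.sum_eq_zero fun j' hj' => Pi.single_eq_of_ne (Finset.ne_of_mem_erase hj') _
  have e1 : ∀ i ∈ Finset.univ.erase j,
      ∑ j' ∈ Finset.univ.erase i, (Pi.single j (K : ℝ) : Fin K → ℝ) j' = K := fun i hi => by
    rw [Finset.sum_eq_single_of_mem j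
      (Finset.mem_erase.2 ⟨(Finset.ne_of_mem_erase hi).symm, Finset.mem_univ j⟩)
      (fun j' _ hj' => Pi.single_eq_of_ne hj' _), Pi.single_eq_same]
  rw [e0, Pi.single_eq_same]
  rw [Finset.sum_congr rfl fun i hi => by
    rw [e1 i hi, Pi.single_eq_of_ne (Finset.ne_of_mem_erase hi)],
    Finset.sum_const, Finset.card_erase_of_mem (Finset.mem_univ j), Finset.card_univ,
    Fintype.card_fin, nsmul_eq_mul, Nat.cast_sub (by omega), Nat.cast_one]
  field_simp
  ring

end RidgeModel

end FoldStatistic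

/-! ### Gaussian fourth moments and Isserlis' theorem. -/

section GaussianMoments

/-- Moments as derivatives at 0 of the moment generating function exp(vt²/2); this includes the
degenerate case v = 0. -/
lemma integral_pow_gaussianReal (v : ℝ≥0) :
    ∫ x, x ^ 3 ∂gaussianReal 0 v = 0 ∧ ∫ x, x ^ 4 ∂gaussianReal 0 v = 3 * (v : ℝ) ^ 2 := by
  have h0 : (0 : ℝ) ∈ interior (integrableExpSet id (gaussianReal 0 v)) := by
    rw [integrableExpSet_id_gaussianReal, interior_univ]; trivial
  -- Differentiation acts on the polynomial factor by p ↦ p′ + vtp, which is iterated four times.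
  have hd : ∀ (p p' : ℝ → ℝ), (∀ t, HasDerivAt p (p' t) t) →
      deriv (fun t => p t * Real.exp ((v : ℝ) * t ^ 2 / 2))
        = fun t => (p' t + v * t * p t) * Real.exp ((v : ℝ) * t ^ 2 / 2) := fun p p' hp => by
    funext t
    have h1 : HasDerivAt (fun t : ℝ => (v : ℝ) * t ^ 2 / 2) (v * t) t := by
      have := (((hasDerivAt_id t).pow 2).const_mul (v : ℝ)).div_const 2
      refine this.congr_deriv ?_
      simp
      ring
    refine ((hp t).mul h1.exp).deriv.trans ?_
    ring
  have e0 : iteratedDeriv 0 (mgf id (gaussianReal 0 v))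
      = fun t => 1 * Real.exp ((v : ℝ) * t ^ 2 / 2) := by
    rw [iteratedDeriv_zero, mgf_id_gaussianReal]
    funext t
    simp
  have e1 : iteratedDeriv 1 (mgf id (gaussianReal 0 v))
      = fun t => (v * t) * Real.exp ((v : ℝ) * t ^ 2 / 2) := by
    rw [iteratedDeriv_succ, e0, hd (fun _ => 1) (fun _ => 0) fun t => hasDerivAt_const t 1]
    funext t; ring
  have e2 : iteratedDeriv 2 (mgf id (gaussianReal 0 v))
      = fun t => (v + v ^ 2 * t ^ 2) * Real.exp ((v : ℝ) * t ^ 2 / 2) := by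
    rw [iteratedDeriv_succ, e1, hd (fun t => v * t) (fun _ => v) fun t => by
      simpa using (hasDerivAt_id t).const_mul (v : ℝ)]
    funext t; ring
  have e3 : iteratedDeriv 3 (mgf id (gaussianReal 0 v))
      = fun t => (3 * v ^ 2 * t + v ^ 3 * t ^ 3) * Real.exp ((v : ℝ) * t ^ 2 / 2) := by
    rw [iteratedDeriv_succ, e2, hd (fun t => v + v ^ 2 * t ^ 2) (fun t => v ^ 2 * (2 * t)) fun t => by
      simpa using ((hasDerivAt_pow 2 t).const_mul ((v : ℝ) ^ 2)).const_add (v : ℝ)]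
    funext t; ring
  have e4 : iteratedDeriv 4 (mgf id (gaussianReal 0 v))
      = fun t => (3 * v ^ 2 + 6 * v ^ 3 * t ^ 2 + v ^ 4 * t ^ 4)
        * Real.exp ((v : ℝ) * t ^ 2 / 2) := by
    rw [iteratedDeriv_succ, e3, hd (fun t => 3 * v ^ 2 * t + v ^ 3 * t ^ 3)
      (fun t => 3 * v ^ 2 + v ^ 3 * (3 * t ^ 2)) fun t => by
      simpa using ((hasDerivAt_id t).const_mul (3 * (v : ℝ) ^ 2)).fun_add
        ((hasDerivAt_pow 3 t).const_mul ((v : ℝ) ^ 3))]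
    funext t; ring
  have h3 := iteratedDeriv_mgf_zero h0 3
  have h4 := iteratedDeriv_mgf_zero h0 4
  rw [e3] at h3
  rw [e4] at h4
  simp only [Pi.pow_apply, id] at h3 h4
  exact ⟨by rw [← h3]; simp, by rw [← h4]; simp⟩

variable {Ω : Type*} [MeasurableSpace Ω] {μ : Measure Ω}

lemma ProbabilityTheory.HasGaussianLaw.integral_pow_four {f : Ω → ℝ} (hf : HasGaussianLaw f μ)
    (h0 : ∫ ω, f ω ∂μ = 0) : ∫ ω, f ω ^ 4 ∂μ = 3 * (∫ ω, f ω ^ 2 ∂μ) ^ 2 := by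
  have h1 := hf.map_eq_gaussianReal
  rw [h0, variance_of_integral_eq_zero hf.aemeasurable h0] at h1
  have h2 := (integral_pow_gaussianReal (∫ ω, f ω ^ 2 ∂μ).toNNReal).2
  rw [← h1, integral_map hf.aemeasurable (by fun_prop),
    Real.coe_toNNReal _ (integral_nonneg fun ω => sq_nonneg _)] at h2
  exact h2

/-- A form of Isserlis' theorem. -/
lemma integral_sq_mul_sq_of_pow_four {f g : Ω → ℝ} (hf : MemLp f 4 μ) (hg : MemLp g 4 μ)
    [IsProbabilityMeasure μ]
    (h : ∀ a b : ℝ, ∫ ω, (a * f ω + b * g ω) ^ 4 ∂μ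
      = 3 * (∫ ω, (a * f ω + b * g ω) ^ 2 ∂μ) ^ 2) :
    ∫ ω, f ω ^ 2 * g ω ^ 2 ∂μ
      = (∫ ω, f ω ^ 2 ∂μ) * (∫ ω, g ω ^ 2 ∂μ) + 2 * (∫ ω, f ω * g ω ∂μ) ^ 2 := by
  have h42 : (2 : ENNReal) ≤ 4 := by norm_num
  have hf2 := hf.mono_exponent h42
  have hg2 := hg.mono_exponent h42
  have If := integrable_pow_four hf
  have Ig := integrable_pow_four hg
  have Ifg : Integrable (fun ω => f ω ^ 2 * g ω ^ 2) μ :=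
    integrable_mul_of_memLp_two (memLp_sq_of_four hf) (memLp_sq_of_four hg)
  have I1 := hf2.integrable_sq
  have I2 := hg2.integrable_sq
  have I12 : Integrable (fun ω => f ω * g ω) μ := integrable_mul_of_memLp_two hf2 hg2
  have hsq : ∀ a b : ℝ, ∫ ω, (a * f ω + b * g ω) ^ 2 ∂μ = a ^ 2 * ∫ ω, f ω ^ 2 ∂μ
      + b ^ 2 * ∫ ω, g ω ^ 2 ∂μ + 2 * a * b * ∫ ω, f ω * g ω ∂μ := fun a b => by
    have J := (I1.const_mul (a ^ 2)).fun_add (I2.const_mul (b ^ 2))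
    rw [← integral_const_mul, ← integral_const_mul, ← integral_const_mul,
      ← integral_add (I1.const_mul (a ^ 2)) (I2.const_mul (b ^ 2)),
      ← integral_add J (I12.const_mul (2 * a * b))]
    exact integral_congr_ae (ae_of_all _ fun ω => by ring)
  have hL : ∀ a b : ℝ, Integrable (fun ω => (a * f ω + b * g ω) ^ 4) μ := fun a b =>
    integrable_pow_four ((hf.const_mul a).add (hg.const_mul b))
  have h1 := h 1 1
  have h2 := h 1 (-1)
  have h3 := h 1 0
  have h4 := h 0 1
  rw [hsq] at h1 h2 h3 h4
  simp only [one_mul, zero_mul, add_zero, zero_add] at h3 h4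
  -- Odd mixed terms cancel in (f + g)⁴ + (f − g)⁴, isolating 12 f²g².
  have hsum : ∫ ω, (1 * f ω + 1 * g ω) ^ 4 ∂μ + ∫ ω, (1 * f ω + -1 * g ω) ^ 4 ∂μ
      = 2 * ∫ ω, f ω ^ 4 ∂μ + 12 * ∫ ω, f ω ^ 2 * g ω ^ 2 ∂μ + 2 * ∫ ω, g ω ^ 4 ∂μ := by
    have J := (If.const_mul 2).fun_add (Ifg.const_mul 12)
    rw [← integral_add (hL 1 1) (hL 1 (-1)), ← integral_const_mul, ← integral_const_mul,
      ← integral_const_mul, ← integral_add (If.const_mul 2) (Ifg.const_mul 12),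
      ← integral_add J (Ig.const_mul 2)]
    exact integral_congr_ae (ae_of_all _ fun ω => by ring)
  rw [h1, h2, h3, h4] at hsum
  linear_combination (-1 / 12 : ℝ) * hsum

/-- A polarised form of Isserlis' theorem. -/
lemma integral_sq_mul_mul_of_pow_four {f g k : Ω → ℝ} (hf : MemLp f 4 μ) (hg : MemLp g 4 μ)
    (hk : MemLp k 4 μ) [IsProbabilityMeasure μ]
    (h : ∀ a b c : ℝ, ∫ ω, (a * f ω + (b * g ω + c * k ω)) ^ 4 ∂μ
      = 3 * (∫ ω, (a * f ω + (b * g ω + c * k ω)) ^ 2 ∂μ) ^ 2) :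
    ∫ ω, f ω ^ 2 * (g ω * k ω) ∂μ = (∫ ω, f ω ^ 2 ∂μ) * (∫ ω, g ω * k ω ∂μ)
      + 2 * (∫ ω, f ω * g ω ∂μ) * (∫ ω, f ω * k ω ∂μ) := by
  have h42 : (2 : ENNReal) ≤ 4 := by norm_num
  have hf2 := hf.mono_exponent h42
  have hg2 := hg.mono_exponent h42
  have hk2 := hk.mono_exponent h42
  -- Polarisation: 4gk = (g + k)² − (g − k)².
  have A := integral_sq_mul_sq_of_pow_four hf (hg.add hk) fun a b => by
    simpa only [Pi.add_apply, mul_add] using h a b b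
  have B := integral_sq_mul_sq_of_pow_four hf (hg.sub hk) fun a b => by
    have := h a b (-b)
    simpa only [Pi.sub_apply, mul_sub, neg_mul, ← sub_eq_add_neg] using this
  simp only [Pi.add_apply, Pi.sub_apply] at A B
  have Ig := hg2.integrable_sq
  have Ik := hk2.integrable_sq
  have Igk : Integrable (fun ω => g ω * k ω) μ := integrable_mul_of_memLp_two hg2 hk2
  have Ifg : Integrable (fun ω => f ω * g ω) μ := integrable_mul_of_memLp_two hf2 hg2
  have Ifk : Integrable (fun ω => f ω * k ω) μ := integrable_mul_of_memLp_two hf2 hk2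
  have e1 : ∫ ω, (g ω + k ω) ^ 2 ∂μ
      = ∫ ω, g ω ^ 2 ∂μ + ∫ ω, k ω ^ 2 ∂μ + 2 * ∫ ω, g ω * k ω ∂μ := by
    rw [← integral_add Ig Ik, ← integral_const_mul,
      ← integral_add (Ig.fun_add Ik) (Igk.const_mul 2)]
    exact integral_congr_ae (ae_of_all _ fun ω => by ring)
  have e2 : ∫ ω, (g ω - k ω) ^ 2 ∂μ
      = ∫ ω, g ω ^ 2 ∂μ + ∫ ω, k ω ^ 2 ∂μ - 2 * ∫ ω, g ω * k ω ∂μ := by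
    rw [← integral_add Ig Ik, ← integral_const_mul,
      ← integral_sub (Ig.fun_add Ik) (Igk.const_mul 2)]
    exact integral_congr_ae (ae_of_all _ fun ω => by ring)
  have e3 : ∫ ω, f ω * (g ω + k ω) ∂μ = ∫ ω, f ω * g ω ∂μ + ∫ ω, f ω * k ω ∂μ := by
    rw [← integral_add Ifg Ifk]
    exact integral_congr_ae (ae_of_all _ fun ω => by ring)
  have e4 : ∫ ω, f ω * (g ω - k ω) ∂μ = ∫ ω, f ω * g ω ∂μ - ∫ ω, f ω * k ω ∂μ := by
    rw [← integral_sub Ifg Ifk]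
    exact integral_congr_ae (ae_of_all _ fun ω => by ring)
  have JA : Integrable (fun ω => f ω ^ 2 * (g ω + k ω) ^ 2) μ :=
    integrable_mul_of_memLp_two (memLp_sq_of_four hf) (memLp_sq_of_four (hg.add hk))
  have JB : Integrable (fun ω => f ω ^ 2 * (g ω - k ω) ^ 2) μ :=
    integrable_mul_of_memLp_two (memLp_sq_of_four hf) (memLp_sq_of_four (hg.sub hk))
  have e5 : ∫ ω, f ω ^ 2 * (g ω * k ω) ∂μ = 4⁻¹ * (∫ ω, f ω ^ 2 * (g ω + k ω) ^ 2 ∂μ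
      - ∫ ω, f ω ^ 2 * (g ω - k ω) ^ 2 ∂μ) := by
    rw [← integral_sub JA JB, ← integral_const_mul]
    exact integral_congr_ae (ae_of_all _ fun ω => by ring)
  rw [e5, A, B, e1, e2, e3, e4]
  ring

end GaussianMoments

/-! ### The noise: independence from the covariates and factorising moments. -/

section Noise

variable {Ω : Type*} [MeasurableSpace Ω] {μ : Measure Ω} {d : ℕ} {V : Ω → EuclideanSpace ℝ (Fin d) × ℝ} {θopt : EuclideanSpace ℝ (Fin d)}
  {σ : ℝ≥0}

/-- A linear model with normal noise that is independent of the covariates. -/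
structure GaussianNoise (σ : ℝ≥0) (θopt : EuclideanSpace ℝ (Fin d)) (V : Ω → EuclideanSpace ℝ (Fin d) × ℝ) (μ : Measure Ω) : Prop where
  measurable : Measurable V
  indep : IndepFun (fun ω => (V ω).1) (fun ω => fitResidual θopt (V ω)) μ
  map_eq : μ.map (fun ω => fitResidual θopt (V ω)) = gaussianReal 0 (σ ^ 2)

/-- Subtracting the conditional mean turns the conditional law of the response into a kernel that
does not depend on z. Disintegrating over rectangles gives a product, hence both the law and
independence. -/
lemma GaussianNoise.of_condDistrib [IsProbabilityMeasure μ] (hV : Measurable V)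
    (h : ∀ᵐ z ∂(μ.map fun ω => (V ω).1),
      condDistrib (fun ω => (V ω).2) (fun ω => (V ω).1) μ z
        = gaussianReal (inner ℝ z θopt) (σ ^ 2)) :
    GaussianNoise σ θopt V μ := by
  have hZ : Measurable fun ω => (V ω).1 := hV.fst
  have hY : Measurable fun ω => (V ω).2 := hV.snd
  have hε : Measurable fun ω => fitResidual θopt (V ω) :=
    (continuous_fitResidual θopt).measurable.comp hV
  have key : ∀ (s : Set (EuclideanSpace ℝ (Fin d))) (t : Set ℝ), MeasurableSet s → MeasurableSet t →
      μ ((fun ω => (V ω).1) ⁻¹' s ∩ (fun ω => fitResidual θopt (V ω)) ⁻¹' t)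
        = μ ((fun ω => (V ω).1) ⁻¹' s) * gaussianReal 0 (σ ^ 2) t := by
    intro s t hs ht
    have hA : MeasurableSet (Prod.fst ⁻¹' s ∩ fitResidual θopt ⁻¹' t) :=
      (measurable_fst hs).inter ((continuous_fitResidual θopt).measurable ht)
    have e1 : μ ((fun ω => (V ω).1) ⁻¹' s ∩ (fun ω => fitResidual θopt (V ω)) ⁻¹' t)
        = μ.map (fun ω => ((V ω).1, (V ω).2)) (Prod.fst ⁻¹' s ∩ fitResidual θopt ⁻¹' t) := by
      rw [Measure.map_apply (hZ.prodMk hY) hA]; rfl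
    rw [e1, ← compProd_map_condDistrib hY.aemeasurable, Measure.compProd_apply hA]
    have e2 : ∀ᵐ z ∂(μ.map fun ω => (V ω).1),
        condDistrib (fun ω => (V ω).2) (fun ω => (V ω).1) μ z
          (Prod.mk z ⁻¹' (Prod.fst ⁻¹' s ∩ fitResidual θopt ⁻¹' t))
        = s.indicator (fun _ => gaussianReal 0 (σ ^ 2) t) z := by
      filter_upwards [h] with z hz
      rw [hz]
      by_cases hzs : z ∈ s
      · rw [Set.indicator_of_mem hzs]
        have e3 := gaussianReal_map_sub_const (μ := inner ℝ z θopt) (v := σ ^ 2) (inner ℝ z θopt)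
        rw [sub_self] at e3
        rw [← e3, Measure.map_apply (by fun_prop) ht]
        congr 1
        ext y
        simp [hzs, fitResidual]
      · rw [Set.indicator_of_notMem hzs]
        have : Prod.mk z ⁻¹' (Prod.fst ⁻¹' s ∩ fitResidual θopt ⁻¹' t) = ∅ := by
          ext y; simp [hzs]
        rw [this, measure_empty]
    rw [lintegral_congr_ae e2, lintegral_indicator_const hs, Measure.map_apply hZ hs, mul_comm]
  have hlaw : μ.map (fun ω => fitResidual θopt (V ω)) = gaussianReal 0 (σ ^ 2) := by
    ext t ht
    rw [Measure.map_apply hε ht]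
    simpa using key Set.univ t MeasurableSet.univ ht
  refine ⟨hV, indepFun_iff_measure_inter_preimage_eq_mul.2 fun s t hs ht => ?_, hlaw⟩
  rw [key s t hs ht, ← hlaw, Measure.map_apply hε ht]

namespace GaussianNoise

lemma measurable_noise (h : GaussianNoise σ θopt V μ) :
    Measurable fun ω => fitResidual θopt (V ω) :=
  (continuous_fitResidual θopt).measurable.comp h.measurable

lemma memLp_noise (h : GaussianNoise σ θopt V μ) {p : ENNReal} (hp : p ≠ ⊤) :
    MemLp (fun ω => fitResidual θopt (V ω)) p μ := by
  have h1 := memLp_id_gaussianReal' (μ := 0) (v := σ ^ 2) p hp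
  rw [← h.map_eq] at h1
  exact (memLp_map_measure_iff (by fun_prop) h.measurable_noise.aemeasurable).1 h1

lemma hasGaussianLaw_noise (h : GaussianNoise σ θopt V μ) :
    HasGaussianLaw (fun ω => fitResidual θopt (V ω)) μ :=
  ⟨by rw [h.map_eq]; infer_instance⟩

lemma integral_noise (h : GaussianNoise σ θopt V μ) :
    ∫ ω, fitResidual θopt (V ω) ∂μ = 0 := by
  have := integral_map (μ := μ) (f := fun x : ℝ => x) h.measurable_noise.aemeasurable (by fun_prop)
  rw [← this, h.map_eq, integral_id_gaussianReal]

lemma integral_noise_sq (h : GaussianNoise σ θopt V μ) :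
    ∫ ω, fitResidual θopt (V ω) ^ 2 ∂μ = (σ : ℝ) ^ 2 := by
  have := integral_map (μ := μ) (f := fun x : ℝ => x ^ 2) h.measurable_noise.aemeasurable (by fun_prop)
  rw [← this, h.map_eq, ← variance_of_integral_eq_zero (by fun_prop) integral_id_gaussianReal,
    variance_fun_id_gaussianReal]
  simp

lemma integral_noise_pow_three (h : GaussianNoise σ θopt V μ) :
    ∫ ω, fitResidual θopt (V ω) ^ 3 ∂μ = 0 := by
  have := integral_map (μ := μ) (f := fun x : ℝ => x ^ 3) h.measurable_noise.aemeasurable (by fun_prop)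
  rw [← this, h.map_eq, (integral_pow_gaussianReal _).1]

lemma memLp_snd (h : GaussianNoise σ θopt V μ) {p : ENNReal} (hp : p ≠ ⊤)
    (hZ : MemLp (fun ω => (V ω).1) p μ) : MemLp (fun ω => (V ω).2) p μ := by
  convert (h.memLp_noise hp).add (hZ.inner_const (𝕜 := ℝ) θopt) using 1
  funext ω
  simp [fitResidual]

lemma integrable_noise_pow (h : GaussianNoise σ θopt V μ) (k : ℕ) [IsProbabilityMeasure μ] :
    Integrable (fun ω => fitResidual θopt (V ω) ^ k) μ := by
  rcases Nat.eq_zero_or_pos k with rfl | hk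
  · simp
  have h1 := (h.memLp_noise (p := k) (by simp)).integrable_norm_pow hk.ne'
  refine h1.mono (h.measurable_noise.pow_const k).aestronglyMeasurable (ae_of_all _ fun ω => ?_)
  simp

/-- Moments of the noise and the covariates factorise. -/
lemma integral_noise_pow_mul (h : GaussianNoise σ θopt V μ) (k : ℕ) [IsProbabilityMeasure μ]
    {f : EuclideanSpace ℝ (Fin d) → ℝ} (hf : Measurable f) (hi : Integrable (fun ω => f (V ω).1) μ) :
    Integrable (fun ω => fitResidual θopt (V ω) ^ k * f (V ω).1) μ ∧
    ∫ ω, fitResidual θopt (V ω) ^ k * f (V ω).1 ∂μ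
      = (∫ ω, fitResidual θopt (V ω) ^ k ∂μ) * ∫ ω, f (V ω).1 ∂μ := by
  have hind : IndepFun (fun ω => fitResidual θopt (V ω) ^ k) (fun ω => f (V ω).1) μ :=
    (h.indep.comp (φ := f) (ψ := fun x : ℝ => x ^ k) hf (by fun_prop)).symm
  exact ⟨hind.integrable_mul (h.integrable_noise_pow k) hi,
    hind.integral_fun_mul_eq_mul_integral (h.integrable_noise_pow k).aestronglyMeasurable
      hi.aestronglyMeasurable⟩

end GaussianNoise

end Noise

/-! ### Residual moments in the linear model. -/

section NoiseMoments

variable {Ω : Type*} [MeasurableSpace Ω] {μ : Measure Ω} {d : ℕ} {V : Ω → EuclideanSpace ℝ (Fin d) × ℝ} {θopt : EuclideanSpace ℝ (Fin d)}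
  {σ : ℝ≥0}

namespace GaussianNoise

lemma memLp_fitResidual (h : GaussianNoise σ θopt V μ) {p : ENNReal} (hp : p ≠ ⊤)
    (hZ : MemLp (fun ω => (V ω).1) p μ) (θ : EuclideanSpace ℝ (Fin d)) : MemLp (fun ω => fitResidual θ (V ω)) p μ :=
  _root_.memLp_fitResidual hZ (h.memLp_snd hp hZ) θ

variable [IsProbabilityMeasure μ]

/-- Mixed moments of a residual and a linear form in the covariates. -/
lemma integral_residual (h : GaussianNoise σ θopt V μ) (hZ : MemLp (fun ω => (V ω).1) 4 μ)
    (θ u : EuclideanSpace ℝ (Fin d)) :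
    ∫ ω, fitResidual θ (V ω) ^ 2 ∂μ = (σ : ℝ) ^ 2 + ∫ ω, inner ℝ (V ω).1 (θ - θopt) ^ 2 ∂μ ∧
    ∫ ω, fitResidual θ (V ω) * inner ℝ (V ω).1 u ∂μ
      = -∫ ω, inner ℝ (V ω).1 (θ - θopt) * inner ℝ (V ω).1 u ∂μ ∧
    ∫ ω, fitResidual θ (V ω) ^ 2 * (fitResidual θ (V ω) * inner ℝ (V ω).1 u) ∂μ
      = -(∫ ω, inner ℝ (V ω).1 (θ - θopt) ^ 3 * inner ℝ (V ω).1 u ∂μ)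
        - 3 * (σ : ℝ) ^ 2 * ∫ ω, inner ℝ (V ω).1 (θ - θopt) * inner ℝ (V ω).1 u ∂μ := by
  have h42 : (2 : ENNReal) ≤ 4 := by norm_num
  have Lp : MemLp (fun ω => inner ℝ (V ω).1 (θ - θopt)) 4 μ := memLp_inner_fst hZ _
  have Ls : MemLp (fun ω => inner ℝ (V ω).1 u) 4 μ := memLp_inner_fst hZ _
  have Lp2 := Lp.mono_exponent h42
  have Ls2 := Ls.mono_exponent h42
  have Lps : MemLp (fun ω => inner ℝ (V ω).1 (θ - θopt) * inner ℝ (V ω).1 u) 2 μ := Ls.mul' Lp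
  have Lpp := memLp_sq_of_four Lp
  have Ip := Lp2.integrable one_le_two
  have Is := Ls2.integrable one_le_two
  have Ips := Lps.integrable one_le_two
  have Ipp : Integrable (fun ω => inner ℝ (V ω).1 (θ - θopt) ^ 2) μ := Lpp.integrable one_le_two
  have Ipps : Integrable (fun ω => inner ℝ (V ω).1 (θ - θopt) ^ 2 * inner ℝ (V ω).1 u) μ :=
    integrable_mul_of_memLp_two Lpp Ls2
  have Ippps : Integrable (fun ω => inner ℝ (V ω).1 (θ - θopt) ^ 3 * inner ℝ (V ω).1 u) μ :=
    (integrable_mul_of_memLp_two Lpp Lps).congr (ae_of_all _ fun ω => by dsimp only; ring)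
  have e1 := h.integral_noise
  have e2 := h.integral_noise_sq
  have e3 := h.integral_noise_pow_three
  have hr : ∀ ω, fitResidual θ (V ω) = fitResidual θopt (V ω) - inner ℝ (V ω).1 (θ - θopt) :=
    fun ω => fitResidual_eq_sub θ θopt (V ω)
  refine ⟨?_, ?_, ?_⟩
  · obtain ⟨I, J⟩ := h.integral_noise_pow_mul 1
      (f := fun z => inner ℝ z (θ - θopt)) (by fun_prop) Ip
    simp only [pow_one] at I J
    rw [e1, zero_mul] at J
    have I2 := h.integrable_noise_pow 2
    have : ∀ ω, fitResidual θ (V ω) ^ 2 = fitResidual θopt (V ω) ^ 2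
        + inner ℝ (V ω).1 (θ - θopt) ^ 2
        - 2 * (fitResidual θopt (V ω) * inner ℝ (V ω).1 (θ - θopt)) := fun ω => by
      rw [hr]; ring
    simp only [this]
    rw [integral_sub (I2.fun_add Ipp) (I.const_mul 2), integral_add I2 Ipp, integral_const_mul, J,
      e2, mul_zero, sub_zero]
  · obtain ⟨I, J⟩ := h.integral_noise_pow_mul 1 (f := fun z => inner ℝ z u) (by fun_prop) Is
    simp only [pow_one] at I J
    rw [e1, zero_mul] at J
    simp only [hr, sub_mul]
    rw [integral_sub I Ips, J, zero_sub]
  · obtain ⟨I3, J3⟩ := h.integral_noise_pow_mul 3 (f := fun z => inner ℝ z u) (by fun_prop) Is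
    obtain ⟨I2, J2⟩ := h.integral_noise_pow_mul 2
      (f := fun z => inner ℝ z (θ - θopt) * inner ℝ z u) (by fun_prop) Ips
    obtain ⟨I1, J1⟩ := h.integral_noise_pow_mul 1
      (f := fun z => inner ℝ z (θ - θopt) ^ 2 * inner ℝ z u) (by fun_prop) Ipps
    simp only [pow_one] at I1 J1
    rw [e1, zero_mul] at J1
    rw [e2] at J2
    rw [e3, zero_mul] at J3
    have : ∀ ω, fitResidual θ (V ω) ^ 2 * (fitResidual θ (V ω) * inner ℝ (V ω).1 u)
        = fitResidual θopt (V ω) ^ 3 * inner ℝ (V ω).1 u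
        - 3 * (fitResidual θopt (V ω) ^ 2 * (inner ℝ (V ω).1 (θ - θopt) * inner ℝ (V ω).1 u))
        + 3 * (fitResidual θopt (V ω) * (inner ℝ (V ω).1 (θ - θopt) ^ 2 * inner ℝ (V ω).1 u))
        - inner ℝ (V ω).1 (θ - θopt) ^ 3 * inner ℝ (V ω).1 u := fun ω => by
      rw [hr]; ring
    simp only [this]
    have J : Integrable (fun ω => fitResidual θopt (V ω) ^ 3 * inner ℝ (V ω).1 u
        - 3 * (fitResidual θopt (V ω) ^ 2 * (inner ℝ (V ω).1 (θ - θopt) * inner ℝ (V ω).1 u))) μ :=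
      I3.sub (I2.const_mul 3)
    rw [integral_sub (J.fun_add (I1.const_mul 3)) Ippps, integral_add J (I1.const_mul 3),
      integral_sub I3 (I2.const_mul 3), integral_const_mul, integral_const_mul, J1, J2, J3]
    ring

/-- Put r = ε − p with p = ⟨Z, θ − θopt⟩. Odd noise moments vanish; E r³⟨Z, u⟩ contributes −3σ² and
the product of means gives +σ² back, hence the factor −2σ². -/
lemma covariance_residual_sq_score (h : GaussianNoise σ θopt V μ)
    (hZ : MemLp (fun ω => (V ω).1) 4 μ) (θ u : EuclideanSpace ℝ (Fin d)) :
    cov[fun ω => fitResidual θ (V ω) ^ 2, fun ω => inner ℝ u (score θ (V ω)); μ]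
      = -cov[fun ω => inner ℝ (inner ℝ (V ω).1 (θ - θopt) • (V ω).1) u,
          fun ω => inner ℝ (inner ℝ (V ω).1 (θ - θopt) • (V ω).1) (θ - θopt); μ]
        - 2 * (σ : ℝ) ^ 2 * ∫ ω, inner ℝ (V ω).1 u * inner ℝ (V ω).1 (θ - θopt) ∂μ := by
  obtain ⟨h1, h2, h3⟩ := h.integral_residual hZ θ u
  have Lr := h.memLp_fitResidual (by simp) hZ θ
  have Lp : MemLp (fun ω => inner ℝ (V ω).1 (θ - θopt)) 4 μ := memLp_inner_fst hZ _
  have Ls : MemLp (fun ω => inner ℝ (V ω).1 u) 4 μ := memLp_inner_fst hZ _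
  have Lps : MemLp (fun ω => inner ℝ (V ω).1 (θ - θopt) * inner ℝ (V ω).1 u) 2 μ := Ls.mul' Lp
  have Lpp : MemLp (fun ω => inner ℝ (V ω).1 (θ - θopt) * inner ℝ (V ω).1 (θ - θopt)) 2 μ :=
    Lp.mul' Lp
  have Lrs : MemLp (fun ω => fitResidual θ (V ω) * inner ℝ (V ω).1 u) 2 μ := Ls.mul' Lr
  have e0 : ∀ ω, inner ℝ u (score θ (V ω)) = fitResidual θ (V ω) * inner ℝ (V ω).1 u := fun ω => by
    rw [score, real_inner_smul_right, real_inner_comm]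
  simp only [e0, real_inner_smul_left]
  rw [covariance_eq_sub (memLp_sq_of_four Lr) Lrs, covariance_eq_sub Lps Lpp]
  simp only [Pi.mul_apply]
  rw [h1, h2, h3]
  have e1 : ∀ ω, inner ℝ (V ω).1 (θ - θopt) * inner ℝ (V ω).1 u
      * inner ℝ (V ω).1 (θ - θopt) ^ 2
      = inner ℝ (V ω).1 (θ - θopt) ^ 3 * inner ℝ (V ω).1 u := fun ω => by ring
  have e2 : ∀ ω, inner ℝ (V ω).1 (θ - θopt) * inner ℝ (V ω).1 (θ - θopt)
      = inner ℝ (V ω).1 (θ - θopt) ^ 2 := fun ω => by ring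
  have e3 : ∀ ω, inner ℝ (V ω).1 u * inner ℝ (V ω).1 (θ - θopt)
      = inner ℝ (V ω).1 (θ - θopt) * inner ℝ (V ω).1 u := fun ω => by ring
  simp only [e1, e2, e3]
  ring

/-- Linear forms in the noise and the covariates have the kurtosis of a normal distribution. -/
lemma integral_pow_four (h : GaussianNoise σ θopt V μ)
    (hG : HasGaussianLaw (fun ω => (V ω).1) μ) (h0 : ∫ ω, (V ω).1 ∂μ = 0) (a : ℝ) (u : EuclideanSpace ℝ (Fin d)) :
    ∫ ω, (a * fitResidual θopt (V ω) + inner ℝ u (V ω).1) ^ 4 ∂μ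
      = 3 * (∫ ω, (a * fitResidual θopt (V ω) + inner ℝ u (V ω).1) ^ 2 ∂μ) ^ 2 := by
  have h1 := IndepFun.hasGaussianLaw hG h.hasGaussianLaw_noise h.indep
  have h2 : HasGaussianLaw (fun ω => a * fitResidual θopt (V ω) + inner ℝ u (V ω).1) μ :=
    h1.map_fun (a • ContinuousLinearMap.snd ℝ (EuclideanSpace ℝ (Fin d)) ℝ + (innerSL ℝ u) ∘L ContinuousLinearMap.fst ℝ (EuclideanSpace ℝ (Fin d)) ℝ)
  refine h2.integral_pow_four ?_
  rw [integral_add (h.hasGaussianLaw_noise.integrable.const_mul a)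
    (hG.integrable.const_inner u), integral_const_mul, h.integral_noise,
    integral_inner hG.integrable, h0, inner_zero_right, mul_zero, add_zero]

lemma integral_residual_pow_four (h : GaussianNoise σ θopt V μ)
    (hG : HasGaussianLaw (fun ω => (V ω).1) μ) (h0 : ∫ ω, (V ω).1 ∂μ = 0) (θ : EuclideanSpace ℝ (Fin d)) :
    ∫ ω, fitResidual θ (V ω) ^ 4 ∂μ = 3 * (∫ ω, fitResidual θ (V ω) ^ 2 ∂μ) ^ 2 := by
  have := h.integral_pow_four hG h0 1 (-(θ - θopt))
  have e : ∀ ω, 1 * fitResidual θopt (V ω) + inner ℝ (-(θ - θopt)) (V ω).1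
      = fitResidual θ (V ω) := fun ω => by
    rw [fitResidual_eq_sub θ θopt, inner_neg_left, real_inner_comm]; ring
  simpa only [e] using this

lemma integral_residual_sq_mul_residual (h : GaussianNoise σ θopt V μ)
    (hG : HasGaussianLaw (fun ω => (V ω).1) μ) (h0 : ∫ ω, (V ω).1 ∂μ = 0) (θ u : EuclideanSpace ℝ (Fin d)) :
    ∫ ω, fitResidual θ (V ω) ^ 2 * (fitResidual θ (V ω) * inner ℝ (V ω).1 u) ∂μ
      = 3 * (∫ ω, fitResidual θ (V ω) ^ 2 ∂μ)
        * ∫ ω, fitResidual θ (V ω) * inner ℝ (V ω).1 u ∂μ := by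
  have hZ : MemLp (fun ω => (V ω).1) 4 μ := hG.memLp (by simp)
  have Lr := h.memLp_fitResidual (by simp) hZ θ
  have := integral_sq_mul_mul_of_pow_four Lr Lr (memLp_inner_fst hZ u) fun a b c => by
    -- The residual is the noise minus a linear form in Z, so any combination of residuals and
    -- linear forms has the normal shape required here.
    have := h.integral_pow_four hG h0 (a + b) (c • u - (a + b) • (θ - θopt))
    have e : ∀ ω, (a + b) * fitResidual θopt (V ω)
        + inner ℝ (c • u - (a + b) • (θ - θopt)) (V ω).1
        = a * fitResidual θ (V ω) + (b * fitResidual θ (V ω) + c * inner ℝ (V ω).1 u) :=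
      fun ω => by
        rw [fitResidual_eq_sub θ θopt, inner_sub_left, real_inner_smul_left, real_inner_smul_left,
          real_inner_comm, real_inner_comm (V ω).1 (θ - θopt)]
        ring
    simpa only [e] using this
  rw [this]
  simp only [← pow_two]
  ring

lemma integral_residual_sq_mul_inner (h : GaussianNoise σ θopt V μ)
    (hG : HasGaussianLaw (fun ω => (V ω).1) μ) (h0 : ∫ ω, (V ω).1 ∂μ = 0) (θ u v : EuclideanSpace ℝ (Fin d)) :
    ∫ ω, fitResidual θ (V ω) ^ 2 * (inner ℝ (V ω).1 u * inner ℝ (V ω).1 v) ∂μ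
      = (∫ ω, fitResidual θ (V ω) ^ 2 ∂μ) * (∫ ω, inner ℝ (V ω).1 u * inner ℝ (V ω).1 v ∂μ)
        + 2 * (∫ ω, fitResidual θ (V ω) * inner ℝ (V ω).1 u ∂μ)
          * ∫ ω, fitResidual θ (V ω) * inner ℝ (V ω).1 v ∂μ := by
  have hZ : MemLp (fun ω => (V ω).1) 4 μ := hG.memLp (by simp)
  have Lr := h.memLp_fitResidual (by simp) hZ θ
  exact integral_sq_mul_mul_of_pow_four Lr (memLp_inner_fst hZ u) (memLp_inner_fst hZ v)
    fun a b c => by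
    have := h.integral_pow_four hG h0 a (b • u + c • v - a • (θ - θopt))
    have e : ∀ ω, a * fitResidual θopt (V ω)
        + inner ℝ (b • u + c • v - a • (θ - θopt)) (V ω).1
        = a * fitResidual θ (V ω) + (b * inner ℝ (V ω).1 u + c * inner ℝ (V ω).1 v) :=
      fun ω => by
        rw [fitResidual_eq_sub θ θopt, inner_sub_left, inner_add_left, real_inner_smul_left,
          real_inner_smul_left, real_inner_smul_left,
          real_inner_comm, real_inner_comm (V ω).1 (θ - θopt), real_inner_comm (V ω).1 v]
        ring
    simpa only [e] using this

lemma variance_residual_sq (h : GaussianNoise σ θopt V μ)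
    (hG : HasGaussianLaw (fun ω => (V ω).1) μ) (h0 : ∫ ω, (V ω).1 ∂μ = 0) (θ : EuclideanSpace ℝ (Fin d)) :
    Var[fun ω => fitResidual θ (V ω) ^ 2; μ] = 2 * (∫ ω, fitResidual θ (V ω) ^ 2 ∂μ) ^ 2 := by
  have hZ : MemLp (fun ω => (V ω).1) 4 μ := hG.memLp (by simp)
  have Lr := h.memLp_fitResidual (by simp) hZ θ
  rw [variance_eq_sub (memLp_sq_of_four Lr)]
  simp only [Pi.pow_apply, ← pow_mul]
  rw [h.integral_residual_pow_four hG h0]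
  ring

lemma covariance_residual_sq_score_of_gaussian (h : GaussianNoise σ θopt V μ)
    (hG : HasGaussianLaw (fun ω => (V ω).1) μ) (h0 : ∫ ω, (V ω).1 ∂μ = 0) (θ u : EuclideanSpace ℝ (Fin d)) :
    cov[fun ω => fitResidual θ (V ω) ^ 2, fun ω => inner ℝ u (score θ (V ω)); μ]
      = 2 * (∫ ω, fitResidual θ (V ω) ^ 2 ∂μ)
        * ∫ ω, fitResidual θ (V ω) * inner ℝ (V ω).1 u ∂μ := by
  have hZ : MemLp (fun ω => (V ω).1) 4 μ := hG.memLp (by simp)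
  have Lr := h.memLp_fitResidual (by simp) hZ θ
  have Ls : MemLp (fun ω => inner ℝ (V ω).1 u) 4 μ := memLp_inner_fst hZ _
  have Lrs : MemLp (fun ω => fitResidual θ (V ω) * inner ℝ (V ω).1 u) 2 μ := Ls.mul' Lr
  have e : ∀ ω, inner ℝ u (score θ (V ω)) = fitResidual θ (V ω) * inner ℝ (V ω).1 u := fun ω => by
    rw [score, real_inner_smul_right, real_inner_comm]
  simp only [e]
  rw [covariance_eq_sub (memLp_sq_of_four Lr) Lrs]
  simp only [Pi.mul_apply]
  rw [h.integral_residual_sq_mul_residual hG h0]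
  ring

lemma covariance_score (h : GaussianNoise σ θopt V μ)
    (hG : HasGaussianLaw (fun ω => (V ω).1) μ) (h0 : ∫ ω, (V ω).1 ∂μ = 0) (θ u v : EuclideanSpace ℝ (Fin d)) :
    cov[fun ω => inner ℝ u (score θ (V ω)), fun ω => inner ℝ v (score θ (V ω)); μ]
      = (∫ ω, fitResidual θ (V ω) ^ 2 ∂μ) * (∫ ω, inner ℝ (V ω).1 u * inner ℝ (V ω).1 v ∂μ)
        + (∫ ω, fitResidual θ (V ω) * inner ℝ (V ω).1 u ∂μ)
          * ∫ ω, fitResidual θ (V ω) * inner ℝ (V ω).1 v ∂μ := by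
  have hZ : MemLp (fun ω => (V ω).1) 4 μ := hG.memLp (by simp)
  have Lr := h.memLp_fitResidual (by simp) hZ θ
  have L : ∀ u : EuclideanSpace ℝ (Fin d), MemLp (fun ω => fitResidual θ (V ω) * inner ℝ (V ω).1 u) 2 μ := fun u =>
    (memLp_inner_fst hZ u).mul' Lr
  have e : ∀ (u : EuclideanSpace ℝ (Fin d)) ω, inner ℝ u (score θ (V ω)) = fitResidual θ (V ω) * inner ℝ (V ω).1 u :=
    fun u ω => by rw [score, real_inner_smul_right, real_inner_comm]
  simp only [e]
  rw [covariance_eq_sub (L u) (L v)]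
  have e2 : ∀ ω, ((fun ω => fitResidual θ (V ω) * inner ℝ (V ω).1 u)
      * fun ω => fitResidual θ (V ω) * inner ℝ (V ω).1 v) ω
      = fitResidual θ (V ω) ^ 2 * (inner ℝ (V ω).1 u * inner ℝ (V ω).1 v) := fun ω => by
    simp only [Pi.mul_apply]; ring
  simp only [e2]
  rw [h.integral_residual_sq_mul_inner hG h0]
  ring

end GaussianNoise

end NoiseMoments

/-! ### Matrices as bilinear moments, the resolvent, and the gradient. -/

section MomentMatrices

variable {Ω : Type*} [MeasurableSpace Ω] {μ : Measure Ω} {d : ℕ} {W : Ω → EuclideanSpace ℝ (Fin d)}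

lemma inner_eq_sum (u v : EuclideanSpace ℝ (Fin d)) : inner ℝ u v = ∑ i, u i * v i := by
  rw [EuclideanSpace.inner_eq_star_dotProduct, dotProduct]
  exact Finset.sum_congr rfl fun i _ => by simp [mul_comm]

lemma dotProduct_mulVec_eq_sum (A : Matrix (Fin d) (Fin d) ℝ) (u v : Fin d → ℝ) :
    v ⬝ᵥ A.mulVec u = ∑ i, ∑ j, v i * u j * A i j := by
  simp only [dotProduct, Matrix.mulVec, Finset.mul_sum]
  exact Finset.sum_congr rfl fun i _ => Finset.sum_congr rfl fun j _ => by ring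

lemma inner_toEuclideanCLM (A : Matrix (Fin d) (Fin d) ℝ) (u v : EuclideanSpace ℝ (Fin d)) :
    inner ℝ (Matrix.toEuclideanCLM (𝕜 := ℝ) A u) v = v.ofLp ⬝ᵥ A.mulVec u.ofLp := by
  rw [EuclideanSpace.inner_eq_star_dotProduct, Matrix.ofLp_toEuclideanCLM]
  simp

lemma dotProduct_secondMomentMatrix (hW : MemLp W 2 μ) (u v : EuclideanSpace ℝ (Fin d)) :
    v.ofLp ⬝ᵥ (secondMomentMatrix W μ).mulVec u.ofLp
      = ∫ ω, inner ℝ (W ω) u * inner ℝ (W ω) v ∂μ := by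
  have I : ∀ i j, Integrable (fun ω => v i * u j * (W ω i * W ω j)) μ := fun i j =>
    (integrable_mul_of_memLp_two (memLp_coord hW i) (memLp_coord hW j)).const_mul _
  have e : ∀ ω, inner ℝ (W ω) u * inner ℝ (W ω) v
      = ∑ i, ∑ j, v i * u j * (W ω i * W ω j) := fun ω => by
    rw [mul_comm, inner_eq_sum, inner_eq_sum, Finset.sum_mul_sum]
    exact Finset.sum_congr rfl fun i _ => Finset.sum_congr rfl fun j _ => by ring
  simp only [e]
  rw [integral_finsetSum _ fun i _ => integrable_finsetSum _ fun j _ => I i j,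
    dotProduct_mulVec_eq_sum]
  refine Finset.sum_congr rfl fun i _ => ?_
  rw [integral_finsetSum _ fun j _ => I i j]
  refine Finset.sum_congr rfl fun j _ => ?_
  rw [integral_const_mul]
  rfl

lemma dotProduct_covMatrix [IsFiniteMeasure μ] (hW : MemLp W 2 μ) (u v : EuclideanSpace ℝ (Fin d)) :
    v.ofLp ⬝ᵥ (covMatrix W μ).mulVec u.ofLp
      = cov[fun ω => inner ℝ (W ω) v, fun ω => inner ℝ (W ω) u; μ] := by
  simp only [inner_eq_sum]
  rw [covariance_fun_sum_fun_sum (fun i => (memLp_coord hW i).mul_const _)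
    (fun j => (memLp_coord hW j).mul_const _), dotProduct_mulVec_eq_sum]
  refine Finset.sum_congr rfl fun i _ => Finset.sum_congr rfl fun j _ => ?_
  rw [covariance_mul_const_left, covariance_mul_const_right, covMatrix, Matrix.of_apply]
  ring

lemma covMatrix_eq_secondMomentMatrix [IsProbabilityMeasure μ] (hW : MemLp W 2 μ)
    (h0 : ∫ ω, W ω ∂μ = 0) : covMatrix W μ = secondMomentMatrix W μ := by
  have h1 : ∀ i, ∫ ω, W ω i ∂μ = 0 := fun i => by
    have := integral_inner (𝕜 := ℝ) (hW.integrable one_le_two) (EuclideanSpace.single i 1)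
    rw [h0, inner_zero_right] at this
    simpa only [coord_eq_inner, real_inner_comm] using this
  ext i j
  rw [covMatrix, secondMomentMatrix, Matrix.of_apply, Matrix.of_apply,
    covariance_eq_sub (memLp_coord hW i) (memLp_coord hW j), h1, zero_mul, sub_zero]
  rfl

lemma secondMomentMatrix_transpose : (secondMomentMatrix W μ).transpose = secondMomentMatrix W μ := by
  ext i j
  simp only [secondMomentMatrix, Matrix.transpose_apply, Matrix.of_apply]
  exact integral_congr_ae (ae_of_all _ fun ω => mul_comm _ _)

variable {M : Matrix (Fin d) (Fin d) ℝ} {lam : ℝ}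

/-- A kernel vector v would satisfy 0 = ⟨v, Mv⟩ + λ‖v‖², impossible for v ≠ 0; M itself may be
singular. -/
lemma isUnit_det_add_smul (hM : ∀ v : EuclideanSpace ℝ (Fin d), 0 ≤ v.ofLp ⬝ᵥ M.mulVec v.ofLp) (hlam : 0 < lam) :
    IsUnit (M + lam • (1 : Matrix (Fin d) (Fin d) ℝ)).det := by
  refine isUnit_iff_ne_zero.2 fun h => ?_
  obtain ⟨v, hv, hMv⟩ := Matrix.exists_mulVec_eq_zero_iff.2 h
  have h1 : v ⬝ᵥ (M + lam • (1 : Matrix (Fin d) (Fin d) ℝ)).mulVec v = 0 := by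
    rw [hMv, dotProduct_zero]
  rw [Matrix.add_mulVec, Matrix.smul_mulVec, Matrix.one_mulVec, dotProduct_add,
    dotProduct_smul, smul_eq_mul] at h1
  have h2 := hM (WithLp.toLp 2 v)
  have h3 : 0 < v ⬝ᵥ v :=
    lt_of_le_of_ne (Finset.sum_nonneg fun i _ => mul_self_nonneg _)
      fun h => hv (dotProduct_self_eq_zero.1 h.symm)
  have := mul_pos hlam h3
  simp only at h2
  linarith

/-- A quadratic form with the resolvent of a symmetric matrix on the left. -/
lemma dotProduct_mul_inv_mul_mulVec (hM : M.transpose = M) (N : Matrix (Fin d) (Fin d) ℝ)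
    (x y : Fin d → ℝ) :
    x ⬝ᵥ (M * (M + lam • (1 : Matrix (Fin d) (Fin d) ℝ))⁻¹ * N).mulVec y
      = (M + lam • (1 : Matrix (Fin d) (Fin d) ℝ))⁻¹.mulVec (M.mulVec x) ⬝ᵥ N.mulVec y := by
  have hA : (M + lam • (1 : Matrix (Fin d) (Fin d) ℝ))⁻¹.transpose
      = (M + lam • (1 : Matrix (Fin d) (Fin d) ℝ))⁻¹ := by
    rw [Matrix.transpose_nonsing_inv, Matrix.transpose_add, Matrix.transpose_smul,
      Matrix.transpose_one, hM]
  rw [← Matrix.mulVec_mulVec, Matrix.dotProduct_mulVec, ← Matrix.mulVec_transpose,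
    Matrix.transpose_mul, hA, hM, Matrix.mulVec_mulVec]

lemma gradient_ridgeLoss (x : EuclideanSpace ℝ (Fin d) × ℝ) (θ : EuclideanSpace ℝ (Fin d)) :
    gradient (ridgeLoss lam x) θ = (-2 : ℝ) • score θ x + (2 * lam) • θ := by
  refine HasGradientAt.gradient (hasGradientAt_iff_hasFDerivAt.2 ?_)
  have h1 : HasFDerivAt (fun θ : EuclideanSpace ℝ (Fin d) => x.2 - inner ℝ x.1 θ) (-(innerSL ℝ x.1)) θ :=
    ((innerSL ℝ x.1).hasFDerivAt).const_sub x.2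
  have h2 := ((h1.pow 2).add ((hasStrictFDerivAt_norm_sq θ).hasFDerivAt.const_mul lam))
  refine h2.congr_fderiv ?_
  ext v
  simp [score, fitResidual]
  ring

end MomentMatrices

/-! ### First order condition and construction of the model data. -/

section RidgeModelConstruction

variable {Ω : Type*} [MeasurableSpace Ω] {μ : Measure Ω} [IsProbabilityMeasure μ] {d : ℕ}
  {lam : ℝ} {X : ℕ → Ω → EuclideanSpace ℝ (Fin d) × ℝ} {X' Xt : Ω → EuclideanSpace ℝ (Fin d) × ℝ} {θopt : EuclideanSpace ℝ (Fin d)} {σ : ℝ≥0}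

/-- The first order condition for the population minimiser. -/
lemma integral_fitResidual_ridgeTarget (hlam : 0 < lam) {V : Ω → EuclideanSpace ℝ (Fin d) × ℝ}
    (hZ : MemLp (fun ω => (V ω).1) 4 μ) (hY : MemLp (fun ω => (V ω).2) 4 μ) (u : EuclideanSpace ℝ (Fin d)) :
    ∫ ω, fitResidual (ridgeTarget lam V μ) (V ω) * inner ℝ (V ω).1 u ∂μ
      = lam * inner ℝ (ridgeTarget lam V μ) u := by
  have h42 : (2 : ENNReal) ≤ 4 := by norm_num
  have hZ2 := hZ.mono_exponent h42
  have hY2 := hY.mono_exponent h42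
  set M := Matrix.toEuclideanCLM (𝕜 := ℝ) (secondMomentMatrix (fun ω => (V ω).1) μ) with hMdef
  have hM : ∀ u v, inner ℝ (M u) v = ∫ ω, inner ℝ (V ω).1 u * inner ℝ (V ω).1 v ∂μ :=
    fun u v => by rw [hMdef, inner_toEuclideanCLM, dotProduct_secondMomentMatrix hZ2]
  have Ib : Integrable (fun ω => (V ω).2 • (V ω).1) μ := (hZ2.smul hY2 (r := 1)).integrable le_rfl
  have hb : ∀ v, inner ℝ (∫ ω, (V ω).2 • (V ω).1 ∂μ) v
      = ∫ ω, (V ω).2 * inner ℝ (V ω).1 v ∂μ := fun v => by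
    rw [real_inner_comm, ← integral_inner Ib]
    refine integral_congr_ae (ae_of_all _ fun ω => ?_)
    dsimp only
    rw [real_inner_smul_right, real_inner_comm]
  have IZ : ∀ v v' : EuclideanSpace ℝ (Fin d), Integrable (fun ω => inner ℝ (V ω).1 v * inner ℝ (V ω).1 v') μ :=
    fun v v' => integrable_mul_of_memLp_two (memLp_inner_fst hZ2 v) (memLp_inner_fst hZ2 v')
  have IY : ∀ v : EuclideanSpace ℝ (Fin d), Integrable (fun ω => (V ω).2 * inner ℝ (V ω).1 v) μ :=
    fun v => integrable_mul_of_memLp_two hY2 (memLp_inner_fst hZ2 v)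
  -- The population objective is the penalised quadratic with linear coefficient E[YZ] and constant
  -- E[Y²].
  have key := argmin_quadratic M (fun u v => by rw [hM, hM]; simp only [mul_comm])
    (fun v => by rw [hM]; exact integral_nonneg fun ω => mul_self_nonneg _) hlam
    (∫ ω, (V ω).2 • (V ω).1 ∂μ) (∫ ω, (V ω).2 ^ 2 ∂μ)
    (fun θ => (∫ ω, sqLoss (V ω) θ ∂μ) + lam * ‖θ‖ ^ 2) fun θ => by
      have J : Integrable (fun ω => (V ω).2 ^ 2 - 2 * ((V ω).2 * inner ℝ (V ω).1 θ)) μ :=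
        hY2.integrable_sq.sub ((IY θ).const_mul 2)
      rw [hb, hM, ← integral_const_mul, ← integral_sub hY2.integrable_sq ((IY θ).const_mul 2),
        ← integral_add J (IZ θ θ)]
      congr 1
      refine integral_congr_ae (ae_of_all _ fun ω => ?_)
      simp only [sqLoss]
      ring
  change M (ridgeTarget lam V μ) + lam • ridgeTarget lam V μ = _ at key
  have h1 := congrArg (fun v => inner ℝ v u) key
  simp only [inner_add_left, real_inner_smul_left] at h1
  rw [hb, hM] at h1
  simp only [fitResidual, sub_mul]
  rw [integral_sub (IY u) (IZ _ u)]
  linarith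

/-- The linearisation data of ridge regression in a linear model with normal noise. -/
lemma GaussianNoise.ridgeModel (hX : IIDWithCopies X X' Xt μ) (hlam : 0 < lam)
    (hN : GaussianNoise σ θopt (X 0) μ) (hZ : MemLp (fun ω => (X 0 ω).1) 4 μ)
    {M : Matrix (Fin d) (Fin d) ℝ} (hM : M = secondMomentMatrix (fun ω => (X 0 ω).1) μ)
    {w : EuclideanSpace ℝ (Fin d)} (hw : M.mulVec w.ofLp + lam • w.ofLp = M.mulVec (ridgeTarget lam (X 0) μ - θopt).ofLp) :
    RidgeModel lam X X' Xt μ (Matrix.toEuclideanCLM (𝕜 := ℝ) M) (ridgeTarget lam (X 0) μ) w := by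
  have hY := hN.memLp_snd (by simp) hZ
  have hZ2 := hZ.mono_exponent (by norm_num : (2 : ENNReal) ≤ 4)
  have hop : ∀ u v, inner ℝ (Matrix.toEuclideanCLM (𝕜 := ℝ) M u) v
      = ∫ ω, inner ℝ (X 0 ω).1 u * inner ℝ (X 0 ω).1 v ∂μ := fun u v => by
    rw [inner_toEuclideanCLM, hM, dotProduct_secondMomentMatrix hZ2]
  have hscore := integral_fitResidual_ridgeTarget hlam hZ hY
  refine ⟨hX, hlam, hZ, hY, hop, hscore, ?_⟩
  -- The direction is given through MΔ, whereas the expansion wants −λθ; the two agree because the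
  -- mean score is λθ by optimality and −MΔ by the linear model.
  have h1 : Matrix.toEuclideanCLM (𝕜 := ℝ) M w + lam • w
      = Matrix.toEuclideanCLM (𝕜 := ℝ) M (ridgeTarget lam (X 0) μ - θopt) := by
    refine (WithLp.ofLp_injective 2) ?_
    rw [WithLp.ofLp_add, WithLp.ofLp_smul, Matrix.ofLp_toEuclideanCLM, Matrix.ofLp_toEuclideanCLM,
      hw]
  rw [h1]
  refine ext_inner_right ℝ fun u => ?_
  rw [hop, inner_neg_left, real_inner_smul_left, ← hscore u,
    (hN.integral_residual hZ (ridgeTarget lam (X 0) μ) u).2.1, neg_neg]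

end RidgeModelConstruction

/-! ### Inequalities for the speed-up. -/

section Speedup

variable {v a q D σ2 : ℝ}

/-- The total asymptotic variance is positive. -/
lemma asymptoticVariance_pos (hv : v = D + σ2) (hσ : 0 < σ2) (hD : 0 ≤ D)
    (hQ : 0 ≤ D - 4 * a + 4 * q) :
    0 < 2 * v ^ 2 + 4 * (v * q + a ^ 2) + 2 * (-4 * v * a) := by
  have hv0 : 0 < v := by linarith
  -- The total equals v(v − 4a + 4q) + (v − 2a)², and v − 4a + 4q is at least σ² by `hQ`.
  have h1 : 0 < v * (v - 4 * a + 4 * q) := mul_pos hv0 (by linarith)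
  nlinarith [sq_nonneg (v - 2 * a)]

lemma lt_mul_inv_speedup {K s ρ : ℝ} (hK : 0 < K) (hs : 0 < s + 2 * ρ) (hρ : ρ < 0) :
    K < K * (1 + 2 * ρ / s)⁻¹ := by
  have hs0 : 0 < s := by linarith
  have h1 : 1 + 2 * ρ / s = (s + 2 * ρ) / s := by field_simp
  rw [h1, inv_div, lt_mul_iff_one_lt_right hK, one_lt_div hs]
  linarith

/-- The loss of the train-test split compared to cross-validation. -/
lemma lt_split_div_cv {K : ℝ} (hK : 2 ≤ K) (hv : 0 < v) (ha : 0 < a) (hq : q ≤ a) (hav : a ≤ v)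
    (hpos : 0 < 2 * v ^ 2 + 4 * (v * q + a ^ 2) + 2 * (-4 * v * a)) :
    K < K * (2 * v ^ 2 + (K - 1)⁻¹ * (4 * (v * q + a ^ 2)))
      / (2 * v ^ 2 + 4 * (v * q + a ^ 2) + 2 * (-4 * v * a)) := by
  have hK0 : 0 < K := by linarith
  have hi0 : 0 < (K - 1)⁻¹ := inv_pos.2 (by linarith)
  have hi1 : (K - 1)⁻¹ ≤ 1 := inv_le_one_of_one_le₀ (by linarith)
  rw [lt_div_iff₀ hpos]
  refine mul_lt_mul_of_pos_left ?_ hK0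
  -- Thus (1 − 1/(K − 1)) times σ₂² is at most (1 − 1/(K − 1))·2|ρ|, strictly less than 2|ρ|; this
  -- also covers K = 2, where the factor vanishes.
  have h1 : v * q + a ^ 2 ≤ 2 * (v * a) := by
    have := mul_le_mul_of_nonneg_left hq hv.le
    have := mul_le_mul_of_nonneg_right hav ha.le
    nlinarith
  have h2 := mul_le_mul_of_nonneg_left h1 (sub_nonneg.2 hi1)
  have h3 := mul_pos hi0 (mul_pos hv ha)
  nlinarith

end Speedup

/-! ### Covariance of the loss gradient for Gaussian covariates. -/

section CenteredGaussian

variable {Ω : Type*} [MeasurableSpace Ω] {μ : Measure Ω} [IsProbabilityMeasure μ] {d : ℕ}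
  {lam : ℝ} {V : Ω → EuclideanSpace ℝ (Fin d) × ℝ} {θopt : EuclideanSpace ℝ (Fin d)} {σ : ℝ≥0}

/-- The covariance matrix of the gradient of the ridge loss. -/
lemma GaussianNoise.covMatrix_gradient (hN : GaussianNoise σ θopt V μ)
    (hG : HasGaussianLaw (fun ω => (V ω).1) μ) (h0 : ∫ ω, (V ω).1 ∂μ = 0) (θ : EuclideanSpace ℝ (Fin d))
    {S : Matrix (Fin d) (Fin d) ℝ} (hS : S = secondMomentMatrix (fun ω => (V ω).1) μ) :
    covMatrix (fun ω => gradient (ridgeLoss lam (V ω)) θ) μ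
      = (4 : ℝ) • ((∫ ω, fitResidual θ (V ω) ^ 2 ∂μ) • S
        + Matrix.vecMulVec (S.mulVec (θ - θopt).ofLp) (S.mulVec (θ - θopt).ofLp)) := by
  have hZ : MemLp (fun ω => (V ω).1) 4 μ := hG.memLp (by simp)
  have hZ2 : MemLp (fun ω => (V ω).1) 2 μ := hG.memLp (by simp)
  have Ls : MemLp (fun ω => score θ (V ω)) 2 μ :=
    memLp_score hZ (hN.memLp_snd (by simp) hZ) θ
  have h1 : ∀ i, ∫ ω, fitResidual θ (V ω) * inner ℝ (V ω).1 (EuclideanSpace.single i 1) ∂μ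
      = -(S.mulVec (θ - θopt).ofLp i) := fun i => by
    rw [(hN.integral_residual hZ θ _).2.1, ← dotProduct_secondMomentMatrix hZ2, ← hS]
    simp
  ext i j
  have h2 := hN.covariance_score hG h0 θ (EuclideanSpace.single i 1) (EuclideanSpace.single j 1)
  have Lc : ∀ i, MemLp (fun ω => score θ (V ω) i) 2 μ := memLp_coord Ls
  rw [h1, h1] at h2
  simp only [real_inner_comm _ (EuclideanSpace.single _ (1 : ℝ)), ← coord_eq_inner] at h2
  rw [covMatrix, Matrix.of_apply]
  simp only [gradient_ridgeLoss, PiLp.add_apply, PiLp.smul_apply, smul_eq_mul]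
  rw [covariance_add_const_left (((Lc i).const_mul (-2)).integrable one_le_two),
    covariance_add_const_right (((Lc j).const_mul (-2)).integrable one_le_two),
    covariance_const_mul_left, covariance_const_mul_right, h2, hS]
  simp only [Matrix.smul_apply, Matrix.add_apply, Matrix.vecMulVec_apply, smul_eq_mul,
    secondMomentMatrix, Matrix.of_apply]
  ring

end CenteredGaussian
-- The main theorem.
theorem mainTheorem10 {Ω : Type*} [MeasurableSpace Ω] (μ : Measure Ω) [IsProbabilityMeasure μ]
    (d : ℕ) (lam : ℝ) (hlam : 0 < lam) (σ : ℝ≥0) (θopt : EuclideanSpace ℝ (Fin d))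
    (X : ℕ → Ω → EuclideanSpace ℝ (Fin d) × ℝ) (X' Xt : Ω → EuclideanSpace ℝ (Fin d) × ℝ)
    (hX : IIDWithCopies X X' Xt μ)
    (hmoment : MemLp (fun ω => (X 0 ω).1) 4 μ)
    (hnoise : ∀ᵐ z ∂(μ.map fun ω => (X 0 ω).1),
      condDistrib (fun ω => (X 0 ω).2) (fun ω => (X 0 ω).1) μ z
        = gaussianReal (inner ℝ z θopt) (σ ^ 2))
    (θstar Δ : EuclideanSpace ℝ (Fin d)) (hθstar : θstar = ridgeTarget lam (X 0) μ)
    (hΔ : Δ = θstar - θopt)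
    (M S T Sigma : Matrix (Fin d) (Fin d) ℝ)
    (hM : M = secondMomentMatrix (fun ω => (X 0 ω).1) μ)
    (hS : S = covMatrix (fun ω => (X 0 ω).1) μ)
    (hT : T = covMatrix (fun ω => (inner ℝ (X 0 ω).1 Δ : ℝ) • (X 0 ω).1) μ)
    (hSigma : Sigma = covMatrix (fun ω => gradient (ridgeLoss lam (X 0 ω)) θstar) μ) :
    -- general covariates
    IsRho (ridgeEstimator lam) sqLoss X X' Xt μ
      (-2 * (Δ.ofLp ⬝ᵥ
        (M * (M + lam • 1)⁻¹ * (T + (2 * (σ : ℝ) ^ 2) • M)).mulVec Δ.ofLp)) ∧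
    -- centred covariates
    ((∫ ω, (X 0 ω).1 ∂μ) = 0 →
      IsRho (ridgeEstimator lam) sqLoss X X' Xt μ
        (-2 * (Δ.ofLp ⬝ᵥ
          (S * (S + lam • 1)⁻¹ * (T + (2 * (σ : ℝ) ^ 2) • S)).mulVec Δ.ofLp))) ∧
    -- centred Gaussian covariates
    (HasGaussianLaw (fun ω => (X 0 ω).1) μ → (∫ ω, (X 0 ω).1 ∂μ) = 0 →
      ∃ σ1sq σ2sq ρ : ℝ,
        IsSigmaOneSq (ridgeEstimator lam) sqLoss X Xt μ σ1sq ∧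
        IsSigmaTwoSq (ridgeEstimator lam) sqLoss X Xt μ σ2sq ∧
        IsRho (ridgeEstimator lam) sqLoss X X' Xt μ ρ ∧
        σ1sq = 2 * (Δ.ofLp ⬝ᵥ S.mulVec Δ.ofLp + (σ : ℝ) ^ 2) ^ 2 ∧
        Sigma = (4 : ℝ) • ((Δ.ofLp ⬝ᵥ S.mulVec Δ.ofLp + (σ : ℝ) ^ 2) • S
          + Matrix.vecMulVec (S.mulVec Δ.ofLp) (S.mulVec Δ.ofLp)) ∧
        σ2sq = Δ.ofLp ⬝ᵥ
          (S * (S + lam • 1)⁻¹ * Sigma * (S + lam • 1)⁻¹ * S).mulVec Δ.ofLp ∧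
        ρ = -4 * (Δ.ofLp ⬝ᵥ S.mulVec Δ.ofLp + (σ : ℝ) ^ 2)
          * (Δ.ofLp ⬝ᵥ (S * (S + lam • 1)⁻¹ * S).mulVec Δ.ofLp) ∧
        ρ ≤ 0 ∧
        (ρ < 0 ↔ S.mulVec θopt.ofLp ≠ 0) ∧
        (0 < σ → S.mulVec θopt.ofLp ≠ 0 → ∀ K : ℕ, 2 ≤ K →
          0 < σ1sq + σ2sq + 2 * ρ ∧
          (K : ℝ) < K * (1 + 2 * ρ / (σ1sq + σ2sq))⁻¹ ∧
          ∀ b : ℕ → ℕ → Fin K, (∀ n, BalancedFolds (b n) n) → ∀ j : Fin K,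
            Tendsto (fun n : ℕ =>
                (n : ℝ) * Var[fun ω => cvRisk (ridgeEstimator lam) sqLoss (b n) n
                  (dataset X ω); μ])
              atTop (𝓝 (σ1sq + σ2sq + 2 * ρ)) ∧
            ∃ s : ℝ, (K : ℝ) < s ∧
              Tendsto (fun n : ℕ =>
                  Var[fun ω => splitRisk (ridgeEstimator lam) sqLoss (b n) j n
                      (dataset X ω); μ]
                    / Var[fun ω => cvRisk (ridgeEstimator lam) sqLoss (b n) n
                      (dataset X ω); μ])
                atTop (𝓝 s))) := by
  have hN := GaussianNoise.of_condDistrib (hX.measurable_obs 0) hnoise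
  have hZ2 := hmoment.mono_exponent (by norm_num : (2 : ENNReal) ≤ 4)
  have hY := hN.memLp_snd (by simp) hmoment
  subst hθstar
  set θ := ridgeTarget lam (X 0) μ
  subst hΔ
  have hMt : M.transpose = M := by rw [hM]; exact secondMomentMatrix_transpose
  have hquad : ∀ u v : EuclideanSpace ℝ (Fin d), v.ofLp ⬝ᵥ M.mulVec u.ofLp
      = ∫ ω, inner ℝ (X 0 ω).1 u * inner ℝ (X 0 ω).1 v ∂μ := fun u v => by
    rw [hM, dotProduct_secondMomentMatrix hZ2]
  have hpos : ∀ v : EuclideanSpace ℝ (Fin d), 0 ≤ v.ofLp ⬝ᵥ M.mulVec v.ofLp := fun v => by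
    rw [hquad]; exact integral_nonneg fun ω => mul_self_nonneg _
  have hdet := isUnit_det_add_smul hpos hlam
  -- w = (M + λ)⁻¹MΔ. By symmetry of M, the row vector Δᵀ M (M + λ)⁻¹ in every formula is wᵀ.
  set w : EuclideanSpace ℝ (Fin d) :=
    WithLp.toLp 2 ((M + lam • 1)⁻¹.mulVec (M.mulVec (θ - θopt).ofLp)) with hwdef
  have hw' : (M + lam • (1 : Matrix (Fin d) (Fin d) ℝ)).mulVec w.ofLp
      = M.mulVec (θ - θopt).ofLp := by
    rw [hwdef, Matrix.mulVec_mulVec, Matrix.mul_nonsing_inv _ hdet, Matrix.one_mulVec]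
  have hw : M.mulVec w.ofLp + lam • w.ofLp = M.mulVec (θ - θopt).ofLp := by
    rwa [Matrix.add_mulVec, Matrix.smul_mulVec, Matrix.one_mulVec] at hw'
  have model := hN.ridgeModel hX hlam hmoment hM hw
  have hrho := model.isRho
  have hres : ∀ (N : Matrix (Fin d) (Fin d) ℝ) (y : Fin d → ℝ),
      (θ - θopt).ofLp ⬝ᵥ (M * (M + lam • 1)⁻¹ * N).mulVec y = w.ofLp ⬝ᵥ N.mulVec y := fun N y =>
    dotProduct_mul_inv_mul_mulVec hMt N _ y
  have general : IsRho (ridgeEstimator lam) sqLoss X X' Xt μ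
      (-2 * ((θ - θopt).ofLp ⬝ᵥ
        (M * (M + lam • 1)⁻¹ * (T + (2 * (σ : ℝ) ^ 2) • M)).mulVec (θ - θopt).ofLp)) := by
    convert hrho using 1
    rw [hres, Matrix.add_mulVec, Matrix.smul_mulVec, dotProduct_add, dotProduct_smul, hquad, hT,
      dotProduct_covMatrix (memLp_inner_smul hmoment _),
      hN.covariance_residual_sq_score hmoment]
    simp only [smul_eq_mul, mul_comm (inner ℝ (X 0 _).1 (θ - θopt))]
    ring
  have hSM : (∫ ω, (X 0 ω).1 ∂μ) = 0 → S = M := fun h0 => by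
    rw [hS, hM, covMatrix_eq_secondMomentMatrix hZ2 h0]
  refine ⟨general, fun h0 => by rw [hSM h0]; exact general, fun hG h0 => ?_⟩
  obtain rfl := hSM h0
  have hZ8 : MemLp (fun ω => (X 0 ω).1) 8 μ := hG.memLp (by simp)
  have hY8 := hN.memLp_snd (by simp) hZ8
  set Δ := θ - θopt with hΔ
  set v := ∫ ω, fitResidual θ (X 0 ω) ^ 2 ∂μ with hvdef
  set a := w.ofLp ⬝ᵥ S.mulVec Δ.ofLp with ha
  set q := w.ofLp ⬝ᵥ S.mulVec w.ofLp with hq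
  set D := Δ.ofLp ⬝ᵥ S.mulVec Δ.ofLp with hD
  have hv : v = D + (σ : ℝ) ^ 2 := by
    rw [hvdef, (hN.integral_residual hmoment θ 0).1, hD, hquad]
    simp only [pow_two]
    ring
  have ha' : Δ.ofLp ⬝ᵥ S.mulVec w.ofLp = a := by
    rw [ha, hquad, hquad]; simp only [mul_comm]
  have hrw : ∫ ω, fitResidual θ (X 0 ω) * inner ℝ (X 0 ω).1 w ∂μ = -a := by
    rw [(hN.integral_residual hmoment θ w).2.1, ha, hquad]
  have hV1 := hN.variance_residual_sq hG h0 θ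
  have hcov := hN.covariance_residual_sq_score_of_gaussian hG h0 θ w
  have hV2 : Var[fun ω => inner ℝ w (score θ (X 0 ω)); μ] = v * q + a ^ 2 := by
    rw [← covariance_self model.memLp_inner_score.aestronglyMeasurable.aemeasurable,
      hN.covariance_score hG h0, hrw, hq, hquad, hvdef]
    ring
  rw [hrw] at hcov
  have hSig : Sigma = (4 : ℝ) • (v • S
      + Matrix.vecMulVec (S.mulVec Δ.ofLp) (S.mulVec Δ.ofLp)) := by
    rw [hSigma, hN.covMatrix_gradient hG h0 θ hM]
  -- the order relations between the quadratic forms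
  have hnorm : q + lam * (w.ofLp ⬝ᵥ w.ofLp) = a := by
    rw [ha, hq, ← hw, dotProduct_add, dotProduct_smul, smul_eq_mul]
  have hww : 0 ≤ w.ofLp ⬝ᵥ w.ofLp := Finset.sum_nonneg fun i _ => mul_self_nonneg _
  have hq0 : 0 ≤ q := hpos w
  have hD0 : 0 ≤ D := hpos Δ
  -- Positivity of S at Δ − cw. The value c = 1 gives a ≤ D, and c = 2 gives positivity of the total
  -- variance.
  have hsq : ∀ c : ℝ, 0 ≤ D - 2 * c * a + c ^ 2 * q := fun c => by
    have h1 := hpos (Δ - c • w)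
    simp only [WithLp.ofLp_sub, WithLp.ofLp_smul, Matrix.mulVec_sub, Matrix.mulVec_smul,
      sub_dotProduct, dotProduct_sub, smul_dotProduct, dotProduct_smul, smul_eq_mul] at h1
    rw [ha', ← ha, ← hq, ← hD] at h1
    linarith
  have hlw := mul_nonneg hlam.le hww
  have hqa : q ≤ a := by linarith
  have ha0 : 0 ≤ a := by linarith
  have haD : a ≤ D := by have := hsq 1; linarith
  have hav : a ≤ v := by have := sq_nonneg (σ : ℝ); linarith
  have hv0 : 0 ≤ v := ha0.trans hav
  -- degenerate covariates
  have hSΔ : S.mulVec Δ.ofLp = -(lam • θ.ofLp) := by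
    have h1 := model.direction
    have h2 : S.mulVec w.ofLp + lam • w.ofLp = -(lam • θ.ofLp) := by
      have := congrArg WithLp.ofLp h1
      rwa [WithLp.ofLp_add, WithLp.ofLp_smul, Matrix.ofLp_toEuclideanCLM, WithLp.ofLp_neg,
        WithLp.ofLp_smul] at this
    rw [← hw, h2]
  -- If a = 0 then λ‖w‖² = 0, so w = 0 and SΔ = 0; then λθ = −SΔ = 0, hence Δ = −θopt and Sθopt = 0.
  have hapos : S.mulVec θopt.ofLp ≠ 0 → 0 < a := fun hne => by
    refine lt_of_le_of_ne ha0 fun h => hne ?_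
    have h1 : w.ofLp ⬝ᵥ w.ofLp = 0 := by
      have : lam * (w.ofLp ⬝ᵥ w.ofLp) = 0 := by linarith
      exact (mul_eq_zero.1 this).resolve_left hlam.ne'
    have h2 : S.mulVec Δ.ofLp = 0 := by
      rw [← hw, dotProduct_self_eq_zero.1 h1, Matrix.mulVec_zero, smul_zero, add_zero]
    have h3 : θ.ofLp = 0 := by
      rw [h2, eq_comm, neg_eq_zero] at hSΔ
      exact (smul_eq_zero.1 hSΔ).resolve_left hlam.ne'
    rw [hΔ, WithLp.ofLp_sub, h3, zero_sub, Matrix.mulVec_neg, neg_eq_zero] at h2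
    exact h2
  -- If Sθopt = 0 then Sθ = −λθ, which positivity of S permits only for θ = 0; then SΔ = 0.
  have hazero : S.mulVec θopt.ofLp = 0 → a = 0 := fun h => by
    have h1 : S.mulVec θ.ofLp = -(lam • θ.ofLp) := by
      rw [hΔ, WithLp.ofLp_sub, Matrix.mulVec_sub, h, sub_zero] at hSΔ
      exact hSΔ
    have h2 := hpos θ
    rw [h1, dotProduct_neg, dotProduct_smul, smul_eq_mul] at h2
    have h3 : 0 ≤ θ.ofLp ⬝ᵥ θ.ofLp := Finset.sum_nonneg fun i _ => mul_self_nonneg _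
    have h4 : lam * (θ.ofLp ⬝ᵥ θ.ofLp) = 0 := by
      have := mul_nonneg hlam.le h3
      linarith
    have h5 := dotProduct_self_eq_zero.1 ((mul_eq_zero.1 h4).resolve_left hlam.ne')
    rw [ha, hSΔ, h5, smul_zero, neg_zero, dotProduct_zero]
  refine ⟨2 * v ^ 2, 4 * (v * q + a ^ 2), -4 * v * a, ?_, ?_, ?_, ?_, ?_, ?_, ?_, ?_, ?_, ?_⟩
  · exact model.isSigmaOneSq hZ8 hY8 fun u => hN.integral_residual_pow_four hG h0 u
  · rw [← hV2]
    exact model.isSigmaTwoSq hZ8 hY8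
  · convert hrho using 1
    rw [hcov]
    ring
  · rw [hv]
  · rw [hSig, hv]
  -- Reassociated so that each outer resolvent block acts on Δ and becomes w, leaving wᵀ Σ w.
  · rw [Matrix.mul_assoc (S * (S + lam • 1)⁻¹ * Sigma), Matrix.mul_assoc (S * (S + lam • 1)⁻¹),
      hres, ← Matrix.mulVec_mulVec, ← Matrix.mulVec_mulVec]
    change _ = w.ofLp ⬝ᵥ Sigma.mulVec w.ofLp
    rw [hSig, Matrix.smul_mulVec, Matrix.add_mulVec, Matrix.smul_mulVec, Matrix.vecMulVec_mulVec,
      dotProduct_smul, dotProduct_add, dotProduct_smul, dotProduct_smul, ← ha, ← hq,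
      dotProduct_comm (S.mulVec Δ.ofLp), ← ha]
    simp only [smul_eq_mul, MulOpposite.smul_eq_mul_unop, MulOpposite.unop_op]
    ring
  · rw [hres, hv]
  · nlinarith [mul_nonneg hv0 ha0]
  · refine ⟨fun h hne => ?_, fun hne => ?_⟩
    · rw [hazero hne, mul_zero] at h
      exact lt_irrefl _ h
    · have h1 := hapos hne
      have := mul_pos (h1.trans_le hav) h1
      linarith
  · intro hσ hne K hK
    have hσ' : (0 : ℝ) < (σ : ℝ) ^ 2 := by
      have : (0 : ℝ) < σ := by exact_mod_cast hσ
      positivity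
    have hap := hapos hne
    have hvp := hap.trans_le hav
    have hK' : (2 : ℝ) ≤ K := by exact_mod_cast hK
    have htot := asymptoticVariance_pos (a := a) (q := q) hv hσ' hD0
      (by have := hsq 2; linarith)
    refine ⟨htot, lt_mul_inv_speedup (by linarith) htot
      (by have := mul_pos hvp hap; linarith), fun b hb j => ?_⟩
    have hcv := model.tendsto_mul_variance_cvRisk hZ8 hY8 hK hb
    have hsplit := model.tendsto_mul_variance_splitRisk hZ8 hY8 hK hb j
    rw [hV1, hV2] at hsplit
    rw [hV1, hV2, hcov] at hcv
    have hcv' : Tendsto (fun n : ℕ => (n : ℝ) * Var[fun ω => cvRisk (ridgeEstimator lam) sqLoss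
        (b n) n (dataset X ω); μ]) atTop
        (𝓝 (2 * v ^ 2 + 4 * (v * q + a ^ 2) + 2 * (-4 * v * a))) := by
      convert hcv using 2
      ring
    refine ⟨hcv', _, lt_split_div_cv hK' hvp hap hqa hav htot, ?_⟩
    -- The common factor n cancels in the ratio of the two scaled variances.
    refine (hsplit.div hcv' htot.ne').congr' ?_
    filter_upwards [eventually_gt_atTop 0] with n hn
    have hn' : (n : ℝ) ≠ 0 := by exact_mod_cast hn.ne'
    exact mul_div_mul_left _ _ hn'
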